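/- Let $d\ge 2$ and $\mu>0$. Let $V:\mathbb{R}^d\to\mathbb{R}$ be measurable, not almost everywhere zero, with $\int V\,dx\le 0$ (that is, $V_+=\max(V,0)\in L^1(\mathbb{R}^d)$ and $\int V_+\,dx\le\int V_-\,dx\in[0,\infty]$ with $V_-=\max(-V,0)$), and relatively form compact with respect to $|p^2-\mu|$, where $p=-i\nabla$; that is, $(|p^2-\mu|+1)^{-1/2}\,|V|\,(|p^2-\mu|+1)^{-1/2}$ is a compact operator on $L^2(\mathbb{R}^d)$. For $\beta>0$ put $$K_{\beta,\mu}(\eta)=(\eta^2-\mu)\,\frac{e^{\beta(\eta^2-\mu)}+1}{e^{\beta(\eta^2-\mu)}-1}\quad(\eta^2\ne\mu),\qquad K_{\beta,\mu}(\eta)=\frac{2}{\beta}\quad(\eta^2=\mu),$$ and let $|p^2-\mu|+V$ and $K_{\beta,\mu}(p)+V$ be the operators on $L^2(\mathbb{R}^d)$ defined as sums of quadratic forms. Let $\beta_{\mathrm{cr}}(V)=\sup\{\beta>0:\ \inf\sigma(K_{\beta,\mu}(p)+V)\ge 0\}\in[0,\infty]$ be the critical inverse temperature and $T_{\mathrm{cr}}(V)=\beta_{\mathrm{cr}}(V)^{-1}$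 the critical temperature. Then: (i) $|p^2-\mu|+V$ has at least one strictly negative eigenvalue, and if in addition $V\le 0$, it has infinitely many. (ii) For all $\beta>0$ the operator $K_{\beta,\mu}(p)+V$ has at least one eigenvalue strictly below $2\beta^{-1}$, and if in addition $V\le0$, it has infinitely many. The ground state energy $E_\beta=\inf\sigma(K_{\beta,\mu}(p)+V)$ is an eigenvalue; it is strictly decreasing in $\beta>0$, and $E_\beta<0$ for all large enough $\beta$. (iii) $0<\beta_{\mathrm{cr}}(V)<\infty$, hence $T_{\mathrm{cr}}(V)>0$. If $0<\beta<\beta_{\mathrm{cr}}(V)$, then $\inf\sigma(K_{\beta,\mu}(p)+V)>0$, and if $\beta>\beta_{\mathrm{cr}}(V)$, then $\inf\sigma(K_{\beta,\mu}(p)+V)<0$. -/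

import Mathlib

open MeasureTheory
open scoped FourierTransform ENNReal ComplexConjugate

/-! ### Unbounded operators on a complex Hilbert space -/

section Unbounded

variable {H : Type*} [NormedAddCommGroup H] [InnerProductSpace ℂ H]

/-- `z` is an eigenvalue of the unbounded operator `A`. -/
def IsEigenvalue (A : H →ₗ.[ℂ] H) (z : ℂ) : Prop :=
  ∃ ψ : A.domain, (ψ : H) ≠ 0 ∧ A ψ = z • (ψ : H)

/-- The spectrum of an unbounded operator `A`: the set of all `z` for which `A - z` does not have
an everywhere defined bounded two-sided inverse `R`. -/
def unboundedSpectrum (A : H →ₗ.[ℂ] H) : Set ℂ :=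
  {z | ¬ ∃ R : H →L[ℂ] H,
    (∀ f : H, ∃ h : R f ∈ A.domain, A ⟨R f, h⟩ - z • R f = f) ∧
    (∀ ψ : A.domain, R (A ψ - z • (ψ : H)) = ψ)}

/-- The real points of the spectrum (all of the spectrum, if `A` is self-adjoint). -/
def realSpectrum (A : H →ₗ.[ℂ] H) : Set ℝ :=
  {E | (E : ℂ) ∈ unboundedSpectrum A}

/-- `inf σ(A)`. -/
noncomputable def infSpectrum (A : H →ₗ.[ℂ] H) : ℝ :=
  sInf (realSpectrum A)

end Unbounded

/-! ### The form sum `T(p) + V` on `L²(ℝᵈ)` -/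

/-- Configuration (and momentum) space `ℝᵈ`. -/
abbrev Rd (d : ℕ) : Type := EuclideanSpace ℝ (Fin d)

/-- The Hilbert space `L²(ℝᵈ; ℂ)`. -/
abbrev L2Rd (d : ℕ) : Type := Lp ℂ 2 (volume : Measure (Rd d))

section FormSum

variable {d : ℕ}

/-- `φ = m(p) f`, where `p = -i∇`. Mathlib's Fourier transform on `L²` has the phase
`exp(-2πi x·ξ)`, so that the momentum is `η = 2πξ`. -/
def IsFourierMultiplier (m : Rd d → ℝ) (f φ : L2Rd d) : Prop :=
  ∀ᵐ ξ : Rd d, (𝓕 φ : L2Rd d) ξ = (m ((2 * Real.pi) • ξ) : ℂ) * (𝓕 f : L2Rd d) ξ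

/-- `V` is relatively form compact with respect to `T(p)`:
`(T(p) + 1)^(-1/2) |V| (T(p) + 1)^(-1/2)` is (given by) a compact operator `C` on `L²`. -/
def IsRelFormCompact (T V : Rd d → ℝ) : Prop :=
  ∃ C : L2Rd d →L[ℂ] L2Rd d, IsCompactOperator C ∧
    ∀ f g φ γ : L2Rd d,
      IsFourierMultiplier (fun η => (Real.sqrt (T η + 1))⁻¹) f φ →
      IsFourierMultiplier (fun η => (Real.sqrt (T η + 1))⁻¹) g γ →
      Integrable (fun x : Rd d => ((|V x| : ℝ) : ℂ) * (conj (φ x) * γ x)) ∧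
      inner ℂ f (C g) = ∫ x : Rd d, ((|V x| : ℝ) : ℂ) * (conj (φ x) * γ x)

/-- `ψ ↦ w |ψ|²` is integrable: the form domain of multiplication by `w`. -/
def FiniteForm (w : Rd d → ℝ) (ψ : L2Rd d) : Prop :=
  Integrable (fun x : Rd d => w x * ‖ψ x‖ ^ 2)

theorem FiniteForm.integrable_mul {w : Rd d → ℝ} (hw : AEMeasurable w) {φ ψ : L2Rd d}
    (hφ : FiniteForm w φ) (hψ : FiniteForm w ψ) :
    Integrable (fun x : Rd d => (w x : ℂ) * (conj (φ x) * ψ x)) := by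
  have hm : AEStronglyMeasurable (fun x : Rd d => (w x : ℂ) * (conj (φ x) * ψ x)) := by
    have h1 : AEStronglyMeasurable (fun x : Rd d => (w x : ℂ)) :=
      (Complex.measurable_ofReal.comp_aemeasurable hw).aestronglyMeasurable
    have h2 : AEStronglyMeasurable (fun x : Rd d => conj (φ x)) :=
      Complex.continuous_conj.comp_aestronglyMeasurable (Lp.aestronglyMeasurable φ)
    exact h1.mul (h2.mul (Lp.aestronglyMeasurable ψ))
  have hφ' : Integrable (fun x : Rd d => w x * ‖φ x‖ ^ 2) := hφ
  have hψ' : Integrable (fun x : Rd d => w x * ‖ψ x‖ ^ 2) := hψ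
  refine (hφ'.norm.add hψ'.norm).mono' hm (Filter.Eventually.of_forall fun x => ?_)
  simp only [norm_mul, Complex.norm_real, RCLike.norm_conj, Real.norm_eq_abs, Pi.add_apply,
    abs_norm, abs_pow]
  have := abs_nonneg (w x)
  nlinarith [mul_nonneg this (sq_nonneg (‖φ x‖ - ‖ψ x‖)),
    mul_nonneg this (sq_nonneg ‖φ x‖), mul_nonneg this (sq_nonneg ‖ψ x‖)]

theorem FiniteForm.add {w : Rd d → ℝ} (hw : AEMeasurable w) {φ ψ : L2Rd d}
    (hφ : FiniteForm w φ) (hψ : FiniteForm w ψ) : FiniteForm w (φ + ψ) := by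
  have hφ' : Integrable (fun x : Rd d => w x * ‖φ x‖ ^ 2) := hφ
  have hψ' : Integrable (fun x : Rd d => w x * ‖ψ x‖ ^ 2) := hψ
  have hm : AEStronglyMeasurable (fun x : Rd d => w x * ‖(φ + ψ) x‖ ^ 2) :=
    hw.aestronglyMeasurable.mul ((Lp.aestronglyMeasurable (φ + ψ)).norm.pow 2)
  refine ((hφ'.norm.add hψ'.norm).const_mul 2).mono' hm ?_
  filter_upwards [Lp.coeFn_add φ ψ] with x hx
  simp only [hx, Pi.add_apply, norm_mul, Real.norm_eq_abs, abs_pow, abs_norm]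
  have h0 := abs_nonneg (w x)
  have h1 : ‖φ x + ψ x‖ ^ 2 ≤ 2 * (‖φ x‖ ^ 2 + ‖ψ x‖ ^ 2) := by
    have h2 := norm_add_le (φ x) (ψ x)
    have h3 := norm_nonneg (φ x + ψ x)
    nlinarith [sq_nonneg (‖φ x‖ - ‖ψ x‖)]
  nlinarith [mul_le_mul_of_nonneg_left h1 h0]

theorem FiniteForm.smul {w : Rd d → ℝ} (c : ℂ) {ψ : L2Rd d}
    (hψ : FiniteForm w ψ) : FiniteForm w (c • ψ) := by
  have hψ' : Integrable (fun x : Rd d => w x * ‖ψ x‖ ^ 2) := hψ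
  refine (hψ'.const_mul (‖c‖ ^ 2)).congr ?_
  filter_upwards [Lp.coeFn_smul c ψ] with x hx
  simp only [hx, Pi.smul_apply, norm_smul]
  ring

theorem FiniteForm.zero (w : Rd d → ℝ) : FiniteForm w (0 : L2Rd d) := by
  refine (integrable_zero (Rd d) ℝ volume).congr ?_
  filter_upwards [Lp.coeFn_zero ℂ 2 (volume : Measure (Rd d))] with x hx
  simp [hx]

/-- The symbol `T` read in Mathlib's Fourier variable `ξ = η / 2π`. -/
noncomputable def symbolFourier (T : Rd d → ℝ) (ξ : Rd d) : ℝ := T ((2 * Real.pi) • ξ)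

theorem measurable_symbolFourier {T : Rd d → ℝ} (hT : Measurable T) :
    Measurable (symbolFourier T) :=
  hT.comp (measurable_const_smul _)

/-- The form domain of `T(p) + V`: all `ψ ∈ L²` with `∫ T |ψ̂|² < ∞` and `∫ |V| |ψ|² < ∞`.
If `V` is relatively form bounded with respect to `T(p) ≥ 0`, the second condition follows from
the first, and this is the form domain of `T(p)`. -/
noncomputable def formDomain (T V : Rd d → ℝ) (hT : Measurable T) (hV : AEMeasurable V) :
    Submodule ℂ (L2Rd d) where
  carrier := {ψ | FiniteForm (symbolFourier T) (𝓕 ψ : L2Rd d) ∧ FiniteForm V ψ}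
  zero_mem' := by
    refine ⟨?_, FiniteForm.zero V⟩
    have h : (𝓕 (0 : L2Rd d) : L2Rd d) = 0 := map_zero (Lp.fourierTransformₗᵢ (Rd d) ℂ)
    rw [h]
    exact FiniteForm.zero _
  add_mem' := by
    rintro φ ψ ⟨h1, h2⟩ ⟨h3, h4⟩
    refine ⟨?_, h2.add hV h4⟩
    have h : (𝓕 (φ + ψ) : L2Rd d) = 𝓕 φ + 𝓕 ψ := map_add (Lp.fourierTransformₗᵢ (Rd d) ℂ) φ ψ
    rw [h]
    exact h1.add (measurable_symbolFourier hT).aemeasurable h3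
  smul_mem' := by
    rintro c ψ ⟨h1, h2⟩
    refine ⟨?_, h2.smul c⟩
    have h : (𝓕 (c • ψ) : L2Rd d) = c • 𝓕 ψ := map_smul (Lp.fourierTransformₗᵢ (Rd d) ℂ) c ψ
    rw [h]
    exact h1.smul c

/-- `∫ w conj(φ) ψ`. -/
noncomputable def weightedForm (w : Rd d → ℝ) (φ ψ : L2Rd d) : ℂ :=
  ∫ x : Rd d, (w x : ℂ) * (conj (φ x) * ψ x)

theorem weightedForm_add {w : Rd d → ℝ} (hw : AEMeasurable w) {φ ψ χ : L2Rd d}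
    (hφ : FiniteForm w φ) (hψ : FiniteForm w ψ) (hχ : FiniteForm w χ) :
    weightedForm w φ (ψ + χ) = weightedForm w φ ψ + weightedForm w φ χ := by
  unfold weightedForm
  rw [← integral_add (hφ.integrable_mul hw hψ) (hφ.integrable_mul hw hχ)]
  refine integral_congr_ae ?_
  filter_upwards [Lp.coeFn_add ψ χ] with x hx
  simp only [hx, Pi.add_apply]
  ring

theorem weightedForm_smul (w : Rd d → ℝ) (c : ℂ) (φ ψ : L2Rd d) :
    weightedForm w φ (c • ψ) = c * weightedForm w φ ψ := by
  unfold weightedForm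
  rw [← integral_const_mul]
  refine integral_congr_ae ?_
  filter_upwards [Lp.coeFn_smul c ψ] with x hx
  simp only [hx, Pi.smul_apply, smul_eq_mul]
  ring

theorem weightedForm_zero (w : Rd d → ℝ) (φ : L2Rd d) : weightedForm w φ 0 = 0 := by
  simpa using weightedForm_smul w 0 φ 0

/-- The sesquilinear form `⟨φ, (T(p) + V) ψ⟩ = ∫ T conj(φ̂) ψ̂ + ∫ V conj(φ) ψ`. -/
noncomputable def formSumForm (T V : Rd d → ℝ) (φ ψ : L2Rd d) : ℂ :=
  weightedForm (symbolFourier T) (𝓕 φ) (𝓕 ψ) + weightedForm V φ ψ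

/-- The graph of the operator associated with the form of `T(p) + V`: the pairs `(ψ, f)` with `ψ`
in the form domain and `⟨φ, (T(p) + V) ψ⟩ = ⟨φ, f⟩` for all `φ` in the form domain. -/
noncomputable def formSumGraph (T V : Rd d → ℝ) (hT : Measurable T) (hV : AEMeasurable V) :
    Submodule ℂ (L2Rd d × L2Rd d) where
  carrier := {z | z.1 ∈ formDomain T V hT hV ∧
    ∀ φ ∈ formDomain T V hT hV, formSumForm T V φ z.1 = inner ℂ φ z.2}
  zero_mem' := by
    refine ⟨zero_mem _, fun φ _ => ?_⟩
    have h : (𝓕 (0 : L2Rd d) : L2Rd d) = 0 := map_zero (Lp.fourierTransformₗᵢ (Rd d) ℂ)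
    simp [formSumForm, h, weightedForm_zero]
  add_mem' := by
    rintro ⟨ψ, f⟩ ⟨χ, g⟩ ⟨h1, h2⟩ ⟨h3, h4⟩
    refine ⟨add_mem h1 h3, fun φ hφ => ?_⟩
    have h : (𝓕 (ψ + χ) : L2Rd d) = 𝓕 ψ + 𝓕 χ := map_add (Lp.fourierTransformₗᵢ (Rd d) ℂ) ψ χ
    have e1 := h2 φ hφ
    have e2 := h4 φ hφ
    simp only [formSumForm, Prod.mk_add_mk, inner_add_right] at e1 e2 ⊢
    rw [h, weightedForm_add (measurable_symbolFourier hT).aemeasurable hφ.1 h1.1 h3.1,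
      weightedForm_add hV hφ.2 h1.2 h3.2, ← e1, ← e2]
    ring
  smul_mem' := by
    rintro c ⟨ψ, f⟩ ⟨h1, h2⟩
    refine ⟨Submodule.smul_mem _ c h1, fun φ hφ => ?_⟩
    have h : (𝓕 (c • ψ) : L2Rd d) = c • 𝓕 ψ := map_smul (Lp.fourierTransformₗᵢ (Rd d) ℂ) c ψ
    have e1 := h2 φ hφ
    simp only [formSumForm, Prod.smul_mk, inner_smul_right] at e1 ⊢
    rw [h, weightedForm_smul, weightedForm_smul, ← e1]
    ring

/-- The operator `T(p) + V` on `L²(ℝᵈ)`, defined as a form sum. (Its graph is single valued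
whenever the form domain is dense, see `formSum_graph`.) -/
noncomputable def formSum (T V : Rd d → ℝ) (hT : Measurable T) (hV : AEMeasurable V) :
    L2Rd d →ₗ.[ℂ] L2Rd d :=
  (formSumGraph T V hT hV).toLinearPMap

theorem formSum_graph (T V : Rd d → ℝ) (hT : Measurable T) (hV : AEMeasurable V)
    (hd : Dense (formDomain T V hT hV : Set (L2Rd d))) :
    (formSum T V hT hV).graph = formSumGraph T V hT hV := by
  refine Submodule.toLinearPMap_graph_eq _ ?_
  rintro ⟨ψ, f⟩ ⟨_, h2⟩ h0
  obtain rfl : ψ = 0 := h0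
  refine hd.eq_zero_of_inner_right (𝕜 := ℂ) fun φ hφ => ?_
  have h : (𝓕 (0 : L2Rd d) : L2Rd d) = 0 := map_zero (Lp.fourierTransformₗᵢ (Rd d) ℂ)
  have e := h2 φ hφ
  simp only [formSumForm, h, weightedForm_zero, add_zero] at e
  exact e.symm

end FormSum

/-! ### BCS operators -/

section BCS

variable {d : ℕ}

/-- The zero temperature symbol `|η² - μ|`. -/
noncomputable def bcsSymbolInfty (d : ℕ) (μ : ℝ) (η : Rd d) : ℝ := |‖η‖ ^ 2 - μ|

open Classical in
/-- The symbol `K_{β,μ}(η) = (η² - μ) (e^{β(η² - μ)} + 1) / (e^{β(η² - μ)} - 1)`, extended by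
`2 / β` to `η² = μ`. -/
noncomputable def bcsSymbol (d : ℕ) (β μ : ℝ) (η : Rd d) : ℝ :=
  if ‖η‖ ^ 2 = μ then 2 / β
  else (‖η‖ ^ 2 - μ) * ((Real.exp (β * (‖η‖ ^ 2 - μ)) + 1) / (Real.exp (β * (‖η‖ ^ 2 - μ)) - 1))

theorem measurable_bcsSymbolInfty (d : ℕ) (μ : ℝ) : Measurable (bcsSymbolInfty d μ) := by
  unfold bcsSymbolInfty
  fun_prop

theorem measurable_bcsSymbol (d : ℕ) (β μ : ℝ) : Measurable (bcsSymbol d β μ) := by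
  unfold bcsSymbol
  refine Measurable.ite ?_ measurable_const (by fun_prop)
  exact measurableSet_eq_fun (by fun_prop) measurable_const

/-- The operator `|p² - μ| + V`. -/
noncomputable def bcsOperatorInfty (μ : ℝ) (V : Rd d → ℝ) (hV : AEMeasurable V) :
    L2Rd d →ₗ.[ℂ] L2Rd d :=
  formSum (bcsSymbolInfty d μ) V (measurable_bcsSymbolInfty d μ) hV

/-- The operator `K_{β,μ}(p) + V`. -/
noncomputable def bcsOperator (β μ : ℝ) (V : Rd d → ℝ) (hV : AEMeasurable V) :
    L2Rd d →ₗ.[ℂ] L2Rd d :=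
  formSum (bcsSymbol d β μ) V (measurable_bcsSymbol d β μ) hV

/-- The critical inverse temperature `sup {β > 0 : inf σ(K_{β,μ}(p) + V) ≥ 0}`, in `[0, ∞]`. -/
noncomputable def betaCritical (μ : ℝ) (V : Rd d → ℝ) (hV : AEMeasurable V) : ℝ≥0∞ :=
  sSup (ENNReal.ofReal '' {β : ℝ | 0 < β ∧ 0 ≤ infSpectrum (bcsOperator β μ V hV)})

/-- The critical temperature, the inverse of the critical inverse temperature, in `[0, ∞]`. -/
noncomputable def criticalTemperature (μ : ℝ) (V : Rd d → ℝ) (hV : AEMeasurable V) : ℝ≥0∞ :=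
  (betaCritical μ V hV)⁻¹

end BCS

/-! Write `T = |p² - μ|` and `K_β = K_{β,μ}(p)`. The engine is that `1/T` is not integrable near any
point of the Fermi sphere, since `T` vanishes there to first order on a hypersurface
(`lintegral_inv_symbol_eq_top`). Hence momentum densities of mass one can concentrate at a point of
the sphere while their kinetic energy tends to zero (`exists_concentrating_density`). Their inverse
Fourier transforms are bounded by one and converge pointwise to a plane wave (`exists_wavePackets`),
so in the limit only the potential energy is left: it is at most `∫ W ≤ 0`, where `W ≥ V` is an
integrable majorant. The borderline case of a vanishing integral is made strictly negative by a
first order perturbation (`exists_formEnergy_neg`). If `V ≤ 0`, many plane waves are superposed,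
which is possible because the sphere is infinite for `d ≥ 2`; linear algebra makes the combination
orthogonal to a given finite dimensional space, and a nontrivial sum of plane waves vanishes only on
a null set (`exists_formEnergy_neg_orthogonal`).

To pass from trial states to eigenvalues, `M(p) + V - E` is conjugated with `G = (M(p) + 1)^(-1/2)`.
This gives the bounded `pencil` `1 + B - (1 + E) G²` with `B = G V G` compact. For `E` below a lower
bound `m` of `M` it is an invertible operator plus a compact one, so the Fredholm alternative holds.
Negativity of the form at level `m` then produces a ground state (`exists_ground_state_pencil`), and
negativity on all finite codimensional spaces produces infinitely many eigenvalues
(`infinite_eigenvalues_pencil`). `IsFormFactorization` carries both back to the form sum.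

Temperature enters through `T ≤ K_β ≤ T + 2/β` and `K_β ≥ 2/β`. A state of negative energy for `T +
V` lies below the threshold `2/β` for `K_β + V`, which gives a ground state at every `β`. The symbol
decreases strictly in `β`, hence so does the ground state energy; it is nonnegative for some small
`β` and negative for all large `β`. The critical value is therefore positive and finite, with strict
signs on either side. -/

/-! ### Compact operators and quadratic forms on a Hilbert space -/

section Pencil

variable {H : Type*} [NormedAddCommGroup H] [InnerProductSpace ℂ H]

/-- An operator whose quadratic form is dominated by that of a compact operator is compact. -/
theorem isCompactOperator_of_norm_sq_le {F : Type*} [NormedAddCommGroup F] [NormedSpace ℂ F]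
    [CompleteSpace F] (X : H →L[ℂ] F) (C : H →L[ℂ] H) (hC : IsCompactOperator C)
    (h : ∀ f, ‖X f‖ ^ 2 ≤ ‖f‖ * ‖C f‖) : IsCompactOperator X := by
  have hC' : IsCompactOperator (C : H →ₗ[ℂ] H) := hC
  have hcl := (hC'.isCompact_closure_image_closedBall 1).totallyBounded.subset subset_closure
  suffices hX : TotallyBounded (X '' Metric.closedBall 0 1) from
    (isCompactOperator_iff_isCompact_closure_image_closedBall (X : H →ₗ[ℂ] F) one_pos).2
      (TotallyBounded.isCompact_of_isClosed hX.closure isClosed_closure)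
  rw [Metric.totallyBounded_iff]
  intro ε hε
  -- The width is `ε² / 2` because differences of points of the unit ball have norm at most `2`, so
  -- `‖X (f - p y)‖² ≤ 2 ‖C (f - p y)‖ < ε²`.
  obtain ⟨t, hts, htf, hcov⟩ := Metric.finite_approx_of_totallyBounded hcl (ε ^ 2 / 2)
    (by positivity)
  have hts' : ∀ y ∈ t, ∃ p ∈ Metric.closedBall (0 : H) 1, C p = y := fun y hy => hts hy
  choose! p hp hpC using hts'
  refine ⟨(fun y => X (p y)) '' t, htf.image _, ?_⟩
  rintro _ ⟨f, hf, rfl⟩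
  obtain ⟨y, hy, hfy⟩ := Set.mem_iUnion₂.1 (hcov ⟨f, hf, rfl⟩)
  refine Set.mem_iUnion₂.2 ⟨X (p y), ⟨y, hy, rfl⟩, ?_⟩
  have h1 := h (f - p y)
  have h2 : ‖f - p y‖ ≤ 2 := by
    have a := mem_closedBall_zero_iff.1 hf
    have b := mem_closedBall_zero_iff.1 (hp y hy)
    linarith [norm_sub_le f (p y)]
  have h3 : ‖C (f - p y)‖ < ε ^ 2 / 2 := by
    rw [map_sub, hpC y hy, ← dist_eq_norm]
    exact hfy
  rw [Metric.mem_ball, dist_eq_norm, ← map_sub]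
  refine lt_of_pow_lt_pow_left₀ 2 hε.le (h1.trans_lt ?_)
  nlinarith [norm_nonneg (f - p y), norm_nonneg (C (f - p y))]

/-- A compact form is infinitesimally bounded with respect to `‖G f‖²`, when `G` is symmetric and
has dense range. -/
theorem IsCompactOperator.exists_inner_le {C G : H →L[ℂ] H} (hC : IsCompactOperator C)
    (hGs : ∀ f g, inner ℂ (G f) g = inner ℂ f (G g)) (hGd : DenseRange G) {ε : ℝ} (hε : 0 < ε) :
    ∃ K : ℝ, 0 ≤ K ∧ ∀ f, ‖inner ℂ f (C f)‖ ≤ ε * ‖f‖ ^ 2 + K * ‖G f‖ ^ 2 := by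
  have hC' : IsCompactOperator (C : H →ₗ[ℂ] H) := hC
  have hcl := (hC'.isCompact_closure_image_closedBall 1).totallyBounded.subset subset_closure
  obtain ⟨t, hts, htf, hcov⟩ := Metric.finite_approx_of_totallyBounded hcl (ε / 4) (by positivity)
  have hap : ∀ y : H, ∃ u : H, dist y (G u) < ε / 4 := fun y => by
    obtain ⟨u, hu⟩ := hGd.exists_dist_lt y (ε := ε / 4) (by positivity)
    exact ⟨u, hu⟩
  choose u hu using hap
  obtain ⟨M, hM⟩ := (htf.image fun y => ‖u y‖).bddAbove
  have hM' : ∀ y ∈ t, ‖u y‖ ≤ max M 0 := fun y hy => (hM ⟨y, hy, rfl⟩).trans (le_max_left _ _)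
  set N := max M 0 with hN
  have hN0 : 0 ≤ N := le_max_right _ _
  have key : ∀ f, ‖f‖ = 1 → ‖inner ℂ f (C f)‖ ≤ ε / 2 + N * ‖G f‖ := by
    intro f hf
    obtain ⟨y, hy, hfy⟩ := Set.mem_iUnion₂.1 (hcov ⟨f, by simp [hf], rfl⟩)
    have h1 : ‖C f - G (u y)‖ ≤ ε / 2 := by
      rw [← dist_eq_norm]
      have h2 := dist_triangle (C f) y (G (u y))
      have h3 : dist (C f) y < ε / 4 := hfy
      linarith [hu y]
    -- `C f` is close to one of finitely many vectors `G (u y)`, and symmetry moves `G` onto `f`;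
    -- only `‖G f‖` then enters, with a uniform constant.
    have h4 : inner ℂ f (C f) = inner ℂ f (C f - G (u y)) + inner ℂ (G f) (u y) := by
      rw [inner_sub_right, hGs]; ring
    rw [h4]
    refine (norm_add_le _ _).trans (add_le_add ?_ ?_)
    · exact (norm_inner_le_norm _ _).trans (by rw [hf, one_mul]; exact h1)
    · refine (norm_inner_le_norm _ _).trans ?_
      rw [mul_comm]
      exact mul_le_mul_of_nonneg_right (hM' y hy) (norm_nonneg _)
  -- The constant comes from completing the square in the cross term `N ‖G f‖ ‖f‖`.
  refine ⟨N ^ 2 / (2 * ε), by positivity, fun f => ?_⟩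
  by_cases hf : f = 0
  · simp [hf]
  have hf0 : 0 < ‖f‖ := norm_pos_iff.2 hf
  have h5 := key ((‖f‖⁻¹ : ℂ) • f) (by
    rw [norm_smul, norm_inv, Complex.norm_real, norm_norm, inv_mul_cancel₀ hf0.ne'])
  simp only [map_smul, inner_smul_left, inner_smul_right, norm_mul, norm_smul, norm_inv,
    Complex.norm_real, norm_norm, RCLike.norm_conj, map_inv₀] at h5
  have h6 : ‖inner ℂ f (C f)‖ ≤ ε / 2 * ‖f‖ ^ 2 + N * ‖G f‖ * ‖f‖ := by
    have h7 := mul_le_mul_of_nonneg_right h5 (sq_nonneg ‖f‖)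
    have e1 : ‖f‖⁻¹ * (‖f‖⁻¹ * ‖inner ℂ f (C f)‖) * ‖f‖ ^ 2 = ‖inner ℂ f (C f)‖ := by
      field_simp
    have e2 : (ε / 2 + N * (‖f‖⁻¹ * ‖G f‖)) * ‖f‖ ^ 2
        = ε / 2 * ‖f‖ ^ 2 + N * ‖G f‖ * ‖f‖ := by
      field_simp
    rwa [e1, e2] at h7
  have h8 : N * ‖G f‖ * ‖f‖ ≤ ε / 2 * ‖f‖ ^ 2 + N ^ 2 / (2 * ε) * ‖G f‖ ^ 2 := by
    have : ε / 2 * ‖f‖ ^ 2 + N ^ 2 / (2 * ε) * ‖G f‖ ^ 2 - N * ‖G f‖ * ‖f‖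
        = (ε * ‖f‖ - N * ‖G f‖) ^ 2 / (2 * ε) := by field_simp; ring
    have h9 : 0 ≤ (ε * ‖f‖ - N * ‖G f‖) ^ 2 / (2 * ε) := by positivity
    linarith
  linarith

/-- `1 + B - (1 + E) G²`: if `G = (T + 1)^(-1/2)` and `B = G V G`, this is
`G (T + V - E) G`. -/
noncomputable def pencil (G B : H →L[ℂ] H) (E : ℝ) : H →L[ℂ] H :=
  ContinuousLinearMap.id ℂ H + B - ((1 + E : ℝ) : ℂ) • (G ∘L G)

theorem pencil_apply (G B : H →L[ℂ] H) (E : ℝ) (f : H) :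
    pencil G B E f = f + B f - ((1 + E : ℝ) : ℂ) • G (G f) := rfl

variable {G B : H →L[ℂ] H}

theorem inner_pencil (hGs : ∀ f g, inner ℂ (G f) g = inner ℂ f (G g)) (E : ℝ) (f g : H) :
    inner ℂ f (pencil G B E g)
      = inner ℂ f g + inner ℂ f (B g) - ((1 + E : ℝ) : ℂ) * inner ℂ (G f) (G g) := by
  rw [pencil_apply, inner_sub_right, inner_add_right, inner_smul_right, hGs]

theorem re_inner_pencil (hGs : ∀ f g, inner ℂ (G f) g = inner ℂ f (G g)) (E : ℝ) (f : H) :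
    (inner ℂ f (pencil G B E f)).re
      = ‖f‖ ^ 2 + (inner ℂ f (B f)).re - (1 + E) * ‖G f‖ ^ 2 := by
  rw [inner_pencil hGs, Complex.sub_re, Complex.add_re, Complex.re_ofReal_mul,
    inner_self_eq_norm_sq_to_K, inner_self_eq_norm_sq_to_K]
  norm_cast

theorem re_inner_pencil_sub (hGs : ∀ f g, inner ℂ (G f) g = inner ℂ f (G g)) (E F : ℝ) (f : H) :
    (inner ℂ f (pencil G B E f)).re
      = (inner ℂ f (pencil G B F f)).re + (F - E) * ‖G f‖ ^ 2 := by
  rw [re_inner_pencil hGs, re_inner_pencil hGs]; ring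

theorem inner_pencil_symm (hGs : ∀ f g, inner ℂ (G f) g = inner ℂ f (G g))
    (hBs : ∀ f g, inner ℂ (B f) g = inner ℂ f (B g)) (E : ℝ) (f g : H) :
    inner ℂ (pencil G B E f) g = inner ℂ f (pencil G B E g) := by
  rw [inner_pencil hGs, pencil_apply, inner_sub_left, inner_add_left, inner_smul_left, hBs, hGs,
    Complex.conj_ofReal]

/-- Factoring out the unperturbed pencil leaves `1 + P⁻¹ B`, a compact perturbation of the identity
when `B` is compact. -/
theorem pencil_eq_comp {P : (H →L[ℂ] H)ˣ} {E : ℝ} (hP : (P : H →L[ℂ] H) = pencil G 0 E) :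
    pencil G B E = P * (1 + ↑P⁻¹ * B) := by
  rw [mul_add, mul_one, ← mul_assoc, Units.mul_inv, one_mul, hP]
  ext f
  simp only [pencil_apply, add_apply, zero_apply]
  abel

/-- A nonnegative invertible self-adjoint operator is coercive. -/
theorem exists_coercive_of_isUnit {N : H →L[ℂ] H} (hN : IsUnit N)
    (hs : ∀ f g, inner ℂ (N f) g = inner ℂ f (N g))
    (hpos : ∀ f, 0 ≤ (inner ℂ f (N f)).re) :
    ∃ c : ℝ, 0 < c ∧ ∀ f, c * ‖f‖ ^ 2 ≤ (inner ℂ f (N f)).re := by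
  obtain ⟨U, hNU⟩ := hN
  set K : ℝ := ‖N‖ + 1 with hK
  set L : ℝ := ‖(↑U⁻¹ : H →L[ℂ] H)‖ + 1 with hL
  have hK0 : 0 < K := by positivity
  have hL0 : 0 < L := by positivity
  refine ⟨1 / (K * L ^ 2), by positivity, fun f => ?_⟩
  have h1 : ‖f‖ ≤ L * ‖N f‖ := by
    have h2 : (↑U⁻¹ : H →L[ℂ] H) (N f) = f := by
      rw [← hNU, ← mul_apply_eq_comp, Units.inv_mul]; rfl
    calc ‖f‖ = ‖(↑U⁻¹ : H →L[ℂ] H) (N f)‖ := by rw [h2]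
      _ ≤ ‖(↑U⁻¹ : H →L[ℂ] H)‖ * ‖N f‖ := ContinuousLinearMap.le_opNorm _ _
      _ ≤ L * ‖N f‖ := by gcongr; linarith
  -- Testing positivity on `f - K⁻¹ N f` with `K ≥ ‖N‖` gives `⟨f, N f⟩ ≥ ‖N f‖² / K` without a
  -- square root of `N`; invertibility then bounds `‖N f‖` from below.
  have h3 := hpos (f - ((K⁻¹ : ℝ) : ℂ) • N f)
  have h4 : (inner ℂ (N f) (N (N f))).re ≤ K * ‖N f‖ ^ 2 := by
    refine (Complex.re_le_norm _).trans ((norm_inner_le_norm _ _).trans ?_)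
    have := N.le_opNorm (N f)
    nlinarith [norm_nonneg (N f)]
  have h5 : (inner ℂ (f - ((K⁻¹ : ℝ) : ℂ) • N f) (N (f - ((K⁻¹ : ℝ) : ℂ) • N f))).re
      = (inner ℂ f (N f)).re - 2 * K⁻¹ * ‖N f‖ ^ 2 + K⁻¹ ^ 2 * (inner ℂ (N f) (N (N f))).re := by
    have e : inner ℂ f (N (N f)) = ((‖N f‖ ^ 2 : ℝ) : ℂ) := by
      rw [← hs, inner_self_eq_norm_sq_to_K]; norm_cast
    have e' : inner ℂ (N f) (N f) = ((‖N f‖ ^ 2 : ℝ) : ℂ) := by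
      rw [inner_self_eq_norm_sq_to_K]; norm_cast
    simp only [map_sub, map_smul, inner_sub_left, inner_sub_right, inner_smul_left,
      inner_smul_right, Complex.conj_ofReal, e, e', Complex.sub_re, Complex.re_ofReal_mul,
      Complex.ofReal_re]
    ring
  rw [h5] at h3
  have h6 : ‖N f‖ ^ 2 / K ≤ (inner ℂ f (N f)).re := by
    have h7 : K⁻¹ ^ 2 * (inner ℂ (N f) (N (N f))).re ≤ K⁻¹ ^ 2 * (K * ‖N f‖ ^ 2) :=
      mul_le_mul_of_nonneg_left h4 (by positivity)
    have h8 : K⁻¹ ^ 2 * (K * ‖N f‖ ^ 2) = K⁻¹ * ‖N f‖ ^ 2 := by field_simp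
    rw [h8] at h7
    rw [div_eq_inv_mul]
    linarith
  refine le_trans ?_ h6
  rw [div_mul_eq_mul_div, one_mul, div_le_div_iff₀ (by positivity) hK0]
  have h9 : ‖f‖ ^ 2 ≤ L ^ 2 * ‖N f‖ ^ 2 := by
    rw [← mul_pow]; gcongr
  nlinarith

variable [CompleteSpace H]

/-- Below `m` the unperturbed pencil is invertible. -/
theorem isUnit_pencil_zero (hGs : ∀ f g, inner ℂ (G f) g = inner ℂ f (G g)) {m : ℝ} (hm : 0 ≤ m)
    (hGm : ∀ f, (m + 1) * ‖G f‖ ^ 2 ≤ ‖f‖ ^ 2) {E : ℝ} (hE : E < m) :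
    IsUnit (pencil G 0 E) := by
  -- The form is at least `‖f‖²` if `1 + E ≤ 0`, and at least `(1 - (1 + E) / (m + 1)) ‖f‖²`
  -- otherwise.
  have hc : 0 < min 1 ((m - E) / (m + 1)) := lt_min one_pos (div_pos (by linarith) (by linarith))
  refine ContinuousLinearMap.isUnit_of_forall_le_norm_inner_map _
    (c := (min 1 ((m - E) / (m + 1))).toNNReal) (Real.toNNReal_pos.2 hc) fun f => ?_
  rw [Real.coe_toNNReal _ hc.le, norm_inner_symm]
  refine le_trans ?_ (Complex.re_le_norm _)
  rw [re_inner_pencil hGs]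
  simp only [zero_apply, inner_zero_right, Complex.zero_re, add_zero]
  have h1 := hGm f
  have h0 := sq_nonneg ‖G f‖
  have hf := sq_nonneg ‖f‖
  rcases le_total (1 + E) 0 with h | h
  · have := mul_le_mul_of_nonneg_left (min_le_left 1 ((m - E) / (m + 1))) hf
    nlinarith
  · have h2 := mul_le_mul_of_nonneg_left (min_le_right 1 ((m - E) / (m + 1))) hf
    have h3 : ‖G f‖ ^ 2 ≤ ‖f‖ ^ 2 / (m + 1) := by
      rw [le_div_iff₀ (by linarith)]; linarith
    have h4 := mul_le_mul_of_nonneg_left h3 h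
    have h5 : ‖f‖ ^ 2 * ((m - E) / (m + 1)) = ‖f‖ ^ 2 - (1 + E) * (‖f‖ ^ 2 / (m + 1)) := by
      field_simp; ring
    linarith

/-- The Fredholm alternative for the pencil below `m`. -/
theorem isUnit_pencil (hGs : ∀ f g, inner ℂ (G f) g = inner ℂ f (G g)) {m : ℝ} (hm : 0 ≤ m)
    (hGm : ∀ f, (m + 1) * ‖G f‖ ^ 2 ≤ ‖f‖ ^ 2) (hB : IsCompactOperator B) {E : ℝ} (hE : E < m)
    (hinj : ∀ f, pencil G B E f = 0 → f = 0) : IsUnit (pencil G B E) := by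
  obtain ⟨P, hP⟩ := isUnit_pencil_zero hGs hm hGm hE
  rw [pencil_eq_comp hP]
  refine P.isUnit.mul ?_
  have hK : IsCompactOperator ((↑P⁻¹ : H →L[ℂ] H) * B) := hB.clm_comp _
  -- Either `-1` is an eigenvalue of the compact operator `P⁻¹ B`, which injectivity excludes, or `1
  -- + P⁻¹ B` is invertible.
  rcases hK.hasEigenvalue_or_mem_resolventSet (μ := (-1 : ℂ)) (by norm_num) with h | h
  · obtain ⟨f, hf⟩ := h.exists_hasEigenvector
    refine absurd (hinj f ?_) hf.2
    rw [pencil_eq_comp hP]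
    have h1 : ((↑P⁻¹ : H →L[ℂ] H) * B) f = (-1 : ℂ) • f := hf.apply_eq_smul
    have h2 : (1 + ↑P⁻¹ * B : H →L[ℂ] H) f = 0 := by
      rw [add_apply, h1]; simp
    show (P : H →L[ℂ] H) ((1 + ↑P⁻¹ * B : H →L[ℂ] H) f) = 0
    rw [h2, map_zero]
  · rw [spectrum.mem_resolventSet_iff, map_neg, map_one, ← IsUnit.neg_iff] at h
    rwa [neg_sub, sub_neg_eq_add, add_comm] at h

/-- On the kernel the compact operator `-P⁻¹ B` acts as the identity, and a compact identity forces
finite dimension. -/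
theorem finiteDimensional_ker_pencil (hGs : ∀ f g, inner ℂ (G f) g = inner ℂ f (G g)) {m : ℝ}
    (hm : 0 ≤ m) (hGm : ∀ f, (m + 1) * ‖G f‖ ^ 2 ≤ ‖f‖ ^ 2) (hB : IsCompactOperator B) {E : ℝ}
    (hE : E < m) : FiniteDimensional ℂ (LinearMap.ker (pencil G B E : H →ₗ[ℂ] H)) := by
  obtain ⟨P, hP⟩ := isUnit_pencil_zero hGs hm hGm hE
  have hK : IsCompactOperator ((-((↑P⁻¹ : H →L[ℂ] H) * B) : H →L[ℂ] H) : H →ₗ[ℂ] H) := by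
    have := (hB.clm_comp (↑P⁻¹ : H →L[ℂ] H)).neg
    exact this
  have hid : ∀ f ∈ LinearMap.ker (pencil G B E : H →ₗ[ℂ] H),
      ((-((↑P⁻¹ : H →L[ℂ] H) * B) : H →L[ℂ] H) : H →ₗ[ℂ] H) f = f := by
    intro f hf
    have h1 : pencil G B E f = 0 := hf
    rw [pencil_eq_comp hP] at h1
    have h2 : (↑P⁻¹ : H →L[ℂ] H) ((P * (1 + ↑P⁻¹ * B) : H →L[ℂ] H) f) = 0 := by
      rw [h1, map_zero]
    have h3 : (1 + ↑P⁻¹ * B : H →L[ℂ] H) f = 0 := by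
      rw [← h2, ← mul_apply_eq_comp, ← mul_assoc, Units.inv_mul, one_mul]
    have h4 : f + ((↑P⁻¹ : H →L[ℂ] H) * B) f = 0 := h3
    show -(((↑P⁻¹ : H →L[ℂ] H) * B) f) = f
    rw [eq_comm, ← add_eq_zero_iff_eq_neg]
    exact h4
  have hcl : IsClosed (LinearMap.ker (pencil G B E : H →ₗ[ℂ] H) : Set H) :=
    (pencil G B E).isClosed_ker
  have : CompleteSpace (LinearMap.ker (pencil G B E : H →ₗ[ℂ] H)) := hcl.completeSpace_coe
  have hr := hK.restrict' (V := LinearMap.ker (pencil G B E : H →ₗ[ℂ] H))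
    (fun f hf => by rw [hid f hf]; exact hf)
  refine FiniteDimensional.of_isCompactOperator_id ?_
  refine (congrArg IsCompactOperator (funext fun f => Subtype.ext ?_)).mp hr
  exact hid f f.2

/-- If the form at level `m` is negative somewhere, there is a ground state below `m`. -/
theorem exists_ground_state_pencil (hGs : ∀ f g, inner ℂ (G f) g = inner ℂ f (G g))
    (hGd : DenseRange G) (hBs : ∀ f g, inner ℂ (B f) g = inner ℂ f (B g)) {m : ℝ} (hm : 0 ≤ m)
    (hGm : ∀ f, (m + 1) * ‖G f‖ ^ 2 ≤ ‖f‖ ^ 2) (hB : IsCompactOperator B)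
    (hneg : ∃ f, (inner ℂ f (pencil G B m f)).re < 0) :
    ∃ E < m, (∀ f, 0 ≤ (inner ℂ f (pencil G B E f)).re) ∧ ∃ f ≠ 0, pencil G B E f = 0 := by
  obtain ⟨f₀, hf₀⟩ := hneg
  -- The ground state energy is the largest level at which the form is still nonnegative.
  set S : Set ℝ := {E | ∀ f, 0 ≤ (inner ℂ f (pencil G B E f)).re} with hS
  have hSm : ∀ E ∈ S, E < m := by
    intro E hE
    by_contra h
    have h1 := hE f₀
    rw [re_inner_pencil_sub hGs E m] at h1
    nlinarith [sq_nonneg ‖G f₀‖, not_lt.1 h]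
  have hbdd : BddAbove S := ⟨m, fun E hE => (hSm E hE).le⟩
  obtain ⟨K, hK0, hK⟩ := hB.exists_inner_le hGs hGd one_pos
  have hne : S.Nonempty := by
    -- At this level `-(1 + E) = K`, which compensates the lower bound `-‖f‖² - K ‖G f‖²` for the
    -- potential term.
    refine ⟨-1 - K, fun f => ?_⟩
    rw [re_inner_pencil hGs]
    have h1 := hK f
    have h2 := Complex.abs_re_le_norm (inner ℂ f (B f))
    have h3 := neg_abs_le (inner ℂ f (B f)).re
    nlinarith
  set E₀ := sSup S with hE₀
  have hES : E₀ ∈ S := by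
    have hclosed : IsClosed S := by
      have : S = ⋂ f, {E : ℝ | 0 ≤ ‖f‖ ^ 2 + (inner ℂ f (B f)).re - (1 + E) * ‖G f‖ ^ 2} := by
        ext E
        simp only [hS, Set.mem_ofPred_eq, Set.mem_iInter, re_inner_pencil hGs]
      rw [this]
      exact isClosed_iInter fun f => isClosed_le continuous_const (by fun_prop)
    exact hclosed.csSup_mem hne hbdd
  refine ⟨E₀, hSm _ hES, hES, ?_⟩
  -- With trivial kernel the pencil at `E₀` would be invertible and nonnegative, hence coercive; as
  -- `‖G f‖ ≤ ‖f‖`, the level could be raised by `c`, against maximality.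
  by_contra! hcon
  have hunit := isUnit_pencil hGs hm hGm hB (hSm _ hES)
    (fun f hf => by by_contra h; exact hcon f h hf)
  obtain ⟨c, hc, hcoer⟩ := exists_coercive_of_isUnit hunit (inner_pencil_symm hGs hBs E₀) hES
  have hmem : E₀ + c ∈ S := by
    intro f
    rw [re_inner_pencil_sub hGs _ E₀]
    have h1 := hcoer f
    have h2 := hGm f
    have h3 : ‖G f‖ ^ 2 ≤ ‖f‖ ^ 2 := by nlinarith [sq_nonneg ‖G f‖]
    nlinarith
  have := le_csSup hbdd hmem
  linarith

/-- If the form at level `m` is negative somewhere on the orthogonal complement of every finite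
dimensional space, there are infinitely many eigenvalues below `m`. -/
theorem infinite_eigenvalues_pencil (hGs : ∀ f g, inner ℂ (G f) g = inner ℂ f (G g))
    (hGd : DenseRange G) (hGi : ∀ f, G f = 0 → f = 0)
    (hBs : ∀ f g, inner ℂ (B f) g = inner ℂ f (B g)) {m : ℝ}
    (hm : 0 ≤ m) (hGm : ∀ f, (m + 1) * ‖G f‖ ^ 2 ≤ ‖f‖ ^ 2) (hB : IsCompactOperator B)
    (hneg : ∀ U : Submodule ℂ H, FiniteDimensional ℂ U →
      ∃ f, G f ∈ Uᗮ ∧ (inner ℂ f (pencil G B m f)).re < 0) :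
    {E : ℝ | E < m ∧ ∃ f ≠ 0, pencil G B E f = 0}.Infinite := by
  intro hfin
  set S := {E : ℝ | E < m ∧ ∃ f ≠ 0, pencil G B E f = 0} with hS
  let ker' : ℝ → Submodule ℂ H := fun E =>
    (LinearMap.ker (pencil G B E : H →ₗ[ℂ] H)).map (G : H →ₗ[ℂ] H)
  have : Finite S := hfin
  -- `U` is the sum of the finitely many eigenspaces below `m`. Lifting `U` by `t` in energy leaves
  -- its complement alone, and the ground state of the lifted problem turns out to be an eigenvector
  -- that `U` misses.
  let U : Submodule ℂ H := ⨆ E : S, ker' E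
  have hUE : ∀ E : S, FiniteDimensional ℂ (ker' E) := fun E => by
    have := finiteDimensional_ker_pencil hGs hm hGm hB E.2.1
    infer_instance
  have hU : FiniteDimensional ℂ U := Submodule.finiteDimensional_iSup _
  obtain ⟨b, hb⟩ := hfin.bddBelow
  -- With this `t`, every `E' ∈ S` and every `E < m` satisfy `E' + t > E`: lifted eigenvalues cannot
  -- meet the new ground state energy.
  set t : ℝ := m - min b m + 1 with ht
  set Q : H →L[ℂ] H := U.starProjection with hQ
  have hQs : ∀ f g, inner ℂ (Q f) g = inner ℂ f (Q g) :=
    U.inner_starProjection_left_eq_right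
  set B' : H →L[ℂ] H := B + (t : ℂ) • (G ∘L Q ∘L G) with hB'
  have hB'c : IsCompactOperator B' := by
    have hQc : IsCompactOperator Q := by
      have : IsCompactOperator (U.orthogonalProjectionOnto : H →L[ℂ] U) :=
        by
        have : ProperSpace U := FiniteDimensional.proper ℂ U
        exact isCompactOperator_of_locallyCompactSpace_dom _
      exact this.clm_comp U.subtypeL
    have h1 : IsCompactOperator (G ∘L Q ∘L G) := (hQc.comp_clm G).clm_comp G
    exact hB.add (h1.smul (t : ℂ))
  have hB's : ∀ f g, inner ℂ (B' f) g = inner ℂ f (B' g) := by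
    intro f g
    simp only [hB', add_apply, smul_apply,
      ContinuousLinearMap.comp_apply, inner_add_left, inner_add_right, inner_smul_left,
      inner_smul_right, Complex.conj_ofReal, hBs, hGs, hQs]
  have hpB' : ∀ E f, pencil G B' E f = pencil G B E f + (t : ℂ) • G (Q (G f)) := by
    intro E f
    simp only [pencil_apply, hB', add_apply, smul_apply,
      ContinuousLinearMap.comp_apply]
    abel
  have hneg' : ∃ f, (inner ℂ f (pencil G B' m f)).re < 0 := by
    obtain ⟨f, hf, hlt⟩ := hneg U hU
    refine ⟨f, ?_⟩
    have : Q (G f) = 0 := (Submodule.starProjection_apply_eq_zero_iff U).2 hf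
    rw [hpB', this, map_zero, smul_zero, add_zero]
    exact hlt
  obtain ⟨E, hEm, -, f, hf0, hf⟩ := exists_ground_state_pencil hGs hGd hB's hm hGm hB'c hneg'
  -- Pairing the lifted equation for `f` with an old eigenvector `v` yields `(E' - E + t) ⟨G v, G f⟩
  -- = 0`.
  have horth : G f ∈ Uᗮ := by
    rw [Submodule.mem_orthogonal]
    have hle : U ≤ (ℂ ∙ G f)ᗮ := by
      refine iSup_le fun E' => ?_
      rintro _ ⟨v, hv, rfl⟩
      have hv0 : pencil G B E' v = 0 := hv
      have hGvU : G v ∈ U :=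
        (le_iSup (fun E : S => ker' E) E') ⟨v, hv, rfl⟩
      rw [Submodule.mem_orthogonal_singleton_iff_inner_left]
      have e1 : inner ℂ v (pencil G B' E f) = 0 := by rw [hf, inner_zero_right]
      rw [hpB', inner_add_right, inner_smul_right, ← hGs, ← hQs,
        show Q (G v) = G v from (Submodule.starProjection_eq_self_iff).2 hGvU] at e1
      have e2 : inner ℂ v (pencil G B E' f) = 0 := by
        rw [← inner_pencil_symm hGs hBs, hv0, inner_zero_left]
      rw [inner_pencil hGs] at e1 e2
      have e3 : (((E' : ℝ) - E + t : ℝ) : ℂ) * inner ℂ (G v) (G f) = 0 := by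
        push_cast at e1 e2 ⊢
        linear_combination e1 - e2
      have hpos : (0 : ℝ) < (E' : ℝ) - E + t := by
        have h1 := hb E'.2
        have h2 := min_le_left b m
        linarith
      exact (mul_eq_zero.1 e3).resolve_left (by exact_mod_cast hpos.ne')
    intro u hu
    exact (Submodule.mem_orthogonal_singleton_iff_inner_left).1 (hle hu)
  have hQf : Q (G f) = 0 := (Submodule.starProjection_apply_eq_zero_iff U).2 horth
  have hker : pencil G B E f = 0 := by
    have := hf
    rwa [hpB', hQf, map_zero, smul_zero, add_zero] at this
  have hGfU : G f ∈ U :=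
    (le_iSup (fun E : S => ker' E) ⟨E, hEm, f, hf0, hker⟩) ⟨f, hker, rfl⟩
  exact hf0 (hGi f (inner_self_eq_zero.1 ((Submodule.mem_orthogonal _ _).1 horth _ hGfU)))

end Pencil

/-! ### Multiplication operators and Fourier multipliers on `L²` -/

section Multiplier

variable {d : ℕ}

theorem inner_L2Rd (f g : L2Rd d) : inner ℂ f g = ∫ x, conj (f x) * g x := by
  rw [L2.inner_def]
  refine integral_congr_ae (Filter.Eventually.of_forall fun x => ?_)
  simp only [RCLike.inner_apply]
  ring

theorem norm_sq_L2Rd (f : L2Rd d) : ‖f‖ ^ 2 = ∫ x, ‖f x‖ ^ 2 := by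
  have h : (inner ℂ f f : ℂ) = ((∫ x, ‖f x‖ ^ 2 : ℝ) : ℂ) := by
    rw [inner_L2Rd, ← integral_complex_ofReal]
    refine integral_congr_ae (Filter.Eventually.of_forall fun x => ?_)
    simp only [Complex.conj_mul', Complex.ofReal_pow]
  rw [inner_self_eq_norm_sq_to_K] at h
  refine Complex.ofReal_injective ?_
  rw [← h]
  norm_cast

theorem integrable_norm_sq_L2Rd (f : L2Rd d) : Integrable (fun x => ‖f x‖ ^ 2) :=
  (memLp_two_iff_integrable_sq_norm (Lp.aestronglyMeasurable f)).1 (Lp.memLp f)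

theorem integrable_conj_mul_L2Rd (f g : L2Rd d) : Integrable (fun x => conj (f x) * g x) := by
  refine (L2.integrable_inner (𝕜 := ℂ) f g).congr (Filter.Eventually.of_forall fun x => ?_)
  simp only [RCLike.inner_apply]
  ring

theorem inner_fourier_L2Rd (f g : L2Rd d) :
    inner ℂ (𝓕 f : L2Rd d) (𝓕 g : L2Rd d) = inner ℂ f g :=
  Lp.inner_fourier_eq f g

/-- Multiplication by a bounded real function. -/
theorem exists_mul_operator {w : Rd d → ℝ} (hw : AEMeasurable w) {c : ℝ}
    (hc : ∀ x, |w x| ≤ c) :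
    ∃ A : L2Rd d →L[ℂ] L2Rd d, ∀ f, ∀ᵐ x, A f x = (w x : ℂ) * f x := by
  have hw' : AEStronglyMeasurable (fun x => (w x : ℂ)) :=
    (Complex.measurable_ofReal.comp_aemeasurable hw).aestronglyMeasurable
  have hmem : ∀ f : L2Rd d, MemLp (fun x => (w x : ℂ) * f x) 2 := fun f =>
    (Lp.memLp f).of_le_mul (c := c) (hw'.mul (Lp.aestronglyMeasurable f))
      (Filter.Eventually.of_forall fun x => by
        rw [norm_mul, Complex.norm_real, Real.norm_eq_abs]
        exact mul_le_mul_of_nonneg_right (hc x) (norm_nonneg _))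
  let A₀ : L2Rd d →ₗ[ℂ] L2Rd d :=
    { toFun := fun f => (hmem f).toLp _
      map_add' := fun f g => by
        ext1
        filter_upwards [(hmem (f + g)).coeFn_toLp, (hmem f).coeFn_toLp, (hmem g).coeFn_toLp,
          Lp.coeFn_add f g, Lp.coeFn_add ((hmem f).toLp _) ((hmem g).toLp _)]
          with x h1 h2 h3 h4 h5
        rw [h1, h5, Pi.add_apply, h2, h3, h4, Pi.add_apply, mul_add]
      map_smul' := fun a f => by
        ext1
        filter_upwards [(hmem (a • f)).coeFn_toLp, (hmem f).coeFn_toLp, Lp.coeFn_smul a f,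
          Lp.coeFn_smul a ((hmem f).toLp _)] with x h1 h2 h3 h4
        rw [RingHom.id_apply, h1, h4, Pi.smul_apply, h2, h3, Pi.smul_apply, smul_eq_mul,
          smul_eq_mul]
        ring }
  refine ⟨A₀.mkContinuous c fun f => ?_, fun f => (hmem f).coeFn_toLp⟩
  refine Lp.norm_le_mul_norm_of_ae_le_mul ?_
  filter_upwards [(hmem f).coeFn_toLp] with x hx
  show ‖((hmem f).toLp _ : L2Rd d) x‖ ≤ _
  rw [hx, norm_mul, Complex.norm_real, Real.norm_eq_abs]
  exact mul_le_mul_of_nonneg_right (hc x) (norm_nonneg _)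

theorem IsFourierMultiplier.unique {m : Rd d → ℝ} {f φ φ' : L2Rd d}
    (h : IsFourierMultiplier m f φ) (h' : IsFourierMultiplier m f φ') : φ = φ' := by
  refine (Lp.fourierTransformₗᵢ (Rd d) ℂ).injective ?_
  refine Lp.ext ?_
  filter_upwards [h, h'] with x h1 h2
  exact h1.trans h2.symm

theorem fourier_fourierInv_L2Rd (f : L2Rd d) : (𝓕 (𝓕⁻ f : L2Rd d) : L2Rd d) = f :=
  (Lp.fourierTransformₗᵢ (Rd d) ℂ).apply_symm_apply f

/-- The Fourier multiplier with a bounded real symbol. -/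
theorem exists_fourierMultiplier {m : Rd d → ℝ} (hm : Measurable m) {c : ℝ}
    (hc : ∀ η, |m η| ≤ c) :
    ∃ A : L2Rd d →L[ℂ] L2Rd d, (∀ f, IsFourierMultiplier m f (A f)) ∧
      ∀ f g, inner ℂ (A f) g = inner ℂ f (A g) := by
  obtain ⟨A, hA⟩ := exists_mul_operator (measurable_symbolFourier hm).aemeasurable
    (fun ξ => hc ((2 * Real.pi) • ξ))
  let F := Lp.fourierTransformₗᵢ (Rd d) ℂ
  have key : ∀ f : L2Rd d, IsFourierMultiplier m f (F.symm (A (F f))) := by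
    intro f
    filter_upwards [hA (F f)] with ξ h
    have : (𝓕 (F.symm (A (F f))) : L2Rd d) = A (F f) := F.apply_symm_apply _
    rw [this, h]
    rfl
  refine ⟨(F.symm.toContinuousLinearEquiv : L2Rd d →L[ℂ] L2Rd d) ∘L A ∘L
    (F.toContinuousLinearEquiv : L2Rd d →L[ℂ] L2Rd d), key, fun f g => ?_⟩
  show inner ℂ (F.symm (A (F f))) g = inner ℂ f (F.symm (A (F g)))
  rw [← inner_fourier_L2Rd, ← inner_fourier_L2Rd f, inner_L2Rd, inner_L2Rd]
  refine integral_congr_ae ?_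
  filter_upwards [key f, key g] with ξ h1 h2
  rw [h1, h2, map_mul, Complex.conj_ofReal]
  ring

theorem abs_inv_sqrt_add_one_le {t : ℝ} (ht : 0 ≤ t) : |(Real.sqrt (t + 1))⁻¹| ≤ 1 := by
  rw [abs_of_nonneg (by positivity)]
  exact inv_le_one_of_one_le₀ (Real.one_le_sqrt.2 (by linarith))

/-- Relative form compactness is inherited by larger symbols. -/
theorem IsRelFormCompact.mono {T M V : Rd d → ℝ} (hT : Measurable T) (hM : Measurable M)
    (hT0 : ∀ η, 0 ≤ T η) (hTM : ∀ η, T η ≤ M η) (h : IsRelFormCompact T V) :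
    IsRelFormCompact M V := by
  obtain ⟨C, hC, hCf⟩ := h
  -- `D = (T + 1)^(1/2) (M + 1)^(-1/2)` is a contraction, and the operator for `M` is `D C D`.
  obtain ⟨D, hD, hDs⟩ := exists_fourierMultiplier
    (m := fun η => Real.sqrt (T η + 1) * (Real.sqrt (M η + 1))⁻¹) (by fun_prop) (c := 1)
    (fun η => by
      rw [abs_of_nonneg (by positivity), ← div_eq_mul_inv]
      refine div_le_one_of_le₀ (Real.sqrt_le_sqrt ?_) (Real.sqrt_nonneg _)
      linarith [hTM η])
  have key : ∀ f φ : L2Rd d, IsFourierMultiplier (fun η => (Real.sqrt (M η + 1))⁻¹) f φ →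
      IsFourierMultiplier (fun η => (Real.sqrt (T η + 1))⁻¹) (D f) φ := by
    intro f φ hφ
    filter_upwards [hφ, hD f] with ξ h1 h2
    rw [h1, h2, ← mul_assoc, ← Complex.ofReal_mul, ← mul_assoc, inv_mul_cancel₀, one_mul]
    exact (Real.sqrt_pos.2 (by linarith [hT0 ((2 * Real.pi) • ξ)])).ne'
  refine ⟨D ∘L C ∘L D, (hC.comp_clm D).clm_comp D, fun f g φ γ hφ hγ => ?_⟩
  have := hCf (D f) (D g) φ γ (key f φ hφ) (key g γ hγ)
  refine ⟨this.1, ?_⟩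
  rw [← this.2, hDs]
  rfl

end Multiplier

/-! ### The form sum in terms of a bounded pencil -/

section FormSum

variable {d : ℕ}

/-- `G = (M(p) + 1)^(-1/2)` and `B = G V G`, through the properties which matter for the spectral
theory of `M(p) + V`. -/
structure IsFormFactorization (M V : Rd d → ℝ) (hM : Measurable M) (hV : AEMeasurable V) (m : ℝ)
    (G B : L2Rd d →L[ℂ] L2Rd d) : Prop where
  symm_left : ∀ f g, inner ℂ (G f) g = inner ℂ f (G g)
  injective : ∀ f, G f = 0 → f = 0
  bound : ∀ f, (m + 1) * ‖G f‖ ^ 2 ≤ ‖f‖ ^ 2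
  compact : IsCompactOperator B
  symm_right : ∀ f g, inner ℂ (B f) g = inner ℂ f (B g)
  range_mem : ∀ f, G f ∈ formDomain M V hM hV
  exists_eq : ∀ ψ : L2Rd d, FiniteForm (symbolFourier M) (𝓕 ψ : L2Rd d) → ∃ f, G f = ψ
  form_eq : ∀ f g, formSumForm M V (G f) (G g)
    = inner ℂ f g + inner ℂ f (B g) - inner ℂ (G f) (G g)

/-- The orthogonal complement of the range of a symmetric operator is its kernel. -/
theorem denseRange_of_symm_injective {H : Type*} [NormedAddCommGroup H] [InnerProductSpace ℂ H]
    [CompleteSpace H] {G : H →L[ℂ] H} (hs : ∀ f g, inner ℂ (G f) g = inner ℂ f (G g))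
    (hi : ∀ f, G f = 0 → f = 0) : DenseRange G := by
  have h : (LinearMap.range (G : H →ₗ[ℂ] H)).topologicalClosure = ⊤ := by
    rw [Submodule.topologicalClosure_eq_top_iff, eq_bot_iff]
    intro f hf
    refine hi f (inner_self_eq_zero (𝕜 := ℂ).1 ?_)
    rw [hs, inner_eq_zero_symm]
    exact (Submodule.mem_orthogonal _ _).1 hf _ ⟨G f, rfl⟩
  have h2 := Submodule.dense_iff_topologicalClosure_eq_top.2 h
  exact h2

/-- The square root of the potential, as a bounded operator after `(M(p) + 1)^(-1/2)`. -/
theorem exists_sqrt_potential {M V : Rd d → ℝ} (hV : AEMeasurable V) {G C : L2Rd d →L[ℂ] L2Rd d}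
    (hG : ∀ f, IsFourierMultiplier (fun η => (Real.sqrt (M η + 1))⁻¹) f (G f))
    (hC : ∀ f g φ γ : L2Rd d,
      IsFourierMultiplier (fun η => (Real.sqrt (M η + 1))⁻¹) f φ →
      IsFourierMultiplier (fun η => (Real.sqrt (M η + 1))⁻¹) g γ →
      Integrable (fun x : Rd d => ((|V x| : ℝ) : ℂ) * (conj (φ x) * γ x)) ∧
      inner ℂ f (C g) = ∫ x : Rd d, ((|V x| : ℝ) : ℂ) * (conj (φ x) * γ x)) :
    ∃ X : L2Rd d →L[ℂ] L2Rd d, (∀ f, ∀ᵐ x, X f x = (Real.sqrt |V x| : ℂ) * G f x) ∧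
      ∀ f, ‖X f‖ ^ 2 ≤ ‖f‖ * ‖C f‖ := by
  have hsm : AEStronglyMeasurable (fun x => (Real.sqrt |V x| : ℂ)) :=
    (Complex.measurable_ofReal.comp_aemeasurable
      (Real.continuous_sqrt.measurable.comp_aemeasurable
        (continuous_abs.measurable.comp_aemeasurable hV))).aestronglyMeasurable
  have hmeas : ∀ f : L2Rd d, AEStronglyMeasurable (fun x => (Real.sqrt |V x| : ℂ) * G f x) :=
    fun f => hsm.mul (Lp.aestronglyMeasurable _)
  have hsq : ∀ (f : L2Rd d) (x : Rd d), ‖(Real.sqrt |V x| : ℂ) * G f x‖ ^ 2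
      = ‖((|V x| : ℝ) : ℂ) * (conj (G f x) * G f x)‖ := by
    intro f x
    rw [norm_mul, norm_mul, norm_mul, mul_pow, Complex.norm_real, Complex.norm_real,
      RCLike.norm_conj, Real.norm_eq_abs, Real.norm_eq_abs, abs_abs, abs_of_nonneg
      (Real.sqrt_nonneg _), Real.sq_sqrt (abs_nonneg _)]
    ring
  have hmem : ∀ f : L2Rd d, MemLp (fun x => (Real.sqrt |V x| : ℂ) * G f x) 2 := by
    intro f
    rw [memLp_two_iff_integrable_sq_norm (hmeas f)]
    simp only [hsq]
    exact (hC f f _ _ (hG f) (hG f)).1.norm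
  have hbound : ∀ f : L2Rd d, ‖((hmem f).toLp _ : L2Rd d)‖ ^ 2 ≤ ‖f‖ * ‖C f‖ := by
    intro f
    rw [norm_sq_L2Rd]
    have h1 : ((∫ x, ‖((hmem f).toLp _ : L2Rd d) x‖ ^ 2 : ℝ) : ℂ) = inner ℂ f (C f) := by
      rw [(hC f f _ _ (hG f) (hG f)).2, ← integral_complex_ofReal]
      refine integral_congr_ae ?_
      filter_upwards [(hmem f).coeFn_toLp] with x hx
      rw [hx, hsq, norm_mul, norm_mul, RCLike.norm_conj, Complex.conj_mul', Complex.norm_real,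
        Real.norm_eq_abs, abs_abs]
      push_cast
      ring
    have h2 : (∫ x, ‖((hmem f).toLp _ : L2Rd d) x‖ ^ 2 : ℝ) = (inner ℂ f (C f)).re := by
      rw [← h1, Complex.ofReal_re]
    rw [h2]
    exact (Complex.re_le_norm _).trans (norm_inner_le_norm _ _)
  let X₀ : L2Rd d →ₗ[ℂ] L2Rd d :=
    { toFun := fun f => (hmem f).toLp _
      map_add' := fun f g => by
        refine Lp.ext ?_
        filter_upwards [(hmem (f + g)).coeFn_toLp, (hmem f).coeFn_toLp, (hmem g).coeFn_toLp,
          Lp.coeFn_add (G f) (G g), Lp.coeFn_add ((hmem f).toLp _) ((hmem g).toLp _)]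
          with x h1 h2 h3 h4 h5
        rw [h1, h5, Pi.add_apply, h2, h3, map_add, h4, Pi.add_apply, mul_add]
      map_smul' := fun a f => by
        refine Lp.ext ?_
        filter_upwards [(hmem (a • f)).coeFn_toLp, (hmem f).coeFn_toLp, Lp.coeFn_smul a (G f),
          Lp.coeFn_smul a ((hmem f).toLp _)] with x h1 h2 h3 h4
        rw [RingHom.id_apply, h1, h4, Pi.smul_apply, h2, map_smul, h3, Pi.smul_apply, smul_eq_mul,
          smul_eq_mul]
        ring }
  refine ⟨X₀.mkContinuous (Real.sqrt ‖C‖) fun f => ?_, fun f => (hmem f).coeFn_toLp, hbound⟩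
  refine le_of_sq_le_sq ?_ (by positivity)
  rw [mul_pow, Real.sq_sqrt (norm_nonneg _)]
  refine (hbound f).trans ?_
  nlinarith [C.le_opNorm f, norm_nonneg f]

/-- With `X = |V|^(1/2) G`, the bound `‖X f‖² ≤ ‖f‖ ‖C f‖` passes compactness from `C = G |V| G` to
`X`, and `B = X* sgn(V) X` restores the sign of `V`. The range of `G` is the form domain of `M(p)`,
since multiplying a Fourier transform by `(M + 1)^(1/2)` inverts `G` there. -/
theorem exists_formFactorization {M V : Rd d → ℝ} (hM : Measurable M) (hV : AEMeasurable V)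
    {m : ℝ} (hm : 0 ≤ m) (hmM : ∀ η, m ≤ M η) (h : IsRelFormCompact M V) :
    ∃ G B, IsFormFactorization M V hM hV m G B := by
  obtain ⟨C, hCc, hC⟩ := h
  have hM0 : ∀ η, 0 ≤ M η := fun η => hm.trans (hmM η)
  obtain ⟨G, hG, hGs⟩ := exists_fourierMultiplier
    (m := fun η => (Real.sqrt (M η + 1))⁻¹) (by fun_prop)
    (fun η => abs_inv_sqrt_add_one_le (hM0 η))
  obtain ⟨X, hX, hXC⟩ := exists_sqrt_potential hV hG hC
  -- This is the sign of `V`; where `V` vanishes, `0 / 0 = 0` gives the value zero.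
  obtain ⟨S, hS⟩ := exists_mul_operator (d := d) (w := fun x => V x / |V x|)
    (hV.div (continuous_abs.measurable.comp_aemeasurable hV)) (c := 1) (fun x => by
      rw [abs_div, abs_abs]; exact div_self_le_one _)
  have hXc : IsCompactOperator X := isCompactOperator_of_norm_sq_le X C hCc hXC
  have hM1 : ∀ ξ : Rd d, 0 < symbolFourier M ξ + 1 := fun ξ =>
    add_pos_of_nonneg_of_pos (hM0 _) one_pos
  have hsq : ∀ ξ : Rd d, 0 < Real.sqrt (symbolFourier M ξ + 1) := fun ξ => Real.sqrt_pos.2 (hM1 ξ)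
  have hsq2 : ∀ ξ : Rd d, Real.sqrt (symbolFourier M ξ + 1) ^ 2 = symbolFourier M ξ + 1 :=
    fun ξ => Real.sq_sqrt (hM1 ξ).le
  have hF : ∀ f : L2Rd d, ∀ᵐ ξ, (𝓕 f : L2Rd d) ξ
      = (Real.sqrt (symbolFourier M ξ + 1) : ℂ) * (𝓕 (G f) : L2Rd d) ξ := by
    intro f
    filter_upwards [hG f] with ξ h
    rw [h, ← mul_assoc, ← Complex.ofReal_mul,
      show M ((2 * Real.pi) • ξ) = symbolFourier M ξ from rfl, mul_inv_cancel₀ (hsq ξ).ne',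
      Complex.ofReal_one, one_mul]
  have hFn : ∀ f : L2Rd d, ∀ᵐ ξ, ‖(𝓕 f : L2Rd d) ξ‖ ^ 2
      = (symbolFourier M ξ + 1) * ‖(𝓕 (G f) : L2Rd d) ξ‖ ^ 2 := by
    intro f
    filter_upwards [hF f] with ξ h
    rw [h, norm_mul, mul_pow, Complex.norm_real, Real.norm_eq_abs, sq_abs, hsq2]
  have hdomT : ∀ f : L2Rd d, FiniteForm (symbolFourier M) (𝓕 (G f) : L2Rd d) := by
    intro f
    refine ((integrable_norm_sq_L2Rd (𝓕 f : L2Rd d)).sub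
      (integrable_norm_sq_L2Rd (𝓕 (G f) : L2Rd d))).congr ?_
    filter_upwards [hFn f] with ξ h
    simp only [Pi.sub_apply]
    rw [h]; ring
  have hdomV : ∀ f : L2Rd d, FiniteForm V (G f) := by
    intro f
    have h1 := (hC f f _ _ (hG f) (hG f)).1
    refine h1.norm.mono' (hV.aestronglyMeasurable.mul
      ((Lp.aestronglyMeasurable (G f)).norm.pow 2)) (Filter.Eventually.of_forall fun x => ?_)
    rw [norm_mul, norm_mul, norm_mul, Complex.norm_real, RCLike.norm_conj, Real.norm_eq_abs,
      Real.norm_of_nonneg (sq_nonneg ‖G f x‖), Real.norm_eq_abs, abs_abs, sq]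
  have hBform : ∀ f g, inner ℂ f ((ContinuousLinearMap.adjoint X ∘L S ∘L X) g)
      = weightedForm V (G f) (G g) := by
    intro f g
    show inner ℂ f (ContinuousLinearMap.adjoint X (S (X g))) = _
    rw [ContinuousLinearMap.adjoint_inner_right, inner_L2Rd]
    refine integral_congr_ae ?_
    filter_upwards [hX f, hX g, hS (X g)] with x h1 h2 h3
    rw [h1, h3, h2, map_mul, Complex.conj_ofReal]
    have e : (V x : ℂ) = (Real.sqrt |V x| : ℂ) * ((V x / |V x| : ℝ) : ℂ)
        * (Real.sqrt |V x| : ℂ) := by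
      rw [← Complex.ofReal_mul, ← Complex.ofReal_mul]
      congr 1
      have := Real.mul_self_sqrt (abs_nonneg (V x))
      rcases eq_or_ne (V x) 0 with h0 | h0
      · simp [h0]
      · have h0' := abs_pos.2 h0
        field_simp
        rw [sq, this]
    rw [e]
    ring
  refine ⟨G, ContinuousLinearMap.adjoint X ∘L S ∘L X, ⟨hGs, ?_, ?_, ?_, ?_, fun f => ⟨hdomT f, hdomV f⟩, ?_, ?_⟩⟩
  · intro f hf
    have h0 : (𝓕 f : L2Rd d) = 0 := by
      have hz : (𝓕 (0 : L2Rd d) : L2Rd d) = 0 := map_zero (Lp.fourierTransformₗᵢ (Rd d) ℂ)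
      refine Lp.ext ?_
      filter_upwards [hF f, Lp.coeFn_zero ℂ 2 (volume : Measure (Rd d))] with ξ h1 h2
      rw [h1, hf, hz, h2, Pi.zero_apply, mul_zero]
    exact (map_eq_zero_iff _ (Lp.fourierTransformₗᵢ (Rd d) ℂ).injective).1 h0
  · intro f
    rw [← Lp.norm_fourier_eq (G f), ← Lp.norm_fourier_eq f, norm_sq_L2Rd, norm_sq_L2Rd,
      ← integral_const_mul]
    refine integral_mono_ae ((integrable_norm_sq_L2Rd _).const_mul _)
      (integrable_norm_sq_L2Rd _) ?_
    filter_upwards [hFn f] with ξ h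
    rw [h]
    exact mul_le_mul_of_nonneg_right (by
      have := hmM ((2 * Real.pi) • ξ)
      simpa [symbolFourier] using this) (by positivity)
  · exact ((hXc.clm_comp S).clm_comp (ContinuousLinearMap.adjoint X))
  · intro f g
    rw [← inner_conj_symm, hBform, hBform, weightedForm, weightedForm, ← integral_conj]
    refine integral_congr_ae (Filter.Eventually.of_forall fun x => ?_)
    simp only [map_mul, Complex.conj_ofReal, Complex.conj_conj]
    ring
  · intro ψ h1
    have h1' : Integrable (fun ξ => symbolFourier M ξ * ‖(𝓕 ψ : L2Rd d) ξ‖ ^ 2) := h1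
    have hmem : MemLp (fun ξ => (Real.sqrt (symbolFourier M ξ + 1) : ℂ)
        * (𝓕 ψ : L2Rd d) ξ) 2 := by
      have hms : Measurable fun ξ => (Real.sqrt (symbolFourier M ξ + 1) : ℂ) := by
        have := measurable_symbolFourier hM
        fun_prop
      have hms' : AEStronglyMeasurable (fun ξ => (Real.sqrt (symbolFourier M ξ + 1) : ℂ)
          * (𝓕 ψ : L2Rd d) ξ) :=
        hms.aestronglyMeasurable.mul (Lp.aestronglyMeasurable _)
      rw [memLp_two_iff_integrable_sq_norm hms']
      refine (h1'.add (integrable_norm_sq_L2Rd (𝓕 ψ : L2Rd d))).congr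
        (Filter.Eventually.of_forall fun ξ => ?_)
      simp only [Pi.add_apply]
      rw [norm_mul, mul_pow, Complex.norm_real, Real.norm_eq_abs, sq_abs, hsq2]
      ring
    refine ⟨(𝓕⁻ (hmem.toLp _ : L2Rd d) : L2Rd d), (hG _).unique ?_⟩
    filter_upwards [hmem.coeFn_toLp] with ξ h
    rw [fourier_fourierInv_L2Rd, h, ← mul_assoc, ← Complex.ofReal_mul,
      show M ((2 * Real.pi) • ξ) = symbolFourier M ξ from rfl, inv_mul_cancel₀ (hsq ξ).ne',
      Complex.ofReal_one, one_mul]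
  · intro f g
    rw [hBform, formSumForm, ← inner_fourier_L2Rd f g, ← inner_fourier_L2Rd (G f) (G g),
      inner_L2Rd, inner_L2Rd]
    have : weightedForm (symbolFourier M) (𝓕 (G f) : L2Rd d) (𝓕 (G g) : L2Rd d)
        + ∫ ξ, conj ((𝓕 (G f) : L2Rd d) ξ) * (𝓕 (G g) : L2Rd d) ξ
        = ∫ ξ, conj ((𝓕 f : L2Rd d) ξ) * (𝓕 g : L2Rd d) ξ := by
      rw [weightedForm, ← integral_add
        ((hdomT f).integrable_mul (measurable_symbolFourier hM).aemeasurable (hdomT g))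
        (integrable_conj_mul_L2Rd _ _)]
      refine integral_congr_ae ?_
      filter_upwards [hF f, hF g] with ξ h1 h2
      rw [h1, h2, map_mul, Complex.conj_ofReal]
      have e : ((symbolFourier M ξ : ℝ) : ℂ) + 1
          = (Real.sqrt (symbolFourier M ξ + 1) : ℂ) * (Real.sqrt (symbolFourier M ξ + 1) : ℂ) := by
        rw [← Complex.ofReal_mul, ← sq, hsq2]; push_cast; ring
      linear_combination (conj ((𝓕 (G f) : L2Rd d) ξ) * (𝓕 (G g) : L2Rd d) ξ) * e
    rw [← this]
    ring

namespace IsFormFactorization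

variable {M V : Rd d → ℝ} {hM : Measurable M} {hV : AEMeasurable V} {m : ℝ}
  {G B : L2Rd d →L[ℂ] L2Rd d}

theorem denseRange (h : IsFormFactorization M V hM hV m G B) : DenseRange G :=
  denseRange_of_symm_injective h.symm_left h.injective

theorem mem_formDomain (h : IsFormFactorization M V hM hV m G B) (ψ : L2Rd d) :
    ψ ∈ formDomain M V hM hV ↔ ∃ f, G f = ψ :=
  ⟨fun hψ => h.exists_eq ψ hψ.1, fun ⟨f, hf⟩ => hf ▸ h.range_mem f⟩

theorem inner_pencil_eq (h : IsFormFactorization M V hM hV m G B) (E : ℝ) (f g : L2Rd d) :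
    inner ℂ f (pencil G B E g)
      = formSumForm M V (G f) (G g) - (E : ℂ) * inner ℂ (G f) (G g) := by
  rw [inner_pencil h.symm_left, h.form_eq]
  push_cast
  ring

/-- Form domain vectors are exactly the `G f`; testing against `G g` and moving `G` across the inner
product turns the weak equation into a bounded one. This is the bridge from the form sum to the
pencil. -/
theorem mem_graph_iff (h : IsFormFactorization M V hM hV m G B) (ψ k : L2Rd d) :
    (ψ, k) ∈ (formSum M V hM hV).graph ↔ ∃ f, G f = ψ ∧ pencil G B 0 f = G k := by
  have hdense : Dense (formDomain M V hM hV : Set (L2Rd d)) := by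
    have : (formDomain M V hM hV : Set (L2Rd d)) = Set.range G := by
      ext ψ
      exact h.mem_formDomain ψ
    rw [this]
    exact h.denseRange
  have hp : ∀ f g, inner ℂ g (pencil G B 0 f) = formSumForm M V (G g) (G f) := by
    intro f g
    rw [h.inner_pencil_eq]; simp
  rw [formSum_graph M V hM hV hdense]
  constructor
  · rintro ⟨h1, h2⟩
    obtain ⟨f, hf⟩ := (h.mem_formDomain ψ).1 h1
    refine ⟨f, hf, ext_inner_left ℂ fun g => ?_⟩
    rw [hp, hf, ← h.symm_left]
    exact h2 (G g) ((h.mem_formDomain _).2 ⟨g, rfl⟩)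
  · rintro ⟨f, rfl, hf⟩
    refine ⟨(h.mem_formDomain _).2 ⟨f, rfl⟩, fun φ hφ => ?_⟩
    obtain ⟨g, rfl⟩ := (h.mem_formDomain φ).1 hφ
    show formSumForm M V (G g) (G f) = inner ℂ (G g) k
    rw [← hp, hf, h.symm_left]

theorem pencil_zero_eq (E : ℝ) (f : L2Rd d) :
    pencil G B 0 f = pencil G B E f + (E : ℂ) • G (G f) := by
  simp only [pencil_apply, add_zero, Complex.ofReal_add, Complex.ofReal_one, one_smul, add_smul]
  abel

theorem isEigenvalue_iff (h : IsFormFactorization M V hM hV m G B) (E : ℝ) :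
    IsEigenvalue (formSum M V hM hV) E ↔ ∃ f ≠ 0, pencil G B E f = 0 := by
  constructor
  · rintro ⟨ψ, hψ0, hψ⟩
    have hg : ((ψ : L2Rd d), (E : ℂ) • (ψ : L2Rd d)) ∈ (formSum M V hM hV).graph := by
      rw [← hψ]; exact LinearPMap.mem_graph _ ψ
    obtain ⟨f, hf, hf2⟩ := (h.mem_graph_iff _ _).1 hg
    refine ⟨f, fun h0 => hψ0 (by rw [← hf, h0, map_zero]), ?_⟩
    rw [pencil_zero_eq E, ← hf, map_smul] at hf2
    exact add_eq_right.1 hf2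
  · rintro ⟨f, hf0, hf⟩
    have hg : (G f, (E : ℂ) • G f) ∈ (formSum M V hM hV).graph := by
      refine (h.mem_graph_iff _ _).2 ⟨f, rfl, ?_⟩
      rw [pencil_zero_eq E, hf, zero_add, map_smul]
    obtain ⟨ψ, h1, h2⟩ := (LinearPMap.mem_graph_iff _).1 hg
    exact ⟨ψ, by rw [h1]; exact fun h0 => hf0 (h.injective f h0), by rw [h1]; exact h2⟩

/-- The resolvent is `G (pencil G B E)⁻¹ G`. -/
theorem not_mem_realSpectrum (h : IsFormFactorization M V hM hV m G B) {E : ℝ}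
    (hu : IsUnit (pencil G B E)) : E ∉ realSpectrum (formSum M V hM hV) := by
  obtain ⟨U, hU⟩ := hu
  have hUinv : ∀ f, (↑U⁻¹ : L2Rd d →L[ℂ] L2Rd d) (pencil G B E f) = f := fun f => by
    rw [← hU, ← mul_apply_eq_comp, Units.inv_mul]; rfl
  have hinvU : ∀ f, pencil G B E ((↑U⁻¹ : L2Rd d →L[ℂ] L2Rd d) f) = f := fun f => by
    rw [← hU, ← mul_apply_eq_comp, Units.mul_inv]; rfl
  simp only [realSpectrum, unboundedSpectrum, Set.mem_ofPred_eq, not_not]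
  refine ⟨G ∘L (↑U⁻¹ : L2Rd d →L[ℂ] L2Rd d) ∘L G, fun f => ?_, fun ψ => ?_⟩
  · set k := (↑U⁻¹ : L2Rd d →L[ℂ] L2Rd d) (G f) with hk
    have hg : (G k, f + (E : ℂ) • G k) ∈ (formSum M V hM hV).graph := by
      refine (h.mem_graph_iff _ _).2 ⟨k, rfl, ?_⟩
      rw [pencil_zero_eq E, hk, hinvU, map_add, map_smul]
    obtain ⟨ψ, h1, h2⟩ := (LinearPMap.mem_graph_iff _).1 hg
    replace h1 : (ψ : L2Rd d) = G k := h1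
    have hmem : G k ∈ (formSum M V hM hV).domain := h1 ▸ ψ.2
    refine ⟨hmem, ?_⟩
    have h3 : (⟨G k, hmem⟩ : (formSum M V hM hV).domain) = ψ := Subtype.ext h1.symm
    show formSum M V hM hV ⟨G k, hmem⟩ - (E : ℂ) • G k = f
    rw [h3, h2, add_sub_cancel_right]
  · obtain ⟨f, hf, hf2⟩ := (h.mem_graph_iff _ _).1 (LinearPMap.mem_graph _ ψ)
    show G ((↑U⁻¹ : L2Rd d →L[ℂ] L2Rd d) (G (formSum M V hM hV ψ - (E : ℂ) • (ψ : L2Rd d)))) = ψ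
    rw [map_sub, map_smul, ← hf2, ← hf, pencil_zero_eq E, add_sub_cancel_right, hUinv]

end IsFormFactorization

theorem IsEigenvalue.mem_realSpectrum {H : Type*} [NormedAddCommGroup H] [InnerProductSpace ℂ H]
    {A : H →ₗ.[ℂ] H} {E : ℝ} (h : IsEigenvalue A E) : E ∈ realSpectrum A := by
  obtain ⟨ψ, h0, h1⟩ := h
  rintro ⟨R, -, hR⟩
  have := hR ψ
  rw [h1, sub_self, map_zero] at this
  exact h0 this.symm

end FormSum

/-! ### The energy functional and the bottom of the spectrum -/

section Energy

variable {d : ℕ}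

/-- The energy `⟨ψ, (T(p) + V) ψ⟩`. -/
noncomputable def formEnergy (T V : Rd d → ℝ) (ψ : L2Rd d) : ℝ :=
  (∫ ξ, symbolFourier T ξ * ‖(𝓕 ψ : L2Rd d) ξ‖ ^ 2) + ∫ x, V x * ‖ψ x‖ ^ 2

theorem weightedForm_self (w : Rd d → ℝ) (ψ : L2Rd d) :
    weightedForm w ψ ψ = ((∫ x, w x * ‖ψ x‖ ^ 2 : ℝ) : ℂ) := by
  rw [weightedForm, ← integral_complex_ofReal]
  refine integral_congr_ae (Filter.Eventually.of_forall fun x => ?_)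
  simp only [Complex.conj_mul', Complex.ofReal_mul, Complex.ofReal_pow]

theorem formSumForm_self (T V : Rd d → ℝ) (ψ : L2Rd d) :
    formSumForm T V ψ ψ = (formEnergy T V ψ : ℂ) := by
  rw [formSumForm, weightedForm_self, weightedForm_self, formEnergy, Complex.ofReal_add]

variable {M V : Rd d → ℝ} {hM : Measurable M} {hV : AEMeasurable V} {m : ℝ}
  {G B : L2Rd d →L[ℂ] L2Rd d}

theorem IsFormFactorization.inner_pencil_self (h : IsFormFactorization M V hM hV m G B) (E : ℝ)
    (f : L2Rd d) :
    inner ℂ f (pencil G B E f) = ((formEnergy M V (G f) - E * ‖G f‖ ^ 2 : ℝ) : ℂ) := by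
  rw [h.inner_pencil_eq, formSumForm_self, inner_self_eq_norm_sq_to_K]
  push_cast
  rfl

theorem IsFormFactorization.re_inner_pencil_self (h : IsFormFactorization M V hM hV m G B) (E : ℝ)
    (f : L2Rd d) :
    (inner ℂ f (pencil G B E f)).re = formEnergy M V (G f) - E * ‖G f‖ ^ 2 := by
  rw [h.inner_pencil_self, Complex.ofReal_re]

/-- Relative form boundedness: the form domain of `M(p)` is that of `M(p) + V`. -/
theorem IsRelFormCompact.mem_formDomain (h : IsRelFormCompact M V) (hM : Measurable M)
    (hV : AEMeasurable V) (hM0 : ∀ η, 0 ≤ M η) {ψ : L2Rd d}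
    (hψ : FiniteForm (symbolFourier M) (𝓕 ψ : L2Rd d)) : ψ ∈ formDomain M V hM hV := by
  obtain ⟨G, B, hGB⟩ := exists_formFactorization hM hV le_rfl hM0 h
  exact (hGB.mem_formDomain ψ).2 (hGB.exists_eq ψ hψ)

/-- The form of `M(p) + V` is bounded below. -/
theorem exists_formEnergy_ge (hM : Measurable M) (hV : AEMeasurable V)
    (hM0 : ∀ η, 0 ≤ M η) (h : IsRelFormCompact M V) :
    ∃ c : ℝ, ∀ ψ ∈ formDomain M V hM hV, -c * ‖ψ‖ ^ 2 ≤ formEnergy M V ψ := by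
  obtain ⟨G, B, hGB⟩ := exists_formFactorization hM hV le_rfl hM0 h
  obtain ⟨K, -, hK⟩ := hGB.compact.exists_inner_le hGB.symm_left hGB.denseRange one_pos
  refine ⟨K + 1, fun ψ hψ => ?_⟩
  obtain ⟨f, rfl⟩ := (hGB.mem_formDomain ψ).1 hψ
  have h1 := hGB.re_inner_pencil_self 0 f
  rw [re_inner_pencil hGB.symm_left] at h1
  have h2 := hK f
  have h3 := neg_abs_le (inner ℂ f (B f)).re
  have h4 := Complex.abs_re_le_norm (inner ℂ f (B f))
  nlinarith

/-- Below `m ≤ M(p)`, the bottom of the spectrum of `M(p) + V` is an eigenvalue, which is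
characterized variationally. -/
theorem exists_ground_state (hM : Measurable M) (hV : AEMeasurable V) (hm : 0 ≤ m)
    (hmM : ∀ η, m ≤ M η) (h : IsRelFormCompact M V)
    (hneg : ∃ ψ ∈ formDomain M V hM hV, formEnergy M V ψ < m * ‖ψ‖ ^ 2) :
    ∃ E < m, IsLeast (realSpectrum (formSum M V hM hV)) E ∧ IsEigenvalue (formSum M V hM hV) E ∧
      (∀ ψ ∈ formDomain M V hM hV, E * ‖ψ‖ ^ 2 ≤ formEnergy M V ψ) ∧
      ∃ ψ ∈ formDomain M V hM hV, ψ ≠ 0 ∧ formEnergy M V ψ = E * ‖ψ‖ ^ 2 := by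
  obtain ⟨G, B, hGB⟩ := exists_formFactorization hM hV hm hmM h
  obtain ⟨ψ, hψ, hlt⟩ := hneg
  obtain ⟨f, rfl⟩ := (hGB.mem_formDomain ψ).1 hψ
  obtain ⟨E, hE, hpos, g, hg0, hg⟩ := exists_ground_state_pencil hGB.symm_left hGB.denseRange
    hGB.symm_right hm hGB.bound hGB.compact
    ⟨f, by rw [hGB.re_inner_pencil_self]; linarith⟩
  have heig := (hGB.isEigenvalue_iff E).2 ⟨g, hg0, hg⟩
  refine ⟨E, hE, ⟨heig.mem_realSpectrum, fun F hF => ?_⟩, heig, fun φ hφ => ?_, G g,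
    (hGB.mem_formDomain _).2 ⟨g, rfl⟩, fun h0 => hg0 (hGB.injective g h0), ?_⟩
  -- Below `E` the form exceeds a nonnegative one by a positive multiple of `‖G k‖²`, so the kernel
  -- is trivial and the Fredholm alternative excludes spectrum.
  · by_contra hlt'
    refine hGB.not_mem_realSpectrum (isUnit_pencil hGB.symm_left hm hGB.bound hGB.compact
      ((not_le.1 hlt').trans hE) fun k hk => ?_) hF
    have h1 := re_inner_pencil_sub (B := B) hGB.symm_left F E k
    rw [hk, inner_zero_right, Complex.zero_re] at h1
    have h2 := hpos k
    refine hGB.injective k (norm_eq_zero.1 (pow_eq_zero_iff two_ne_zero |>.1 ?_))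
    nlinarith [sq_nonneg ‖G k‖, not_le.1 hlt']
  · obtain ⟨k, rfl⟩ := (hGB.mem_formDomain φ).1 hφ
    have h1 := hpos k
    rw [hGB.re_inner_pencil_self] at h1
    linarith
  · have h1 := hGB.re_inner_pencil_self E g
    rw [hg, inner_zero_right, Complex.zero_re] at h1
    linarith

theorem infinite_eigenvalues (hM : Measurable M) (hV : AEMeasurable V) (hm : 0 ≤ m)
    (hmM : ∀ η, m ≤ M η) (h : IsRelFormCompact M V)
    (hneg : ∀ U : Submodule ℂ (L2Rd d), FiniteDimensional ℂ U →
      ∃ ψ ∈ formDomain M V hM hV, ψ ∈ Uᗮ ∧ formEnergy M V ψ < m * ‖ψ‖ ^ 2) :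
    {E : ℝ | E < m ∧ IsEigenvalue (formSum M V hM hV) E}.Infinite := by
  obtain ⟨G, B, hGB⟩ := exists_formFactorization hM hV hm hmM h
  simp only [hGB.isEigenvalue_iff]
  refine infinite_eigenvalues_pencil hGB.symm_left hGB.denseRange hGB.injective hGB.symm_right hm
    hGB.bound hGB.compact fun U hU => ?_
  obtain ⟨ψ, hψ, hperp, hlt⟩ := hneg U hU
  obtain ⟨f, rfl⟩ := (hGB.mem_formDomain ψ).1 hψ
  exact ⟨f, hperp, by rw [hGB.re_inner_pencil_self]; linarith⟩

/-- A lower bound for `T + 2V` lets half of the kinetic energy control `V`, leaving the other half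
to provide a gap at high temperature. -/
theorem IsRelFormCompact.two_mul (h : IsRelFormCompact M V) :
    IsRelFormCompact M (fun x => 2 * V x) := by
  obtain ⟨C, hC, hCf⟩ := h
  refine ⟨(2 : ℂ) • C, hC.smul (2 : ℂ), fun f g φ γ hφ hγ => ?_⟩
  obtain ⟨h1, h2⟩ := hCf f g φ γ hφ hγ
  have e : (fun x : Rd d => ((|2 * V x| : ℝ) : ℂ) * (conj (φ x) * γ x))
      = fun x => 2 * (((|V x| : ℝ) : ℂ) * (conj (φ x) * γ x)) := by
    funext x
    rw [abs_mul, abs_two]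
    push_cast
    ring
  rw [e]
  refine ⟨h1.const_mul 2, ?_⟩
  rw [integral_const_mul, ← h2, smul_apply, inner_smul_right]

end Energy

/-! ### The BCS symbols -/

section Symbols

variable {d : ℕ}

theorem bcsSymbolInfty_nonneg (μ : ℝ) (η : Rd d) : 0 ≤ bcsSymbolInfty d μ η := abs_nonneg _

theorem bcsSymbol_of_eq {β μ : ℝ} {η : Rd d} (h : bcsSymbolInfty d μ η = 0) :
    bcsSymbol d β μ η = 2 / β := by
  rw [bcsSymbolInfty, abs_eq_zero, sub_eq_zero] at h
  rw [bcsSymbol, if_pos h]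

/-- The function `x coth(βx/2)` is even, so only `|η² - μ|` matters. The excess over it is explicit,
and all comparisons between symbols are read off from this form. -/
theorem bcsSymbol_of_ne {β μ : ℝ} (hβ : 0 < β) {η : Rd d} (h : bcsSymbolInfty d μ η ≠ 0) :
    bcsSymbol d β μ η = bcsSymbolInfty d μ η
      + 2 * bcsSymbolInfty d μ η / (Real.exp (β * bcsSymbolInfty d μ η) - 1) := by
  have h0 : ‖η‖ ^ 2 - μ ≠ 0 := abs_ne_zero.1 h
  rw [bcsSymbol, if_neg (fun h' => h0 (sub_eq_zero.2 h'))]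
  have hx : ∀ x : ℝ, x ≠ 0 → Real.exp (β * x) - 1 ≠ 0 := fun x hx => by
    rw [sub_ne_zero, ne_eq, Real.exp_eq_one_iff]
    exact mul_ne_zero hβ.ne' hx
  unfold bcsSymbolInfty
  set x := ‖η‖ ^ 2 - μ with hxdef
  rcases abs_choice x with e | e
  · rw [e]
    have := hx x h0
    generalize Real.exp (β * x) = y at this ⊢
    field_simp
    ring
  · rw [e]
    have h1 := hx x h0
    have h2 := hx (-x) (neg_ne_zero.2 h0)
    have h3 : Real.exp (β * -x) = (Real.exp (β * x))⁻¹ := by rw [mul_neg, Real.exp_neg]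
    rw [h3] at h2 ⊢
    have h4 := Real.exp_ne_zero (β * x)
    generalize Real.exp (β * x) = y at h1 h2 h4 ⊢
    have h5 : y⁻¹ - 1 = (1 - y) / y := by field_simp
    have h6 : 1 - y ≠ 0 := fun h' => h1 (by linarith)
    rw [h5]
    field_simp
    ring

theorem bcsSymbolInfty_le_bcsSymbol {β μ : ℝ} (hβ : 0 < β) (η : Rd d) :
    bcsSymbolInfty d μ η ≤ bcsSymbol d β μ η := by
  have h0 := bcsSymbolInfty_nonneg μ η
  by_cases h : bcsSymbolInfty d μ η = 0
  · rw [bcsSymbol_of_eq h, h]; positivity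
  · rw [bcsSymbol_of_ne hβ h]
    have h1 : 0 < Real.exp (β * bcsSymbolInfty d μ η) - 1 :=
      sub_pos.2 (Real.one_lt_exp_iff.2 (mul_pos hβ (lt_of_le_of_ne h0 (Ne.symm h))))
    have : 0 ≤ 2 * bcsSymbolInfty d μ η / (Real.exp (β * bcsSymbolInfty d μ η) - 1) := by
      positivity
    linarith

theorem bcsSymbol_le {β μ : ℝ} (hβ : 0 < β) (η : Rd d) :
    bcsSymbol d β μ η ≤ bcsSymbolInfty d μ η + 2 / β := by
  have h0 := bcsSymbolInfty_nonneg μ η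
  by_cases h : bcsSymbolInfty d μ η = 0
  · rw [bcsSymbol_of_eq h, h, zero_add]
  · rw [bcsSymbol_of_ne hβ h]
    have hp := mul_pos hβ (lt_of_le_of_ne h0 (Ne.symm h))
    have h1 : 0 < Real.exp (β * bcsSymbolInfty d μ η) - 1 :=
      sub_pos.2 (Real.one_lt_exp_iff.2 hp)
    have h2 := Real.add_one_le_exp (β * bcsSymbolInfty d μ η)
    refine add_le_add_right ?_ _
    rw [div_le_div_iff₀ h1 hβ]
    linarith

/-- `2 (e^y - 1) ≤ y (e^y + 1)` for `y ≥ 0`, that is, `tanh (y / 2) ≤ y / 2`. -/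
theorem two_mul_exp_sub_one_le {y : ℝ} (hy : 0 ≤ y) :
    2 * (Real.exp y - 1) ≤ y * (Real.exp y + 1) := by
  have hd : ∀ t : ℝ, HasDerivAt (fun y => y * (Real.exp y + 1) - 2 * (Real.exp y - 1))
      (1 * (Real.exp t + 1) + t * Real.exp t - 2 * Real.exp t) t := fun t =>
    ((hasDerivAt_id t).mul ((Real.hasDerivAt_exp t).add_const 1)).sub
      (((Real.hasDerivAt_exp t).sub_const 1).const_mul 2)
  have hmono : Monotone fun y : ℝ => y * (Real.exp y + 1) - 2 * (Real.exp y - 1) := by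
    refine monotone_of_deriv_nonneg (fun t => (hd t).differentiableAt) fun t => ?_
    rw [(hd t).deriv]
    -- The derivative equals `exp t * (exp (-t) - 1 + t)`.
    have h1 := Real.add_one_le_exp (-t)
    have h2 : Real.exp (-t) * Real.exp t = 1 := by rw [← Real.exp_add]; simp
    nlinarith [Real.exp_pos t]
  have := hmono hy
  simp only [zero_mul, Real.exp_zero, sub_self, mul_zero] at this
  linarith

theorem two_div_le_bcsSymbol {β μ : ℝ} (hβ : 0 < β) (η : Rd d) :
    2 / β ≤ bcsSymbol d β μ η := by
  have h0 := bcsSymbolInfty_nonneg μ η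
  by_cases h : bcsSymbolInfty d μ η = 0
  · rw [bcsSymbol_of_eq h]
  · rw [bcsSymbol_of_ne hβ h]
    have hp := mul_pos hβ (lt_of_le_of_ne h0 (Ne.symm h))
    have h1 : 0 < Real.exp (β * bcsSymbolInfty d μ η) - 1 :=
      sub_pos.2 (Real.one_lt_exp_iff.2 hp)
    have h2 := two_mul_exp_sub_one_le hp.le
    have h3 : bcsSymbolInfty d μ η
        + 2 * bcsSymbolInfty d μ η / (Real.exp (β * bcsSymbolInfty d μ η) - 1)
        = bcsSymbolInfty d μ η * (Real.exp (β * bcsSymbolInfty d μ η) + 1)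
          / (Real.exp (β * bcsSymbolInfty d μ η) - 1) := by
      have h1' := h1.ne'
      generalize Real.exp (β * bcsSymbolInfty d μ η) = y at h1' ⊢
      field_simp
      ring
    rw [h3, div_le_div_iff₀ hβ h1]
    linarith

theorem bcsSymbol_strictAnti {β₁ β₂ μ : ℝ} (h1 : 0 < β₁) (h12 : β₁ < β₂) (η : Rd d) :
    bcsSymbol d β₂ μ η < bcsSymbol d β₁ μ η := by
  have h2 := h1.trans h12
  have h0 := bcsSymbolInfty_nonneg μ η
  by_cases h : bcsSymbolInfty d μ η = 0
  · rw [bcsSymbol_of_eq h, bcsSymbol_of_eq h]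
    exact div_lt_div_of_pos_left two_pos h1 h12
  · rw [bcsSymbol_of_ne h1 h, bcsSymbol_of_ne h2 h]
    have hp := lt_of_le_of_ne h0 (Ne.symm h)
    have h3 : 0 < Real.exp (β₁ * bcsSymbolInfty d μ η) - 1 :=
      sub_pos.2 (Real.one_lt_exp_iff.2 (mul_pos h1 hp))
    have h4 : Real.exp (β₁ * bcsSymbolInfty d μ η) < Real.exp (β₂ * bcsSymbolInfty d μ η) :=
      Real.exp_lt_exp.2 (mul_lt_mul_of_pos_right h12 hp)
    have := div_lt_div_of_pos_left (a := 2 * bcsSymbolInfty d μ η) (by positivity) h3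
      (sub_lt_sub_right h4 1)
    linarith

end Symbols

/-! ### Wave packets concentrating on the Fermi sphere -/

section WavePacket

open Filter Topology
open scoped Pointwise

variable {d : ℕ}

/-- The plane wave `exp (2πi ω·x)`. -/
noncomputable def planeWave (ω x : Rd d) : ℂ := (Real.fourierChar (inner ℝ ω x) : ℂ)

theorem norm_planeWave (ω x : Rd d) : ‖planeWave ω x‖ = 1 := Circle.norm_coe _

theorem continuous_planeWave (ω : Rd d) : Continuous (planeWave ω) :=
  continuous_induced_dom.comp (Real.continuous_fourierChar.comp (by fun_prop))

theorem continuous_planeWave_left (x : Rd d) : Continuous fun ω : Rd d => planeWave ω x :=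
  continuous_induced_dom.comp (Real.continuous_fourierChar.comp (by fun_prop))

theorem fourierInv_eq_planeWave (h : Rd d → ℂ) (x : Rd d) :
    𝓕⁻ h x = ∫ ξ, planeWave ξ x * h ξ := by
  rw [Real.fourierInv_eq]
  rfl

/-- On `L¹ ∩ L²` the inverse Fourier transform is given by the Fourier integral. -/
theorem fourierInv_toLp_ae_eq {h : Rd d → ℂ} (h1 : Integrable h) (h2 : MemLp h 2) :
    ∀ᵐ x, (𝓕⁻ (h2.toLp h : L2Rd d) : L2Rd d) x = 𝓕⁻ h x := by
  have hcont : Continuous (𝓕⁻ h) := by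
    have : 𝓕⁻ h = fun x => 𝓕 h (-x) := funext fun x => Real.fourierInv_eq_fourier_neg h x
    rw [this]
    exact (VectorFourier.fourierIntegral_continuous Real.continuous_fourierChar
      (by exact continuous_inner) h1).comp continuous_neg
  -- Both sides are compared against test functions: the `L²` transform through tempered
  -- distributions, the integral through Fubini.
  refine ae_eq_of_integral_contDiff_smul_eq ((Lp.memLp _).locallyIntegrable (by norm_num))
    hcont.locallyIntegrable fun g g_smooth g_cpt => ?_
  have hg₁ : HasCompactSupport (Complex.ofRealCLM ∘ g) := g_cpt.comp_left rfl
  have hg₂ : ContDiff ℝ (⊤ : ℕ∞) (Complex.ofRealCLM ∘ g) := by fun_prop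
  set G : SchwartzMap (Rd d) ℂ := hg₁.toSchwartzMap hg₂ with hG
  have hGg : ∀ x, G x = (g x : ℂ) := fun x => rfl
  have e1 := congrArg (fun T => T G)
    (Lp.fourierInv_toTemperedDistribution_eq (h2.toLp h : L2Rd d))
  simp only [TemperedDistribution.fourierInv_apply, Lp.toTemperedDistribution_apply] at e1
  have e2 : ∫ x, G x • 𝓕⁻ h x = ∫ ξ, (𝓕⁻ (G : Rd d → ℂ)) ξ • h ξ := by
    have := VectorFourier.integral_fourierIntegral_smul_eq_flip (μ := volume) (ν := volume)
      (e := Real.fourierChar) (L := -innerₗ (Rd d)) (f := (G : Rd d → ℂ)) (g := h)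
      Real.continuous_fourierChar (by
        have : Continuous fun p : Rd d × Rd d => -(inner ℝ p.1 p.2) := by fun_prop
        exact this) G.integrable h1
    have hflip : (-innerₗ (Rd d)).flip = -innerₗ (Rd d) := by
      ext x y
      simp [real_inner_comm]
    rw [hflip] at this
    exact this.symm
  calc ∫ x, g x • (𝓕⁻ (h2.toLp h : L2Rd d) : L2Rd d) x
      = ∫ x, G x • (𝓕⁻ (h2.toLp h : L2Rd d) : L2Rd d) x := by simp [hGg]
    _ = ∫ ξ, (𝓕⁻ G) ξ • (h2.toLp h : L2Rd d) ξ := e1.symm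
    _ = ∫ ξ, (𝓕⁻ (G : Rd d → ℂ)) ξ • h ξ := by
        refine integral_congr_ae ?_
        filter_upwards [h2.coeFn_toLp] with ξ hξ
        rw [hξ, SchwartzMap.fourierInv_coe]
    _ = ∫ x, g x • 𝓕⁻ h x := by rw [← e2]; simp [hGg]

theorem symbolFourier_bcsSymbolInfty (μ : ℝ) (ξ : Rd d) :
    symbolFourier (bcsSymbolInfty d μ) ξ = |4 * Real.pi ^ 2 * ‖ξ‖ ^ 2 - μ| := by
  unfold symbolFourier bcsSymbolInfty
  rw [norm_smul, Real.norm_eq_abs, abs_of_pos Real.two_pi_pos]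
  ring_nf

/-- The part of the cone around `ω` with vertex `0` which lies in the ball of radius `s`. -/
def coneSector (ω : Rd d) (r s : ℝ) : Set (Rd d) :=
  {ξ | 0 < ‖ξ‖ ∧ ‖ξ‖ < s ∧ ‖‖ξ‖⁻¹ • ξ - ω‖ < r}

theorem measurableSet_coneSector (ω : Rd d) (r s : ℝ) : MeasurableSet (coneSector ω r s) := by
  unfold coneSector
  refine (measurableSet_lt measurable_const measurable_norm).inter
    ((measurableSet_lt measurable_norm measurable_const).inter
      (measurableSet_lt (f := fun ξ : Rd d => ‖‖ξ‖⁻¹ • ξ - ω‖) (by fun_prop) measurable_const))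

theorem coneSector_mono (ω : Rd d) (r : ℝ) {s t : ℝ} (h : s ≤ t) :
    coneSector ω r s ⊆ coneSector ω r t := fun _ ⟨h1, h2, h3⟩ => ⟨h1, h2.trans_le h, h3⟩

/-- Sectors with vertex `0` are dilates of one another, so radial shells in a cone have explicit
volume without polar coordinates. -/
theorem volume_coneSector (ω : Rd d) (r : ℝ) {s : ℝ} (hs : 0 < s) :
    volume (coneSector ω r s) = ENNReal.ofReal (s ^ d) * volume (coneSector ω r 1) := by
  have : coneSector ω r s = s • coneSector ω r 1 := by
    ext ξ
    rw [Set.mem_smul_set_iff_inv_smul_mem₀ hs.ne']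
    unfold coneSector
    simp only [Set.mem_ofPred_eq, norm_smul, norm_inv, Real.norm_eq_abs, abs_of_pos hs, mul_inv,
      inv_inv, smul_smul]
    have e : s * ‖ξ‖⁻¹ * s⁻¹ = ‖ξ‖⁻¹ := by field_simp
    rw [e, inv_mul_lt_iff₀ hs, mul_one]
    have : 0 < s⁻¹ * ‖ξ‖ ↔ 0 < ‖ξ‖ := mul_pos_iff_of_pos_left (inv_pos.2 hs)
    rw [this]
  rw [this, Measure.addHaar_smul]
  simp [abs_of_pos hs]

theorem volume_coneSector_one_pos {ω : Rd d} (hω : ‖ω‖ = 1) {r : ℝ} (hr : 0 < r) :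
    0 < volume (coneSector ω r 1) := by
  have hopen : IsOpen {ξ : Rd d | ξ ≠ 0 ∧ ‖ξ‖ < 1 ∧ ‖‖ξ‖⁻¹ • ξ - ω‖ < r} := by
    rw [isOpen_iff_mem_nhds]
    rintro ξ ⟨h1, h2, h3⟩
    have hc : ContinuousAt (fun ξ : Rd d => ‖‖ξ‖⁻¹ • ξ - ω‖) ξ :=
      (((continuous_norm.continuousAt).inv₀ (norm_ne_zero_iff.2 h1)).smul
        continuousAt_id |>.sub continuousAt_const).norm
    filter_upwards [isOpen_ne.mem_nhds h1, continuous_norm.continuousAt.eventually_lt_const h2,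
      hc.eventually_lt_const h3] with η a b c
    exact ⟨a, b, c⟩
  have hsub : {ξ : Rd d | ξ ≠ 0 ∧ ‖ξ‖ < 1 ∧ ‖‖ξ‖⁻¹ • ξ - ω‖ < r} ⊆ coneSector ω r 1 :=
    fun ξ ⟨h1, h2, h3⟩ => ⟨norm_pos_iff.2 h1, h2, h3⟩
  refine (hopen.measure_pos volume ⟨(2⁻¹ : ℝ) • ω, ?_, ?_, ?_⟩).trans_le (measure_mono hsub)
  · have : ω ≠ 0 := fun h => by simp [h] at hω
    simpa using this
  · rw [norm_smul, hω]; norm_num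
  · rw [norm_smul, hω, smul_smul]; norm_num [hr]

theorem volume_coneSector_one_lt_top (ω : Rd d) (r : ℝ) : volume (coneSector ω r 1) < ∞ := by
  refine (measure_mono (fun ξ h => ?_)).trans_lt
    (measure_ball_lt_top (μ := (volume : Measure (Rd d))) (x := 0) (r := 1))
  exact mem_ball_zero_iff.2 h.2.1

/-- Bounds the volume of a shell from below by its relative thickness. -/
theorem sub_le_pow_sub_pow {a b : ℝ} (hb : 1 ≤ b) (hab : b ≤ a) {d : ℕ} (hd : d ≠ 0) :
    a - b ≤ a ^ d - b ^ d := by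
  obtain ⟨n, rfl⟩ := Nat.exists_eq_succ_of_ne_zero hd
  have h1 : b ^ n ≤ a ^ n := pow_le_pow_left₀ (by linarith) hab n
  have h2 : 1 ≤ a ^ n := one_le_pow₀ (hb.trans hab)
  rw [pow_succ, pow_succ]
  nlinarith

/-- `1 / T` is not integrable near any point of the Fermi sphere. -/
theorem lintegral_inv_symbol_eq_top (hd : d ≠ 0) {μ : ℝ} (hμ : 0 < μ) {ω : Rd d}
    (hω : 4 * Real.pi ^ 2 * ‖ω‖ ^ 2 = μ) {r : ℝ} (hr : 0 < r) :
    ∫⁻ ξ in Metric.ball ω r, ENNReal.ofReal (symbolFourier (bcsSymbolInfty d μ) ξ)⁻¹ = ∞ := by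
  set ρ := ‖ω‖ with hρ
  have hρ0 : 0 < ρ := by
    rcases (norm_nonneg ω).eq_or_lt with h | h
    · rw [← hρ] at h; rw [← h] at hω; norm_num at hω; linarith
    · exact h
  set e : Rd d := ρ⁻¹ • ω with he
  have hen : ‖e‖ = 1 := by
    rw [he, norm_smul, norm_inv, Real.norm_eq_abs, abs_of_pos hρ0, inv_mul_cancel₀ hρ0.ne']
  -- Points of the shells have norm below `2ρ`, so this aperture allows a transverse displacement of
  -- at most `2ρ r' = r / 2`.
  set r' : ℝ := r / (4 * ρ) with hr'
  have hr'0 : 0 < r' := by positivity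
  set v : ℝ≥0∞ := volume (coneSector e r' 1) with hv
  have hv0 : v ≠ 0 := (volume_coneSector_one_pos hen hr'0).ne'
  have hvt : v ≠ ∞ := (volume_coneSector_one_lt_top e r').ne
  obtain ⟨N, hN⟩ := exists_pow_lt_of_lt_one (show 0 < min 1 (r / (2 * ρ)) by positivity)
    (show (2⁻¹ : ℝ) < 1 by norm_num)
  -- Dyadic shells just outside the Fermi sphere: the `k`-th has volume at least of order `2⁻ᵏ` and
  -- `1/T` at least of order `2ᵏ`, so each contributes at least a fixed positive amount. The shift
  -- `N` keeps them all within the ball.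
  set s : ℕ → ℝ := fun k => ρ * (1 + 2⁻¹ ^ (k + N)) with hs
  have hs0 : ∀ k, 0 < s k := fun k => by positivity
  have hsanti : Antitone s := by
    intro i j hij
    simp only [hs]
    have : (2⁻¹ : ℝ) ^ (j + N) ≤ 2⁻¹ ^ (i + N) :=
      pow_le_pow_of_le_one (by norm_num) (by norm_num) (by omega)
    gcongr
  set A : ℕ → Set (Rd d) := fun k => coneSector e r' (s k) \ coneSector e r' (s (k + 1)) with hA
  have hAm : ∀ k, MeasurableSet (A k) := fun k =>
    (measurableSet_coneSector _ _ _).diff (measurableSet_coneSector _ _ _)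
  have hAnorm : ∀ k, ∀ ξ ∈ A k, s (k + 1) ≤ ‖ξ‖ := by
    rintro k ξ ⟨⟨h1, h2, h3⟩, h4⟩
    by_contra h
    exact h4 ⟨h1, not_le.1 h, h3⟩
  have hAdisj : Pairwise (Function.onFun Disjoint A) := by
    have key : ∀ i j, i < j → Disjoint (A i) (A j) := by
      intro i j hij
      rw [Set.disjoint_left]
      intro ξ hi hj
      have h1 := hAnorm i ξ hi
      have h2 : ‖ξ‖ < s j := hj.1.2.1
      have h3 := hsanti (Nat.succ_le_of_lt hij)
      simp only [Nat.succ_eq_add_one] at h3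
      linarith
    intro i j hij
    rcases lt_or_gt_of_ne hij with h | h
    · exact key i j h
    · exact (key j i h).symm
  have hpow : ∀ k, (2⁻¹ : ℝ) ^ (k + N) ≤ 2⁻¹ ^ N := fun k =>
    pow_le_pow_of_le_one (by norm_num) (by norm_num) (by omega)
  have hN1 : (2⁻¹ : ℝ) ^ N < 1 := hN.trans_le (min_le_left _ _)
  have hN2 : ρ * (2⁻¹ : ℝ) ^ N < r / 2 := by
    have := hN.trans_le (min_le_right _ _)
    rw [lt_div_iff₀ (by positivity)] at this
    linarith
  have hAball : (⋃ k, A k) ⊆ Metric.ball ω r := by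
    refine Set.iUnion_subset fun k ξ hξ => ?_
    obtain ⟨⟨h1, h2, h3⟩, -⟩ := id hξ
    have h4 := hAnorm k ξ hξ
    have h5 : ξ - ω = ‖ξ‖ • (‖ξ‖⁻¹ • ξ - e) + (‖ξ‖ - ρ) • e := by
      rw [smul_sub, smul_smul, mul_inv_cancel₀ h1.ne', one_smul, sub_smul, he, smul_smul ρ,
        mul_inv_cancel₀ hρ0.ne', one_smul]
      abel
    have h6 : ρ ≤ ‖ξ‖ := by
      refine le_trans ?_ h4
      simp only [hs]
      have : (0 : ℝ) ≤ 2⁻¹ ^ (k + 1 + N) := by positivity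
      nlinarith
    have h7 : ‖ξ‖ - ρ < r / 2 := by
      simp only [hs] at h2
      nlinarith [hpow k]
    have h8 : ‖ξ‖ < 2 * ρ := by
      simp only [hs] at h2
      nlinarith [hpow k]
    rw [Metric.mem_ball, dist_eq_norm, h5]
    refine (norm_add_le _ _).trans_lt ?_
    rw [norm_smul, norm_smul, hen, norm_norm, Real.norm_eq_abs, abs_of_nonneg (by linarith)]
    have h9 : ‖ξ‖ * ‖‖ξ‖⁻¹ • ξ - e‖ ≤ (2 * ρ) * r' :=
      mul_le_mul h8.le h3.le (norm_nonneg _) (by positivity)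
    have h10 : (2 * ρ) * r' = r / 2 := by rw [hr']; field_simp; norm_num
    linarith
  have hvol : ∀ k, ENNReal.ofReal (ρ ^ d * 2⁻¹ ^ (k + 1 + N)) * v ≤ volume (A k) := by
    intro k
    have hsub : coneSector e r' (s (k + 1)) ⊆ coneSector e r' (s k) :=
      coneSector_mono e r' (hsanti (Nat.le_succ k))
    have hfin : volume (coneSector e r' (s (k + 1))) ≠ ∞ := by
      rw [volume_coneSector e r' (hs0 _)]
      exact ENNReal.mul_ne_top ENNReal.ofReal_ne_top hvt
    rw [hA]
    simp only
    rw [measure_sdiff hsub (measurableSet_coneSector _ _ _).nullMeasurableSet hfin,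
      volume_coneSector e r' (hs0 _), volume_coneSector e r' (hs0 _),
      ← ENNReal.sub_mul (fun _ _ => hvt), ← ENNReal.ofReal_sub _ (by have := hs0 (k+1); positivity)]
    gcongr
    simp only [hs, mul_pow]
    rw [← mul_sub]
    refine mul_le_mul_of_nonneg_left ?_ (by positivity)
    have h1 : (2⁻¹ : ℝ) ^ (k + N) = 2 * 2⁻¹ ^ (k + 1 + N) := by
      rw [show k + 1 + N = (k + N) + 1 by ring, pow_succ]; ring
    have h2 : (0 : ℝ) ≤ 2⁻¹ ^ (k + 1 + N) := by positivity
    have := sub_le_pow_sub_pow (a := 1 + 2⁻¹ ^ (k + N)) (b := 1 + 2⁻¹ ^ (k + 1 + N))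
      (by linarith) (by linarith) hd
    linarith
  -- With `t = 2⁻¹ ^ (k + 1 + N)`, the symbol is at most `μ ((1 + 2t)² - 1) = μ (4t + 4t²)`, which
  -- is at most `6μt` because `2t < 1`.
  have hT : ∀ k, ∀ ξ ∈ A k, (6 * μ * 2⁻¹ ^ (k + 1 + N))⁻¹
      ≤ (symbolFourier (bcsSymbolInfty d μ) ξ)⁻¹ := by
    intro k ξ hξ
    have h1 := hAnorm k ξ hξ
    have h2 : ‖ξ‖ < s k := hξ.1.2.1
    have h3 : (2⁻¹ : ℝ) ^ (k + N) = 2 * 2⁻¹ ^ (k + 1 + N) := by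
      rw [show k + 1 + N = (k + N) + 1 by ring, pow_succ]; ring
    have h4 : (0 : ℝ) < 2⁻¹ ^ (k + 1 + N) := by positivity
    simp only [hs] at h1 h2
    rw [h3] at h2
    set t : ℝ := 2⁻¹ ^ (k + 1 + N) with ht
    have h5 : 2 * t < 1 := by rw [← h3]; exact (hpow k).trans_lt hN1
    rw [symbolFourier_bcsSymbolInfty]
    have hπ : 0 < 4 * Real.pi ^ 2 := by positivity
    have h6 : ρ ^ 2 * (1 + t) ^ 2 ≤ ‖ξ‖ ^ 2 := by
      rw [← mul_pow]; exact pow_le_pow_left₀ (by positivity) h1 2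
    have h7 : ‖ξ‖ ^ 2 ≤ ρ ^ 2 * (1 + 2 * t) ^ 2 := by
      rw [← mul_pow]; exact pow_le_pow_left₀ (norm_nonneg _) h2.le 2
    have h8 : μ * (1 + t) ^ 2 ≤ 4 * Real.pi ^ 2 * ‖ξ‖ ^ 2 := by
      have := mul_le_mul_of_nonneg_left h6 hπ.le
      rwa [← mul_assoc, hω] at this
    have h9 : 4 * Real.pi ^ 2 * ‖ξ‖ ^ 2 ≤ μ * (1 + 2 * t) ^ 2 := by
      have := mul_le_mul_of_nonneg_left h7 hπ.le
      rwa [← mul_assoc (4 * Real.pi ^ 2), hω] at this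
    have hμt : 0 < μ * t := by positivity
    have h10 : 0 < 4 * Real.pi ^ 2 * ‖ξ‖ ^ 2 - μ := by nlinarith
    rw [abs_of_pos h10]
    refine inv_anti₀ h10 ?_
    nlinarith
  rw [eq_top_iff]
  calc ∞ = ∑' _ : ℕ, ENNReal.ofReal (ρ ^ d / (6 * μ)) * v :=
        (ENNReal.tsum_const_eq_top_of_ne_zero (mul_ne_zero
          (ENNReal.ofReal_pos.2 (by positivity)).ne' hv0)).symm
    _ ≤ ∑' k, ∫⁻ ξ in A k, ENNReal.ofReal (symbolFourier (bcsSymbolInfty d μ) ξ)⁻¹ := by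
        refine ENNReal.tsum_le_tsum fun k => ?_
        calc ENNReal.ofReal (ρ ^ d / (6 * μ)) * v
            = ENNReal.ofReal (6 * μ * 2⁻¹ ^ (k + 1 + N))⁻¹
              * (ENNReal.ofReal (ρ ^ d * 2⁻¹ ^ (k + 1 + N)) * v) := by
              rw [← mul_assoc, ← ENNReal.ofReal_mul (by positivity)]
              congr 2
              field_simp
          _ ≤ ENNReal.ofReal (6 * μ * 2⁻¹ ^ (k + 1 + N))⁻¹ * volume (A k) := by
              gcongr
              exact hvol k
          _ = ∫⁻ ξ in A k, ENNReal.ofReal (6 * μ * 2⁻¹ ^ (k + 1 + N))⁻¹ := by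
              rw [setLIntegral_const]
          _ ≤ _ := setLIntegral_mono' (hAm k) fun ξ hξ => ENNReal.ofReal_le_ofReal (hT k ξ hξ)
    _ = ∫⁻ ξ in ⋃ k, A k, ENNReal.ofReal (symbolFourier (bcsSymbolInfty d μ) ξ)⁻¹ :=
        (lintegral_iUnion hAm hAdisj _).symm
    _ ≤ _ := lintegral_mono_set hAball

end WavePacket

/-! ### Momentum densities, wave packets and integrable majorants of the potential. -/

section TrialStates

open Filter Topology

variable {d : ℕ}

/-- Nonnegative momentum densities of mass one, concentrated near a point of the Fermi sphere, with
small kinetic energy. -/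
theorem exists_concentrating_density (hd : d ≠ 0) {μ : ℝ} (hμ : 0 < μ) {ω : Rd d}
    (hω : 4 * Real.pi ^ 2 * ‖ω‖ ^ 2 = μ) {δ : ℝ} (hδ : 0 < δ) :
    ∃ h : Rd d → ℝ, Measurable h ∧ (∀ ξ, 0 ≤ h ξ) ∧ (∃ C, ∀ ξ, h ξ ≤ C) ∧
      (∀ ξ ∉ Metric.ball ω δ, h ξ = 0) ∧ ∫ ξ, h ξ = 1 ∧
      Integrable (fun ξ => symbolFourier (bcsSymbolInfty d μ) ξ * h ξ ^ 2) ∧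
      ∫ ξ, symbolFourier (bcsSymbolInfty d μ) ξ * h ξ ^ 2 ≤ δ := by
  set T := symbolFourier (bcsSymbolInfty d μ) with hT
  have hTm : Measurable T := measurable_symbolFourier (measurable_bcsSymbolInfty d μ)
  have hT0 : ∀ ξ, 0 ≤ T ξ := fun ξ => bcsSymbolInfty_nonneg μ _
  -- Cutting off small `T` makes `1/T` bounded by `k + 1`, while its integral over `S k` still
  -- diverges as `k` grows.
  set S : ℕ → Set (Rd d) := fun k => Metric.ball ω δ ∩ {ξ | ((k : ℝ) + 1)⁻¹ < T ξ} with hS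
  have hSm : ∀ k, MeasurableSet (S k) := fun k =>
    measurableSet_ball.inter (measurableSet_lt measurable_const hTm)
  have hSdir : Directed (· ⊆ ·) S := by
    refine Monotone.directed_le (f := S) fun i j hij ξ hξ => ⟨hξ.1, ?_⟩
    have h2 : ((i : ℝ) + 1)⁻¹ < T ξ := hξ.2
    show ((j : ℝ) + 1)⁻¹ < T ξ
    refine lt_of_le_of_lt ?_ h2
    have : (i : ℝ) ≤ j := by exact_mod_cast hij
    gcongr
  have htop : ∫⁻ ξ in ⋃ k, S k, ENNReal.ofReal (T ξ)⁻¹ = ∞ := by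
    rw [eq_top_iff, ← lintegral_inv_symbol_eq_top hd hμ hω hδ]
    -- As `0⁻¹ = 0`, the Fermi sphere contributes nothing to this integral, whatever its measure.
    have hz : ∫⁻ ξ in {ξ | T ξ = 0}, ENNReal.ofReal (T ξ)⁻¹ = 0 := by
      have hZ : MeasurableSet {ξ | T ξ = 0} := hTm (measurableSet_singleton 0)
      rw [setLIntegral_congr_fun (g := fun _ => 0) hZ fun ξ hξ => ?_, lintegral_zero]
      have hξ' : T ξ = 0 := hξ
      simp [hξ']
    calc _ ≤ ∫⁻ ξ in (⋃ k, S k) ∪ {ξ | T ξ = 0}, ENNReal.ofReal (T ξ)⁻¹ := by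
          refine lintegral_mono_set fun ξ hξ => ?_
          rcases (hT0 ξ).eq_or_lt with h | h
          · exact Or.inr h.symm
          · obtain ⟨k, hk⟩ := exists_nat_one_div_lt h
            exact Or.inl (Set.mem_iUnion.2 ⟨k, hξ, by
              show ((k : ℝ) + 1)⁻¹ < T ξ
              rwa [← one_div]⟩)
      _ ≤ _ := lintegral_union_le _ _ _
      _ = _ := by rw [hz, add_zero]
  rw [setLIntegral_iUnion_of_directed _ hSdir] at htop
  obtain ⟨k, hk⟩ := lt_iSup_iff.1 (htop ▸ ENNReal.ofReal_lt_top : ENNReal.ofReal δ⁻¹ < _)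
  have hle : ∀ ξ ∈ S k, (T ξ)⁻¹ ≤ k + 1 := fun ξ hξ => by
    have h1 : ((k : ℝ) + 1)⁻¹ < T ξ := hξ.2
    exact inv_le_of_inv_le₀ (by positivity) h1.le
  have hSfin : volume (S k) < ∞ :=
    (measure_mono Set.inter_subset_left).trans_lt measure_ball_lt_top
  have hint : IntegrableOn (fun ξ => (T ξ)⁻¹) (S k) := by
    refine Measure.integrableOn_of_bounded (M := k + 1) hSfin.ne
      hTm.inv.aestronglyMeasurable ?_
    refine (ae_restrict_iff' (hSm k)).2 (Eventually.of_forall fun ξ hξ => ?_)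
    rw [Real.norm_eq_abs, abs_of_nonneg (inv_nonneg.2 (hT0 ξ))]
    exact hle ξ hξ
  -- The density `T⁻¹ / c` on `S k` has mass one and kinetic energy `1 / c < δ`; by Cauchy-Schwarz
  -- this is the least energy for that mass and support.
  set c := ∫ ξ in S k, (T ξ)⁻¹ with hc
  have hcδ : δ⁻¹ < c := by
    rw [← ofReal_integral_eq_lintegral_ofReal hint
      (Eventually.of_forall fun ξ => inv_nonneg.2 (hT0 ξ))] at hk
    exact (ENNReal.ofReal_lt_ofReal_iff_of_nonneg (by positivity)).1 hk
  have hc0 : 0 < c := (inv_pos.2 hδ).trans hcδ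
  have hsq : (fun ξ => T ξ * (S k).indicator (fun ξ => (T ξ)⁻¹ / c) ξ ^ 2)
      = (S k).indicator fun ξ => (T ξ)⁻¹ / c ^ 2 := by
    funext ξ
    by_cases hξ : ξ ∈ S k
    · have : T ξ ≠ 0 := ((inv_pos.2 (by positivity : (0 : ℝ) < k + 1)).trans hξ.2).ne'
      rw [Set.indicator_of_mem hξ, Set.indicator_of_mem hξ]
      field_simp
    · rw [Set.indicator_of_notMem hξ, Set.indicator_of_notMem hξ]
      simp
  refine ⟨(S k).indicator fun ξ => (T ξ)⁻¹ / c, (hTm.inv.div_const c).indicator (hSm k),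
    fun ξ => Set.indicator_nonneg (fun ξ _ => div_nonneg (inv_nonneg.2 (hT0 ξ)) hc0.le) ξ,
    ⟨(k + 1) / c, fun ξ => ?_⟩,
    fun ξ hξ => Set.indicator_of_notMem (fun h => hξ h.1) _, ?_, ?_, ?_⟩
  · by_cases hξ : ξ ∈ S k
    · rw [Set.indicator_of_mem hξ]
      exact div_le_div_of_nonneg_right (hle ξ hξ) hc0.le
    · rw [Set.indicator_of_notMem hξ]
      positivity
  · rw [integral_indicator (hSm k), integral_div, ← hc, div_self hc0.ne']
  · rw [hsq]
    exact (integrable_indicator_iff (hSm k)).2 (hint.div_const _)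
  · rw [hsq, integral_indicator (hSm k), integral_div, ← hc, sq, ← div_div, div_self hc0.ne',
      one_div]
    exact (inv_lt_of_inv_lt₀ hδ hcδ).le

/-- Wave packets converging to a plane wave with momentum on the Fermi sphere. -/
theorem exists_wavePackets (hd : d ≠ 0) {μ : ℝ} (hμ : 0 < μ) {ω : Rd d}
    (hω : 4 * Real.pi ^ 2 * ‖ω‖ ^ 2 = μ) :
    ∃ ψ : ℕ → L2Rd d,
      (∀ n, FiniteForm (symbolFourier (bcsSymbolInfty d μ)) (𝓕 (ψ n) : L2Rd d)) ∧
      Tendsto (fun n => ∫ ξ, symbolFourier (bcsSymbolInfty d μ) ξ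
        * ‖(𝓕 (ψ n) : L2Rd d) ξ‖ ^ 2) atTop (𝓝 0) ∧
      (∀ n, ∀ᵐ x, ‖ψ n x‖ ≤ 1) ∧
      ∀ᵐ x, Tendsto (fun n => ψ n x) atTop (𝓝 (planeWave ω x)) := by
  have hδ : ∀ n : ℕ, (0 : ℝ) < 1 / ((n : ℝ) + 1) := fun n => by positivity
  choose h hm h0 hC hsupp h1 hTi hT using fun n : ℕ =>
    exists_concentrating_density hd hμ hω (hδ n)
  -- A nonintegrable function has Bochner integral `0`, which is not `1`.
  have hint : ∀ n, Integrable (h n) := fun n => by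
    by_contra hcon
    have := h1 n
    rw [integral_undef hcon] at this
    exact zero_ne_one this
  have hint' : ∀ n, Integrable (fun ξ => (h n ξ : ℂ)) := fun n => (hint n).ofReal
  have hmem : ∀ n, MemLp (fun ξ => (h n ξ : ℂ)) 2 := fun n => by
    obtain ⟨C, hC⟩ := hC n
    rw [memLp_two_iff_integrable_sq_norm (hint' n).aestronglyMeasurable]
    refine ((hint n).const_mul C).mono' ((hint' n).aestronglyMeasurable.norm.pow 2)
      (Eventually.of_forall fun ξ => ?_)
    simp only [Complex.norm_real, Real.norm_eq_abs, sq_abs, abs_of_nonneg (sq_nonneg (h n ξ))]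
    nlinarith [h0 n ξ, hC ξ]
  have hF : ∀ n, ∀ᵐ ξ, symbolFourier (bcsSymbolInfty d μ) ξ
      * ‖(𝓕 (𝓕⁻ ((hmem n).toLp _ : L2Rd d) : L2Rd d) : L2Rd d) ξ‖ ^ 2
      = symbolFourier (bcsSymbolInfty d μ) ξ * h n ξ ^ 2 := fun n => by
    filter_upwards [(hmem n).coeFn_toLp] with ξ hξ
    rw [fourier_fourierInv_L2Rd, hξ, Complex.norm_real, Real.norm_eq_abs, sq_abs]
  have hpt : ∀ n, ∀ᵐ x, (𝓕⁻ ((hmem n).toLp _ : L2Rd d) : L2Rd d) x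
      = ∫ ξ, planeWave ξ x * (h n ξ : ℂ) := fun n => by
    filter_upwards [fourierInv_toLp_ae_eq (hint' n) (hmem n)] with x hx
    rw [hx, fourierInv_eq_planeWave]
  -- Mass one gives the uniform bound; concentration at `ω` and continuity of the phase in `ξ` give
  -- pointwise convergence.
  refine ⟨fun n => (𝓕⁻ ((hmem n).toLp _ : L2Rd d) : L2Rd d), fun n => ?_, ?_, fun n => ?_, ?_⟩
  · exact (hTi n).congr ((hF n).mono fun ξ hξ => hξ.symm)
  · refine squeeze_zero (fun n => integral_nonneg fun ξ =>
      mul_nonneg (bcsSymbolInfty_nonneg μ _) (sq_nonneg _)) (fun n => ?_)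
      tendsto_one_div_add_atTop_nhds_zero_nat
    rw [integral_congr_ae (hF n)]
    exact hT n
  · filter_upwards [hpt n] with x hx
    rw [hx]
    refine (norm_integral_le_integral_norm _).trans (le_of_eq ?_)
    rw [← h1 n]
    refine integral_congr_ae (Eventually.of_forall fun ξ => ?_)
    simp only [norm_mul, norm_planeWave, one_mul, Complex.norm_real, Real.norm_eq_abs,
      abs_of_nonneg (h0 n ξ)]
  · filter_upwards [ae_all_iff.2 hpt] with x hx
    simp only [hx]
    rw [Metric.tendsto_atTop]
    intro ε hε
    obtain ⟨δ, hδ0, hδε⟩ := Metric.continuous_iff.1 (continuous_planeWave_left x) ω (ε / 2)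
      (by positivity)
    obtain ⟨N, hN⟩ := exists_nat_one_div_lt hδ0
    refine ⟨N, fun n hn => ?_⟩
    have hp : Integrable fun ξ => planeWave ξ x * (h n ξ : ℂ) :=
      (hint' n).bdd_mul (c := 1) (continuous_planeWave_left x).aestronglyMeasurable
        (Eventually.of_forall fun ξ => (norm_planeWave ξ x).le)
    have e1 : ∫ ξ, planeWave ω x * (h n ξ : ℂ) = planeWave ω x := by
      rw [integral_const_mul, integral_complex_ofReal, h1 n]; simp
    rw [dist_eq_norm]
    rw [← e1]
    rw [← integral_sub hp ((hint' n).const_mul _)]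
    have hb : ‖∫ ξ, (planeWave ξ x * (h n ξ : ℂ) - planeWave ω x * (h n ξ : ℂ))‖
        ≤ ∫ ξ, ε / 2 * h n ξ := by
      refine norm_integral_le_of_norm_le ((hint n).const_mul _) (Eventually.of_forall fun ξ => ?_)
      rw [← sub_mul, norm_mul, Complex.norm_real, Real.norm_eq_abs, abs_of_nonneg (h0 n ξ)]
      by_cases hξ : ξ ∈ Metric.ball ω (1 / ((n : ℝ) + 1))
      · refine mul_le_mul_of_nonneg_right ?_ (h0 n ξ)
        rw [← dist_eq_norm]
        refine (hδε ξ (lt_trans (Metric.mem_ball.1 hξ) (lt_of_le_of_lt ?_ hN))).le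
        have : (N : ℝ) ≤ n := by exact_mod_cast hn
        gcongr
      · rw [hsupp n ξ hξ, mul_zero, mul_zero]
    rw [integral_const_mul, h1 n] at hb
    linarith

/-- A sequence of trial states whose energies have a negative limit. -/
theorem exists_formEnergy_neg_of_tendsto {M V W : Rd d → ℝ} (hM : Measurable M)
    (hV : AEMeasurable V) (hM0 : ∀ η, 0 ≤ M η) (hc : IsRelFormCompact M V)
    (hW : Integrable W) (hVW : ∀ x, V x ≤ W x) {χ : ℕ → L2Rd d} {f : Rd d → ℂ} {b : Rd d → ℝ}
    {k : ℕ → ℝ} {K : ℝ}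
    (hfin : ∀ n, FiniteForm (symbolFourier M) (𝓕 (χ n) : L2Rd d))
    (hk : ∀ n, ∫ ξ, symbolFourier M ξ * ‖(𝓕 (χ n) : L2Rd d) ξ‖ ^ 2 ≤ k n)
    (hkK : Tendsto k atTop (𝓝 K)) (hb : Integrable b)
    (hWb : ∀ n, ∀ᵐ x, |W x| * ‖χ n x‖ ^ 2 ≤ b x)
    (hlim : ∀ᵐ x, Tendsto (fun n => χ n x) atTop (𝓝 (f x)))
    (hneg : K + ∫ x, W x * ‖f x‖ ^ 2 < 0) :
    ∃ n, χ n ∈ formDomain M V hM hV ∧ formEnergy M V (χ n) < 0 := by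
  have hmeas : ∀ n, AEStronglyMeasurable (fun x => W x * ‖χ n x‖ ^ 2) := fun n =>
    hW.aestronglyMeasurable.mul ((Lp.aestronglyMeasurable (χ n)).norm.pow 2)
  have hWb' : ∀ n, ∀ᵐ x, ‖W x * ‖χ n x‖ ^ 2‖ ≤ b x := fun n => by
    filter_upwards [hWb n] with x hx
    rwa [norm_mul, Real.norm_eq_abs, Real.norm_of_nonneg (sq_nonneg ‖χ n x‖)]
  have hdct : Tendsto (fun n => ∫ x, W x * ‖χ n x‖ ^ 2) atTop (𝓝 (∫ x, W x * ‖f x‖ ^ 2)) := by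
    refine tendsto_integral_of_dominated_convergence b hmeas hb hWb' ?_
    filter_upwards [hlim] with x hx
    exact (hx.norm.pow 2).const_mul _
  obtain ⟨n, hn⟩ := ((hkK.add hdct).eventually_lt_const hneg).exists
  have hdom := hc.mem_formDomain hM hV hM0 (hfin n)
  refine ⟨n, hdom, lt_of_le_of_lt (add_le_add (hk n) ?_) hn⟩
  refine integral_mono hdom.2 (hb.mono' (hmeas n) (hWb' n)) fun x => ?_
  exact mul_le_mul_of_nonneg_right (hVW x) (sq_nonneg _)

/-- Schwartz functions belong to the form domain of `|p² - μ|`. -/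
theorem finiteForm_fourier_schwartz (μ : ℝ) (g : SchwartzMap (Rd d) ℂ) :
    FiniteForm (symbolFourier (bcsSymbolInfty d μ)) (𝓕 (g.toLp 2 : L2Rd d) : L2Rd d) := by
  rw [SchwartzMap.toLp_fourier_eq]
  set G : SchwartzMap (Rd d) ℂ := 𝓕 g with hG
  obtain ⟨C, hC⟩ : ∃ C, ∀ ξ, ‖G ξ‖ ≤ C := by
    obtain ⟨C, hC⟩ := G.decay 0 0
    exact ⟨C, fun ξ => by simpa using hC.2 ξ⟩
  have hC0 : 0 ≤ C := (norm_nonneg _).trans (hC 0)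
  have h1 : Integrable fun ξ : Rd d => (4 * Real.pi ^ 2 * (‖ξ‖ ^ 2 * ‖G ξ‖)
      + |μ| * (‖ξ‖ ^ 0 * ‖G ξ‖)) * C :=
    (((G.integrable_pow_mul volume 2).const_mul _).add
      ((G.integrable_pow_mul volume 0).const_mul _)).mul_const _
  refine h1.mono' ((measurable_symbolFourier (measurable_bcsSymbolInfty d μ)).aestronglyMeasurable
    |>.mul ((Lp.aestronglyMeasurable _).norm.pow 2)) ?_
  filter_upwards [G.coeFn_toLp 2 volume] with ξ hξ
  rw [hξ, norm_mul, Real.norm_of_nonneg (sq_nonneg ‖G ξ‖), Real.norm_eq_abs,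
    symbolFourier_bcsSymbolInfty, abs_abs, pow_zero, one_mul, sq ‖G ξ‖, ← mul_assoc]
  have h2 : |4 * Real.pi ^ 2 * ‖ξ‖ ^ 2 - μ| ≤ 4 * Real.pi ^ 2 * ‖ξ‖ ^ 2 + |μ| := by
    refine (abs_sub _ _).trans (le_of_eq ?_)
    rw [abs_of_nonneg (by positivity)]
  refine mul_le_mul ?_ (hC ξ) (norm_nonneg _) (by positivity)
  calc _ ≤ (4 * Real.pi ^ 2 * ‖ξ‖ ^ 2 + |μ|) * ‖G ξ‖ :=
        mul_le_mul_of_nonneg_right h2 (norm_nonneg _)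
    _ = _ := by ring

/-- A positive integrable weight on `ℝᵈ`. -/
theorem exists_pos_integrable (d : ℕ) :
    ∃ w : Rd d → ℝ, Measurable w ∧ (∀ x, 0 < w x) ∧ Integrable w := by
  refine ⟨fun x => (1 + ‖x‖) ^ (-((d : ℝ) + 1)), by fun_prop, fun x => by positivity,
    integrable_one_add_norm ?_⟩
  simp

/-- A potential with `∫ V ≤ 0` has an integrable majorant with the same property. -/
theorem exists_integrable_majorant {V : Rd d → ℝ} (hV : AEMeasurable V)
    (hV_ne : ¬ ∀ᵐ x : Rd d, V x = 0)
    (hV_pos : ∫⁻ x : Rd d, ENNReal.ofReal (V x) ≠ ∞)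
    (hV_int : ∫⁻ x : Rd d, ENNReal.ofReal (V x) ≤ ∫⁻ x : Rd d, ENNReal.ofReal (-V x)) :
    ∃ W : Rd d → ℝ, Integrable W ∧ (∀ x, V x ≤ W x) ∧ (∀ x, |W x| ≤ |V x|) ∧
      ∫ x, W x ≤ 0 ∧ ¬ ∀ᵐ x : Rd d, W x = 0 := by
  have hintegrable : ∀ W : Rd d → ℝ, AEMeasurable W → ∫⁻ x, ENNReal.ofReal (W x) ≠ ∞ →
      ∫⁻ x, ENNReal.ofReal (-W x) ≠ ∞ → Integrable W := by
    intro W hW h1 h2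
    refine ⟨hW.aestronglyMeasurable, ?_⟩
    rw [HasFiniteIntegral]
    have : ∀ x, ‖W x‖ₑ = ENNReal.ofReal (W x) + ENNReal.ofReal (-W x) := by
      intro x
      rw [Real.enorm_eq_ofReal_abs]
      rcases le_total 0 (W x) with h | h
      · rw [abs_of_nonneg h, ENNReal.ofReal_of_nonpos (neg_nonpos.2 h), add_zero]
      · rw [abs_of_nonpos h, ENNReal.ofReal_of_nonpos h, zero_add]
    simp only [this]
    rw [lintegral_add_left' hW.ennreal_ofReal]
    exact ENNReal.add_lt_top.2 ⟨h1.lt_top, h2.lt_top⟩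
  by_cases hneg : ∫⁻ x, ENNReal.ofReal (-V x) = ∞
  · obtain ⟨w, hwm, hw0, hwi⟩ := exists_pos_integrable d
    -- If the negative part has infinite integral, truncate it at `n * w`. The positive part is
    -- unchanged, and by monotone convergence the truncated negative part eventually outweighs it.
    set W : ℕ → Rd d → ℝ := fun n x => max (V x) (-(n * w x)) with hWdef
    have hWm : ∀ n, AEMeasurable (W n) := fun n =>
      hV.max ((hwm.const_mul _).neg.aemeasurable)
    have hlim : Tendsto (fun n => ∫⁻ x, ENNReal.ofReal (-W n x)) atTop (𝓝 ∞) := by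
      rw [← hneg]
      refine lintegral_tendsto_of_tendsto_of_monotone (fun n => (hWm n).neg.ennreal_ofReal)
        (Eventually.of_forall fun x i j hij => ENNReal.ofReal_le_ofReal (neg_le_neg ?_))
        (Eventually.of_forall fun x => ?_)
      · refine max_le_max le_rfl (neg_le_neg ?_)
        have : (i : ℝ) ≤ j := by exact_mod_cast hij
        exact mul_le_mul_of_nonneg_right this (hw0 x).le
      · refine tendsto_const_nhds.congr' ?_
        obtain ⟨N, hN⟩ := exists_nat_ge (-V x / w x)
        filter_upwards [eventually_ge_atTop N] with n hn
        have h1 : -V x / w x ≤ n := hN.trans (by exact_mod_cast hn)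
        rw [div_le_iff₀ (hw0 x)] at h1
        rw [hWdef]
        simp only
        rw [max_eq_left (by linarith)]
    have hpos : ∀ n x, ENNReal.ofReal (W n x) = ENNReal.ofReal (V x) := by
      intro n x
      have h1 : -(n * w x) ≤ 0 := neg_nonpos.2 (mul_nonneg (Nat.cast_nonneg n) (hw0 x).le)
      rcases le_total 0 (V x) with h | h
      · simp only [hWdef]; rw [max_eq_left (h1.trans h)]
      · rw [ENNReal.ofReal_of_nonpos h, ENNReal.ofReal_of_nonpos (max_le h h1)]
    obtain ⟨n, hn⟩ := (hlim.eventually_const_lt hV_pos.lt_top).exists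
    have hnegfin : ∫⁻ x, ENNReal.ofReal (-W n x) ≠ ∞ := by
      refine ((lintegral_mono fun x => ENNReal.ofReal_le_ofReal ?_).trans_lt
        (hwi.const_mul (n : ℝ)).lintegral_lt_top).ne
      have := le_max_right (V x) (-(n * w x))
      simp only [hWdef]
      linarith
    have hWi : Integrable (W n) := hintegrable _ (hWm n) (by simpa only [hpos] using hV_pos) hnegfin
    have hlt : ∫ x, W n x < 0 := by
      rw [integral_eq_lintegral_pos_part_sub_lintegral_neg_part hWi, sub_neg]
      simp only [hpos]
      exact (ENNReal.toReal_lt_toReal hV_pos hnegfin).2 hn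
    refine ⟨W n, hWi, fun x => le_max_left _ _, fun x => ?_, hlt.le, fun h0 => ?_⟩
    · have h1 : -(n * w x) ≤ 0 := neg_nonpos.2 (mul_nonneg (Nat.cast_nonneg n) (hw0 x).le)
      simp only [hWdef]
      rcases le_total 0 (V x) with h | h
      · rw [max_eq_left (h1.trans h)]
      · rw [abs_of_nonpos (max_le h h1), abs_of_nonpos h]
        exact neg_le_neg (le_max_left _ _)
    · rw [integral_congr_ae h0, integral_zero] at hlt
      exact lt_irrefl _ hlt
  · have hVi := hintegrable V hV hV_pos hneg
    refine ⟨V, hVi, fun x => le_rfl, fun x => le_rfl, ?_, hV_ne⟩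
    rw [integral_eq_lintegral_pos_part_sub_lintegral_neg_part hVi, sub_nonpos]
    exact (ENNReal.toReal_le_toReal hV_pos hneg).2 hV_int

theorem norm_add_sq_le_two_mul (a b : ℂ) : ‖a + b‖ ^ 2 ≤ 2 * ‖a‖ ^ 2 + 2 * ‖b‖ ^ 2 := by
  have := norm_add_le a b
  nlinarith [norm_nonneg (a + b), sq_nonneg (‖a‖ - ‖b‖), norm_nonneg a, norm_nonneg b]

end TrialStates

/-! ### Trial states of negative energy for `|p² - μ| + V`. -/

section TrialEnergies

open Filter Topology

variable {d : ℕ}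

/-- There are arbitrarily many points on the Fermi sphere with distinct first coordinates. -/
theorem exists_fermi_points (hd : 2 ≤ d) {μ : ℝ} (hμ : 0 < μ) (N : ℕ) :
    ∃ (ω : Fin N → Rd d) (v : Rd d), (∀ j, 4 * Real.pi ^ 2 * ‖ω j‖ ^ 2 = μ) ∧
      Function.Injective fun j => inner ℝ (ω j) v := by
  set i₀ : Fin d := ⟨0, by omega⟩ with hi₀
  set i₁ : Fin d := ⟨1, by omega⟩ with hi₁
  have hne : i₀ ≠ i₁ := by simp [hi₀, hi₁]
  set ρ : ℝ := Real.sqrt μ / (2 * Real.pi) with hρ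
  have hρ0 : 0 < ρ := by positivity
  -- The first coordinate is prescribed as `ρ j / N` and the second one completes the point to the
  -- sphere, which requires two dimensions.
  set a : Fin N → ℝ := fun j => (j : ℝ) / N with ha
  have ha1 : ∀ j, a j ^ 2 ≤ 1 := fun j => by
    have h1 : (j : ℝ) < N := by exact_mod_cast j.2
    have h2 : a j ≤ 1 := div_le_one_of_le₀ h1.le (by positivity)
    have h3 : 0 ≤ a j := by positivity
    nlinarith
  refine ⟨fun j => EuclideanSpace.single i₀ (ρ * a j)
    + EuclideanSpace.single i₁ (ρ * Real.sqrt (1 - a j ^ 2)), EuclideanSpace.single i₀ 1,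
    fun j => ?_, fun j k hjk => ?_⟩
  · have horth : inner ℝ (EuclideanSpace.single i₀ (ρ * a j) : Rd d)
        (EuclideanSpace.single i₁ (ρ * Real.sqrt (1 - a j ^ 2))) = 0 := by
      simp [EuclideanSpace.inner_single_left, hne]
    have h1 := norm_add_sq_real (EuclideanSpace.single i₀ (ρ * a j) : Rd d)
      (EuclideanSpace.single i₁ (ρ * Real.sqrt (1 - a j ^ 2)))
    rw [horth, PiLp.norm_single, PiLp.norm_single, Real.norm_eq_abs,
      Real.norm_eq_abs, sq_abs, sq_abs, mul_pow, mul_pow,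
      Real.sq_sqrt (sub_nonneg.2 (ha1 j))] at h1
    rw [h1, hρ, div_pow, Real.sq_sqrt hμ.le]
    field_simp
    ring
  · have h1 : ρ * a j = ρ * a k := by
      simpa [inner_add_left, EuclideanSpace.inner_single_left, hne, hne.symm] using hjk
    have h2 := mul_left_cancel₀ hρ0.ne' h1
    have hN : (N : ℝ) ≠ 0 := by
      have := j.2
      exact_mod_cast (by omega : N ≠ 0)
    simp only [ha] at h2
    have h3 : (j : ℝ) = k := by field_simp at h2; exact h2
    exact Fin.ext (by exact_mod_cast h3)

/-- Distinct one dimensional exponentials are linearly independent almost everywhere. -/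
theorem ae_sum_exp_ne_zero {N : ℕ} {a : Fin N → ℝ} (ha : Function.Injective a) {c : Fin N → ℂ}
    (hc : c ≠ 0) :
    ∀ᵐ t : ℝ, ∑ j, c j * (Real.fourierChar (t * a j) : ℂ) ≠ 0 := by
  have hne : ∃ t : ℝ, ∑ j, c j * (Real.fourierChar (t * a j) : ℂ) ≠ 0 := by
    by_contra! hcon
    -- Each exponential is a character of `ℝ`, and distinct characters are linearly independent.
    let χ : Fin N → (Multiplicative ℝ →* ℂ) := fun j =>
      { toFun := fun t => (Real.fourierChar (t.toAdd * a j) : ℂ)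
        map_one' := by simp
        map_mul' := fun s t => by
          rw [toAdd_mul, add_mul, AddChar.map_add_eq_mul, Circle.coe_mul] }
    have hχ : Function.Injective χ := by
      intro j k hjk
      by_contra hne
      have hak : a j - a k ≠ 0 := sub_ne_zero.2 fun h => hne (ha h)
      -- At this `t` the two phases differ by half a turn, a factor `-1`.
      set t : ℝ := 1 / (2 * (a j - a k)) with ht
      have h1 : (Real.fourierChar (t * a j) : ℂ) = (Real.fourierChar (t * a k) : ℂ) :=
        DFunLike.congr_fun hjk (Multiplicative.ofAdd t)
      have h2 : t * a j = t * a k + 1 / 2 := by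
        rw [ht]; field_simp; ring
      rw [h2, AddChar.map_add_eq_mul, Circle.coe_mul] at h1
      have h3 : (Real.fourierChar (1 / 2 : ℝ) : ℂ) = -1 := by
        rw [Real.fourierChar_apply]
        have : ((2 * Real.pi * (1 / 2) : ℝ) : ℂ) = (Real.pi : ℂ) := by push_cast; ring
        rw [this, Complex.exp_pi_mul_I]
      have h4 := Circle.coe_ne_zero (Real.fourierChar (t * a k))
      rw [h3, mul_neg, mul_one] at h1
      exact h4 (by linear_combination (-1 / 2 : ℂ) * h1)
    have hli := (linearIndependent_monoidHom (Multiplicative ℝ) ℂ).comp χ hχ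
    refine hc (funext fun j => Fintype.linearIndependent_iff.1 hli c ?_ j)
    funext t
    simpa [χ, Finset.sum_apply] using hcon t.toAdd
  obtain ⟨t₀, ht₀⟩ := hne
  -- A real analytic function on the line that is not identically zero has a discrete, hence null,
  -- zero set.
  have han : AnalyticOnNhd ℝ (fun t : ℝ => ∑ j, c j * (Real.fourierChar (t * a j) : ℂ))
      Set.univ := by
    have : (fun t : ℝ => ∑ j, c j * (Real.fourierChar (t * a j) : ℂ))
        = fun t : ℝ => ∑ j, c j
          * Complex.exp (Complex.ofRealCLM t * (2 * Real.pi * a j * Complex.I)) := by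
      funext t
      refine Finset.sum_congr rfl fun j _ => ?_
      rw [Real.fourierChar_apply, Complex.ofRealCLM_apply]
      push_cast
      ring_nf
    rw [this]
    intro t _
    refine Finset.analyticAt_fun_sum _ fun j _ => analyticAt_const.mul ?_
    exact (analyticAt_cexp.restrictScalars (𝕜 := ℝ)).comp
      ((Complex.ofRealCLM.analyticAt t).mul analyticAt_const)
  have h1 := han.preimage_zero_mem_codiscrete ht₀
  have h2 := ae_restrict_le_codiscreteWithin (μ := (volume : Measure ℝ)) MeasurableSet.univ h1
  rw [Measure.restrict_univ] at h2
  filter_upwards [h2] with t ht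
  exact ht

/-- By Fubini it suffices to look at lines in the direction `v`. On each of them the sum is a one
dimensional exponential sum with distinct frequencies, whose coefficients only acquire phases. -/
theorem ae_sum_planeWave_ne_zero {N : ℕ} {ω : Fin N → Rd d} {v : Rd d}
    (hinj : Function.Injective fun j => inner ℝ (ω j) v) {c : Fin N → ℂ} (hc : c ≠ 0) :
    ∀ᵐ x, ∑ j, c j * planeWave (ω j) x ≠ 0 := by
  have hcont : Continuous fun x => ∑ j, c j * planeWave (ω j) x :=
    continuous_finsetSum _ fun j _ => continuous_const.mul (continuous_planeWave _)
  have hms : MeasurableSet {x | ∑ j, c j * planeWave (ω j) x ≠ 0} :=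
    (hcont.measurable (measurableSet_singleton 0)).compl
  refine ae_mem_of_ae_add_linearMap_mem (LinearMap.toSpanSingleton ℝ (Rd d) v) volume volume hms
    fun y => ?_
  have hc' : (fun j => c j * planeWave (ω j) y) ≠ 0 := by
    intro h0
    refine hc (funext fun j => ?_)
    have hy : planeWave (ω j) y ≠ 0 := fun h => by
      have := norm_planeWave (ω j) y
      rw [h, norm_zero] at this
      exact zero_ne_one this
    exact (mul_eq_zero.1 (congrFun h0 j)).resolve_right hy
  filter_upwards [ae_sum_exp_ne_zero hinj hc'] with t ht
  show ∑ j, c j * planeWave (ω j) (y + t • v) ≠ 0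
  rw [Finset.sum_congr rfl fun j _ => ?_]
  · exact ht
  · unfold planeWave
    rw [inner_add_right, inner_smul_right, AddChar.map_add_eq_mul, Circle.coe_mul, mul_assoc]

/-- If `∫ V ≤ 0` and `V ≠ 0`, the energy of `|p² - μ| + V` is negative for some trial state. -/
theorem exists_formEnergy_neg (hd : 2 ≤ d) {μ : ℝ} (hμ : 0 < μ) {V : Rd d → ℝ}
    (hV : AEMeasurable V) (hc : IsRelFormCompact (bcsSymbolInfty d μ) V)
    (hV_ne : ¬ ∀ᵐ x : Rd d, V x = 0)
    (hV_pos : ∫⁻ x : Rd d, ENNReal.ofReal (V x) ≠ ∞)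
    (hV_int : ∫⁻ x : Rd d, ENNReal.ofReal (V x) ≤ ∫⁻ x : Rd d, ENNReal.ofReal (-V x)) :
    ∃ ψ ∈ formDomain (bcsSymbolInfty d μ) V (measurable_bcsSymbolInfty d μ) hV,
      formEnergy (bcsSymbolInfty d μ) V ψ < 0 := by
  set T := symbolFourier (bcsSymbolInfty d μ) with hT
  have hTm : Measurable T := measurable_symbolFourier (measurable_bcsSymbolInfty d μ)
  have hT0 : ∀ ξ, 0 ≤ T ξ := fun ξ => bcsSymbolInfty_nonneg μ _
  obtain ⟨W, hWi, hVW, hWV, hW0, hWne⟩ := exists_integrable_majorant hV hV_ne hV_pos hV_int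
  obtain ⟨ω, v, hω, -⟩ := exists_fermi_points hd hμ 1
  set e := planeWave (ω 0) with he
  have hen : ∀ x, ‖e x‖ = 1 := norm_planeWave (ω 0)
  have hec : Continuous e := continuous_planeWave (ω 0)
  obtain ⟨ψ, hψT, hψ0, hψ1, hψe⟩ := exists_wavePackets (by omega) hμ (hω 0)
  have hWe : Integrable fun x => (W x : ℂ) * conj (e x) :=
    hWi.ofReal.mul_bdd (c := 1) (Complex.continuous_conj.comp hec).aestronglyMeasurable
      (Eventually.of_forall fun x => by rw [RCLike.norm_conj, hen])
  -- a perturbation which detects the potential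
  obtain ⟨φ, hφT, hφV, hφne⟩ : ∃ φ : L2Rd d, FiniteForm T (𝓕 φ : L2Rd d) ∧ FiniteForm V φ ∧
      ∫ x, (W x : ℂ) * conj (e x) * φ x ≠ 0 := by
    -- If the pairing vanished for all test functions, `W` times a unimodular function, hence `W`
    -- itself, would vanish almost everywhere.
    by_contra! hcon
    have hz := ae_eq_zero_of_integral_contDiff_smul_eq_zero hWe.locallyIntegrable
      fun g g_smooth g_cpt => by
        have hg₁ : HasCompactSupport (Complex.ofRealCLM ∘ g) := g_cpt.comp_left rfl
        have hg₂ : ContDiff ℝ (⊤ : ℕ∞) (Complex.ofRealCLM ∘ g) := by fun_prop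
        set G : SchwartzMap (Rd d) ℂ := hg₁.toSchwartzMap hg₂ with hG
        have hGT := finiteForm_fourier_schwartz μ G
        have hGV := (hc.mem_formDomain (measurable_bcsSymbolInfty d μ) hV
          (bcsSymbolInfty_nonneg μ) hGT).2
        rw [← hcon _ hGT hGV]
        refine integral_congr_ae ?_
        filter_upwards [G.coeFn_toLp 2 volume] with x hx
        rw [hx]
        show g x • ((W x : ℂ) * conj (e x)) = (W x : ℂ) * conj (e x) * (g x : ℂ)
        rw [Complex.real_smul]
        ring
    refine hWne (hz.mono fun x hx => ?_)
    rcases mul_eq_zero.1 hx with h | h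
    · exact_mod_cast h
    · have h1 := hen x
      rw [← RCLike.norm_conj, h, norm_zero] at h1
      exact absurd h1 zero_ne_one
  have hWφ : Integrable fun x => |W x| * ‖φ x‖ ^ 2 := by
    have h1 : Integrable fun x => V x * ‖φ x‖ ^ 2 := hφV
    refine h1.norm.mono' (hWi.aestronglyMeasurable.norm.mul
      ((Lp.aestronglyMeasurable φ).norm.pow 2)) (Eventually.of_forall fun x => ?_)
    rw [norm_mul, norm_mul, Real.norm_eq_abs, abs_abs, Real.norm_eq_abs (V x)]
    exact mul_le_mul_of_nonneg_right (hWV x) (norm_nonneg _)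
  have hWφ' : Integrable fun x => W x * ‖φ x‖ ^ 2 := by
    refine hWφ.mono' (hWi.aestronglyMeasurable.mul
      ((Lp.aestronglyMeasurable φ).norm.pow 2)) (Eventually.of_forall fun x => ?_)
    rw [norm_mul, Real.norm_eq_abs, Real.norm_of_nonneg (sq_nonneg ‖φ x‖)]
  have hcross : Integrable fun x => (W x : ℂ) * conj (e x) * φ x := by
    refine (hWi.norm.add hWφ).mono' (hWe.aestronglyMeasurable.mul (Lp.aestronglyMeasurable φ))
      (Eventually.of_forall fun x => ?_)
    rw [norm_mul, norm_mul, RCLike.norm_conj, hen, mul_one, Complex.norm_real, Pi.add_apply,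
      Real.norm_eq_abs]
    nlinarith [abs_nonneg (W x), mul_nonneg (abs_nonneg (W x)) (sq_nonneg (‖φ x‖ - 1)),
      mul_nonneg (abs_nonneg (W x)) (sq_nonneg (‖φ x‖))]
  set z := ∫ x, (W x : ℂ) * conj (e x) * φ x with hz
  set P := ∫ x, W x * ‖φ x‖ ^ 2 with hP
  set Q := ∫ ξ, T ξ * ‖(𝓕 φ : L2Rd d) ξ‖ ^ 2 with hQ
  -- For `e + c φ` the limiting energy is at most `∫ W + 2 Re(c z) + ‖c‖² (2Q + P)`; the `2Q` comes
  -- from `‖a + b‖² ≤ 2‖a‖² + 2‖b‖²` in the kinetic term. As `2Q + P ≤ R`, the choice `c = -conj z /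
  -- R` makes the last two terms at most `-‖z‖² / R`.
  set R : ℝ := 2 * Q + |P| + 1 with hR
  have hQ0 : 0 ≤ Q := integral_nonneg fun ξ => mul_nonneg (hT0 ξ) (sq_nonneg _)
  have hR0 : 0 < R := by positivity
  have hz0 : 0 < ‖z‖ ^ 2 := by positivity
  set c : ℂ := -((R⁻¹ : ℝ) : ℂ) * conj z with hcdef
  have hcn : ‖c‖ ^ 2 = R⁻¹ ^ 2 * ‖z‖ ^ 2 := by
    rw [hcdef, norm_mul, norm_neg, Complex.norm_real, RCLike.norm_conj, mul_pow,
      Real.norm_eq_abs, sq_abs]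
  have hcz : (c * z).re = -R⁻¹ * ‖z‖ ^ 2 := by
    rw [hcdef, mul_assoc, Complex.conj_mul', ← Complex.ofReal_pow, ← Complex.ofReal_neg,
      ← Complex.ofReal_mul, Complex.ofReal_re]
  have hpot : ∫ x, W x * ‖e x + c * φ x‖ ^ 2 = (∫ x, W x) + 2 * (c * z).re + ‖c‖ ^ 2 * P := by
    have h1 : ∀ x, W x * ‖e x + c * φ x‖ ^ 2
        = W x + 2 * (c * ((W x : ℂ) * conj (e x) * φ x)).re + ‖c‖ ^ 2 * (W x * ‖φ x‖ ^ 2) := by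
      intro x
      have h2 : ‖e x + c * φ x‖ ^ 2
          = ‖e x‖ ^ 2 + 2 * (conj (e x) * (c * φ x)).re + ‖c * φ x‖ ^ 2 := by
        have := norm_add_sq (𝕜 := ℂ) (e x) (c * φ x)
        simp only [RCLike.inner_apply, RCLike.re_to_complex] at this
        rw [this, mul_comm (conj (e x))]
      have h3 : c * ((W x : ℂ) * conj (e x) * φ x) = (W x : ℂ) * (conj (e x) * (c * φ x)) := by
        ring
      rw [h2, h3, Complex.re_ofReal_mul, hen, norm_mul]
      ring
    simp only [h1]
    have hi1 : Integrable fun x => 2 * (c * ((W x : ℂ) * conj (e x) * φ x)).re :=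
      (hcross.const_mul c).re.const_mul 2
    have hi2 : Integrable fun x => W x + 2 * (c * ((W x : ℂ) * conj (e x) * φ x)).re :=
      hWi.add hi1
    rw [integral_add hi2 (hWφ'.const_mul _), integral_add hWi hi1, integral_const_mul,
      integral_const_mul]
    congr 2
    congr 1
    have := integral_re (hcross.const_mul c)
    simp only [RCLike.re_to_complex] at this
    rw [this, integral_const_mul]
  have hadd : ∀ n, ∀ᵐ x, (ψ n + c • φ : L2Rd d) x = ψ n x + c * φ x := fun n => by
    filter_upwards [Lp.coeFn_add (ψ n) (c • φ), Lp.coeFn_smul c φ] with x h1 h2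
    rw [h1, Pi.add_apply, h2, Pi.smul_apply, smul_eq_mul]
  have hFadd : ∀ n, (𝓕 (ψ n + c • φ) : L2Rd d) = 𝓕 (ψ n) + c • 𝓕 φ := fun n => by
    rw [show (𝓕 (ψ n + c • φ) : L2Rd d) = 𝓕 (ψ n) + 𝓕 (c • φ) from
      map_add (Lp.fourierTransformₗᵢ (Rd d) ℂ) _ _, show (𝓕 (c • φ) : L2Rd d) = c • 𝓕 φ from
      map_smul (Lp.fourierTransformₗᵢ (Rd d) ℂ) c φ]
  obtain ⟨n, h1, h2⟩ := exists_formEnergy_neg_of_tendsto (measurable_bcsSymbolInfty d μ) hV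
    (bcsSymbolInfty_nonneg μ) hc hWi hVW (χ := fun n => ψ n + c • φ)
    (f := fun x => e x + c * φ x) (b := fun x => 2 * |W x| + 2 * ‖c‖ ^ 2 * (|W x| * ‖φ x‖ ^ 2))
    (k := fun n => 2 * (∫ ξ, T ξ * ‖(𝓕 (ψ n) : L2Rd d) ξ‖ ^ 2) + 2 * ‖c‖ ^ 2 * Q)
    (K := 2 * 0 + 2 * ‖c‖ ^ 2 * Q)
    (fun n => by
      rw [hFadd]
      exact (hψT n).add hTm.aemeasurable (hφT.smul c))
    (fun n => by
      have hi1 : Integrable fun ξ => T ξ * ‖(𝓕 (ψ n) : L2Rd d) ξ‖ ^ 2 := hψT n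
      have hi2 : Integrable fun ξ => T ξ * ‖(𝓕 φ : L2Rd d) ξ‖ ^ 2 := hφT
      have hi3 : Integrable fun ξ => T ξ * ‖(𝓕 (ψ n) + c • 𝓕 φ : L2Rd d) ξ‖ ^ 2 :=
        (hψT n).add hTm.aemeasurable (hφT.smul c)
      rw [hFadd, ← integral_const_mul, ← integral_const_mul,
        ← integral_add (hi1.const_mul _) (hi2.const_mul _)]
      refine integral_mono_ae hi3 ((hi1.const_mul _).add (hi2.const_mul _)) ?_
      filter_upwards [Lp.coeFn_add (𝓕 (ψ n) : L2Rd d) (c • 𝓕 φ),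
        Lp.coeFn_smul c (𝓕 φ : L2Rd d)] with ξ h1 h2
      rw [h1, Pi.add_apply, h2, Pi.smul_apply, smul_eq_mul]
      have := norm_add_sq_le_two_mul ((𝓕 (ψ n) : L2Rd d) ξ) (c * (𝓕 φ : L2Rd d) ξ)
      rw [norm_mul, mul_pow] at this
      have h3 := mul_le_mul_of_nonneg_left this (hT0 ξ)
      refine h3.trans (le_of_eq ?_)
      ring)
    ((hψ0.const_mul 2).add_const _)
    ((hWi.abs.const_mul 2).add (hWφ.const_mul _))
    (fun n => by
      filter_upwards [hadd n, hψ1 n] with x h1 h2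
      rw [h1]
      have h3 := norm_add_sq_le_two_mul (ψ n x) (c * φ x)
      rw [norm_mul, mul_pow] at h3
      have h4 : ‖ψ n x‖ ^ 2 ≤ 1 := pow_le_one₀ (norm_nonneg _) h2
      have h5 : ‖ψ n x + c * φ x‖ ^ 2 ≤ 2 + 2 * (‖c‖ ^ 2 * ‖φ x‖ ^ 2) := by linarith
      refine (mul_le_mul_of_nonneg_left h5 (abs_nonneg (W x))).trans (le_of_eq ?_)
      ring)
    (by
      filter_upwards [ae_all_iff.2 hadd, hψe] with x h1 h2
      simp only [h1]
      exact h2.add_const _)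
    (by
      rw [hpot, hcn, hcz]
      have h1 := le_abs_self P
      have h2 : R⁻¹ ^ 2 * ‖z‖ ^ 2 * (2 * Q + P) ≤ R⁻¹ ^ 2 * ‖z‖ ^ 2 * R :=
        mul_le_mul_of_nonneg_left (by rw [hR]; linarith) (by positivity)
      have h3 : R⁻¹ ^ 2 * ‖z‖ ^ 2 * R = R⁻¹ * ‖z‖ ^ 2 := by field_simp
      have h4 : 0 < R⁻¹ * ‖z‖ ^ 2 := by positivity
      nlinarith)
  exact ⟨_, h1, h2⟩

theorem coeFn_sum_smul_L2Rd {ι : Type*} (s : Finset ι) (c : ι → ℂ) (ψ : ι → L2Rd d) :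
    ∀ᵐ x, (∑ j ∈ s, c j • ψ j : L2Rd d) x = ∑ j ∈ s, c j * ψ j x := by
  classical
  induction s using Finset.induction_on with
  | empty =>
    filter_upwards [Lp.coeFn_zero ℂ 2 (volume : Measure (Rd d))] with x hx
    simp
  | insert i s hi ih =>
    rw [Finset.sum_insert hi]
    filter_upwards [ih, Lp.coeFn_add (c i • ψ i) (∑ j ∈ s, c j • ψ j), Lp.coeFn_smul (c i) (ψ i)]
      with x h1 h2 h3
    rw [h2, Pi.add_apply, h3, h1, Finset.sum_insert hi, Pi.smul_apply, smul_eq_mul]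

theorem norm_sum_mul_sq_le {N : ℕ} {c : Fin N → ℂ} (hc : ∀ j, ‖c j‖ ≤ 1) (a : Fin N → ℂ) :
    ‖∑ j, c j * a j‖ ^ 2 ≤ N * ∑ j, ‖a j‖ ^ 2 := by
  have h1 : ‖∑ j, c j * a j‖ ≤ ∑ j, ‖a j‖ := by
    refine (norm_sum_le _ _).trans (Finset.sum_le_sum fun j _ => ?_)
    rw [norm_mul]
    exact mul_le_of_le_one_left (norm_nonneg _) (hc j)
  have h2 := sq_sum_le_card_mul_sum_sq (s := Finset.univ) (f := fun j => ‖a j‖)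
  rw [Finset.card_univ, Fintype.card_fin] at h2
  exact (pow_le_pow_left₀ (norm_nonneg _) h1 2).trans h2

/-- A nonpositive potential which is not zero has an integrable majorant of the same kind. -/
theorem exists_integrable_nonpos_majorant {V : Rd d → ℝ} (hV : AEMeasurable V)
    (hV_ne : ¬ ∀ᵐ x : Rd d, V x = 0) (hVneg : ∀ᵐ x : Rd d, V x ≤ 0) :
    ∃ W : Rd d → ℝ, Integrable W ∧ (∀ x, V x ≤ W x) ∧ (∀ᵐ x, W x ≤ 0) ∧
      ¬ ∀ᵐ x : Rd d, W x = 0 := by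
  obtain ⟨w, hwm, hw0, hwi⟩ := exists_pos_integrable d
  refine ⟨fun x => max (V x) (-w x), ?_, fun x => le_max_left _ _, ?_, fun h => hV_ne ?_⟩
  · refine hwi.mono' (hV.max hwm.neg.aemeasurable).aestronglyMeasurable ?_
    filter_upwards [hVneg] with x hx
    rw [Real.norm_eq_abs, abs_of_nonpos (max_le hx (neg_nonpos.2 (hw0 x).le))]
    linarith [le_max_right (V x) (-w x)]
  · filter_upwards [hVneg] with x hx
    exact max_le hx (neg_nonpos.2 (hw0 x).le)
  · filter_upwards [h] with x hx
    rcases max_choice (V x) (-w x) with h1 | h1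
    · rw [← h1, hx]
    · have := hw0 x
      linarith

/-- A nontrivial combination of more than `dim U` vectors is orthogonal to `U`. -/
theorem exists_sum_smul_mem_orthogonal {H : Type*} [NormedAddCommGroup H] [InnerProductSpace ℂ H]
    (U : Submodule ℂ H) [FiniteDimensional ℂ U] {N : ℕ} (hN : Module.finrank ℂ U < N)
    (ψ : Fin N → H) : ∃ c : Fin N → ℂ, ‖c‖ = 1 ∧ ∑ j, c j • ψ j ∈ Uᗮ := by
  set Φ : (Fin N → ℂ) →ₗ[ℂ] U :=
    (U.orthogonalProjectionOnto : H →ₗ[ℂ] U) ∘ₗ Fintype.linearCombination ℂ ψ with hΦ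
  have hker : LinearMap.ker Φ ≠ ⊥ := LinearMap.ker_ne_bot_of_finrank_lt (by simpa using hN)
  obtain ⟨c, hc, hc0⟩ := (Submodule.ne_bot_iff _).1 hker
  refine ⟨((‖c‖⁻¹ : ℝ) : ℂ) • c, ?_, ?_⟩
  · rw [norm_smul, Complex.norm_real, norm_inv, norm_norm,
      inv_mul_cancel₀ (norm_ne_zero_iff.2 hc0)]
  · have h1 : U.orthogonalProjectionOnto (∑ j, c j • ψ j) = 0 := hc
    have h2 : ∑ j, c j • ψ j ∈ Uᗮ := Submodule.orthogonalProjectionOnto_eq_zero_iff.1 h1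
    have h3 : ∑ j, (((‖c‖⁻¹ : ℝ) : ℂ) • c) j • ψ j
        = ((‖c‖⁻¹ : ℝ) : ℂ) • ∑ j, c j • ψ j := by
      rw [Finset.smul_sum]
      refine Finset.sum_congr rfl fun j _ => ?_
      rw [Pi.smul_apply, smul_eq_mul, mul_smul]
    rw [h3]
    exact Submodule.smul_mem _ _ h2

/-- If `V ≤ 0` and `V ≠ 0`, the energy of `|p² - μ| + V` is negative somewhere on the orthogonal
complement of any finite dimensional space. -/
theorem exists_formEnergy_neg_orthogonal (hd : 2 ≤ d) {μ : ℝ} (hμ : 0 < μ) {V : Rd d → ℝ}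
    (hV : AEMeasurable V) (hc : IsRelFormCompact (bcsSymbolInfty d μ) V)
    (hV_ne : ¬ ∀ᵐ x : Rd d, V x = 0) (hVneg : ∀ᵐ x : Rd d, V x ≤ 0)
    (U : Submodule ℂ (L2Rd d)) [FiniteDimensional ℂ U] :
    ∃ ψ ∈ formDomain (bcsSymbolInfty d μ) V (measurable_bcsSymbolInfty d μ) hV,
      ψ ∈ Uᗮ ∧ formEnergy (bcsSymbolInfty d μ) V ψ < 0 := by
  set T := symbolFourier (bcsSymbolInfty d μ) with hT
  have hTm : Measurable T := measurable_symbolFourier (measurable_bcsSymbolInfty d μ)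
  have hT0 : ∀ ξ, 0 ≤ T ξ := fun ξ => bcsSymbolInfty_nonneg μ _
  obtain ⟨W, hWi, hVW, hW0, hWne⟩ := exists_integrable_nonpos_majorant hV hV_ne hVneg
  -- One more wave packet than `dim U`, so some nontrivial combination is orthogonal to `U`.
  set N := Module.finrank ℂ U + 1 with hN
  obtain ⟨ω, v, hω, hinj⟩ := exists_fermi_points hd hμ N
  choose ψ hψT hψ0 hψ1 hψe using fun j => exists_wavePackets (by omega : d ≠ 0) hμ (hω j)
  choose c hc1 hcU using fun n =>
    exists_sum_smul_mem_orthogonal U (Nat.lt_succ_self _) fun j : Fin N => ψ j n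
  -- The coefficients depend on `n`; normalizing them gives a convergent subsequence with a limit
  -- that is again nonzero.
  obtain ⟨a, ha, σ, hσ, hlim⟩ := (isCompact_sphere (0 : Fin N → ℂ) 1).tendsto_subseq
    (fun n => mem_sphere_zero_iff_norm.2 (hc1 n))
  have ha0 : a ≠ 0 := by
    intro h
    rw [mem_sphere_zero_iff_norm, h, norm_zero] at ha
    exact zero_ne_one ha
  have hcle : ∀ n j, ‖c n j‖ ≤ 1 := fun n j => (norm_le_pi_norm (c n) j).trans (hc1 n).le
  have hale : ∀ j, ‖a j‖ ≤ 1 := fun j =>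
    (norm_le_pi_norm a j).trans (mem_sphere_zero_iff_norm.1 ha).le
  set χ : ℕ → L2Rd d := fun n => ∑ j, c (σ n) j • ψ j (σ n) with hχ
  have hχx : ∀ n, ∀ᵐ x, χ n x = ∑ j, c (σ n) j * ψ j (σ n) x := fun n =>
    coeFn_sum_smul_L2Rd Finset.univ (c (σ n)) fun j => ψ j (σ n)
  have hχF : ∀ n, (𝓕 (χ n) : L2Rd d) = ∑ j, c (σ n) j • (𝓕 (ψ j (σ n)) : L2Rd d) := fun n => by
    show Lp.fourierTransformₗᵢ (Rd d) ℂ (χ n) = _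
    rw [hχ, map_sum]
    exact Finset.sum_congr rfl fun j _ => map_smul (Lp.fourierTransformₗᵢ (Rd d) ℂ) _ _
  have hχdom : ∀ n, χ n ∈ formDomain (bcsSymbolInfty d μ) V (measurable_bcsSymbolInfty d μ) hV :=
    fun n => Submodule.sum_mem _ fun j _ => Submodule.smul_mem _ _
      (hc.mem_formDomain (measurable_bcsSymbolInfty d μ) hV (bcsSymbolInfty_nonneg μ)
        (hψT j (σ n)))
  set f : Rd d → ℂ := fun x => ∑ j, a j * planeWave (ω j) x with hf
  have hfc : Continuous f :=
    continuous_finsetSum _ fun j _ => continuous_const.mul (continuous_planeWave _)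
  have hfle : ∀ x, ‖f x‖ ^ 2 ≤ N * N := fun x => by
    refine (norm_sum_mul_sq_le hale _).trans (le_of_eq ?_)
    simp [norm_planeWave]
  have hWf : Integrable fun x => W x * ‖f x‖ ^ 2 :=
    hWi.mul_bdd (c := N * N) (hfc.norm.pow 2).aestronglyMeasurable
      (Eventually.of_forall fun x => by
        rw [Real.norm_of_nonneg (sq_nonneg ‖f x‖)]; exact hfle x)
  -- Since `W ≤ 0`, a vanishing integral would force `W = 0` wherever `f ≠ 0`, that is almost
  -- everywhere.
  have hneg : ∫ x, W x * ‖f x‖ ^ 2 < 0 := by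
    have hnn : 0 ≤ᵐ[volume] fun x => -(W x * ‖f x‖ ^ 2) := by
      filter_upwards [hW0] with x hx
      exact neg_nonneg.2 (mul_nonpos_of_nonpos_of_nonneg hx (sq_nonneg _))
    have h1 := integral_nonneg_of_ae hnn
    rw [integral_neg] at h1
    refine lt_of_le_of_ne (neg_nonneg.1 h1) fun h0 => hWne ?_
    have h2 : ∫ x, -(W x * ‖f x‖ ^ 2) = 0 := by rw [integral_neg, h0, neg_zero]
    have h3 := (integral_eq_zero_iff_of_nonneg_ae hnn hWf.neg).1 h2
    filter_upwards [h3, ae_sum_planeWave_ne_zero hinj ha0] with x hx1 hx2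
    have h4 : W x * ‖f x‖ ^ 2 = 0 := neg_eq_zero.1 hx1
    exact (mul_eq_zero.1 h4).resolve_right (pow_ne_zero 2 (norm_ne_zero_iff.2 hx2))
  obtain ⟨n, h1, h2⟩ := exists_formEnergy_neg_of_tendsto (measurable_bcsSymbolInfty d μ) hV
    (bcsSymbolInfty_nonneg μ) hc hWi hVW (χ := χ) (f := f) (b := fun x => |W x| * (N * N))
    (k := fun n => N * ∑ j, ∫ ξ, T ξ * ‖(𝓕 (ψ j (σ n)) : L2Rd d) ξ‖ ^ 2)
    (K := N * ∑ _j : Fin N, 0)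
    (fun n => (hχdom n).1)
    (fun n => by
      have hi : ∀ j, Integrable fun ξ => T ξ * ‖(𝓕 (ψ j (σ n)) : L2Rd d) ξ‖ ^ 2 :=
        fun j => hψT j (σ n)
      have hi' : Integrable fun ξ => T ξ * ‖(𝓕 (χ n) : L2Rd d) ξ‖ ^ 2 := (hχdom n).1
      rw [← integral_finsetSum _ fun j _ => hi j, ← integral_const_mul]
      refine integral_mono_ae hi' ((integrable_finsetSum _ fun j _ => hi j).const_mul _) ?_
      filter_upwards [coeFn_sum_smul_L2Rd Finset.univ (c (σ n))
        fun j => (𝓕 (ψ j (σ n)) : L2Rd d)] with ξ hξ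
      rw [hχF, hξ]
      refine (mul_le_mul_of_nonneg_left (norm_sum_mul_sq_le (hcle (σ n)) _) (hT0 ξ)).trans
        (le_of_eq ?_)
      rw [mul_left_comm, Finset.mul_sum])
    ((tendsto_finsetSum _ fun j _ => (hψ0 j).comp hσ.tendsto_atTop).const_mul _)
    (hWi.abs.mul_const _)
    (fun n => by
      filter_upwards [hχx n, ae_all_iff.2 fun j => hψ1 j (σ n)] with x h1 h2
      rw [h1]
      refine mul_le_mul_of_nonneg_left ((norm_sum_mul_sq_le (hcle (σ n)) _).trans ?_)
        (abs_nonneg _)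
      refine mul_le_mul_of_nonneg_left ?_ (Nat.cast_nonneg _)
      calc ∑ j, ‖ψ j (σ n) x‖ ^ 2 ≤ ∑ _j : Fin N, (1 : ℝ) :=
            Finset.sum_le_sum fun j _ => pow_le_one₀ (norm_nonneg _) (h2 j)
        _ = N := by simp)
    (by
      filter_upwards [ae_all_iff.2 hχx, ae_all_iff.2 hψe] with x h1 h2
      simp only [h1]
      exact tendsto_finsetSum _ fun j _ =>
        ((tendsto_pi_nhds.1 hlim) j).mul ((h2 j).comp hσ.tendsto_atTop))
    (by simpa using hneg)
  exact ⟨χ n, h1, hcU (σ n), h2⟩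

end TrialEnergies

/-! ### Comparison of form domains and energies at different temperatures. -/

section Comparison

variable {d : ℕ} {M M' V : Rd d → ℝ}

/-- As `T ≤ K_β ≤ T + 2/β`, the form domains for all `β > 0` agree with that of `T`, and one trial
state serves every temperature. -/
theorem formDomain_mono (hM : Measurable M) (hM' : Measurable M') (hV : AEMeasurable V)
    (h0 : ∀ η, 0 ≤ M' η) {c : ℝ} (hc : ∀ η, M' η ≤ M η + c) {ψ : L2Rd d}
    (hψ : ψ ∈ formDomain M V hM hV) : ψ ∈ formDomain M' V hM' hV := by
  have h1 : Integrable fun ξ => symbolFourier M ξ * ‖(𝓕 ψ : L2Rd d) ξ‖ ^ 2 := hψ.1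
  refine ⟨(h1.add ((integrable_norm_sq_L2Rd (𝓕 ψ : L2Rd d)).const_mul c)).mono'
    ((measurable_symbolFourier hM').aestronglyMeasurable.mul
      ((Lp.aestronglyMeasurable _).norm.pow 2)) (Filter.Eventually.of_forall fun ξ => ?_), hψ.2⟩
  have h2 : symbolFourier M' ξ ≤ symbolFourier M ξ + c := hc _
  have h3 : 0 ≤ symbolFourier M' ξ := h0 _
  rw [Real.norm_of_nonneg (mul_nonneg h3 (sq_nonneg _)), Pi.add_apply, ← add_mul]
  exact mul_le_mul_of_nonneg_right h2 (sq_nonneg _)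

theorem formEnergy_le_add {hM : Measurable M} {hM' : Measurable M'} {hV : AEMeasurable V} {c : ℝ}
    (hc : ∀ η, M' η ≤ M η + c) {ψ : L2Rd d} (hψ : ψ ∈ formDomain M V hM hV)
    (hψ' : ψ ∈ formDomain M' V hM' hV) :
    formEnergy M' V ψ ≤ formEnergy M V ψ + c * ‖ψ‖ ^ 2 := by
  have h1 : Integrable fun ξ => symbolFourier M ξ * ‖(𝓕 ψ : L2Rd d) ξ‖ ^ 2 := hψ.1
  have h1' : Integrable fun ξ => symbolFourier M' ξ * ‖(𝓕 ψ : L2Rd d) ξ‖ ^ 2 := hψ'.1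
  have h2 := (integrable_norm_sq_L2Rd (𝓕 ψ : L2Rd d)).const_mul c
  have h3 : ∫ ξ, symbolFourier M' ξ * ‖(𝓕 ψ : L2Rd d) ξ‖ ^ 2
      ≤ (∫ ξ, symbolFourier M ξ * ‖(𝓕 ψ : L2Rd d) ξ‖ ^ 2) + c * ‖ψ‖ ^ 2 := by
    rw [← Lp.norm_fourier_eq ψ, norm_sq_L2Rd, ← integral_const_mul, ← integral_add h1 h2]
    refine integral_mono h1' (h1.add h2) fun ξ => ?_
    have h4 : symbolFourier M' ξ ≤ symbolFourier M ξ + c := hc _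
    rw [← add_mul]
    exact mul_le_mul_of_nonneg_right h4 (sq_nonneg _)
  unfold formEnergy
  linarith

/-- Equality would force the Fourier transform of `ψ` to vanish almost everywhere. This makes the
monotonicity of the ground state energy strict. -/
theorem formEnergy_lt {hM : Measurable M} {hM' : Measurable M'} {hV : AEMeasurable V}
    (hlt : ∀ η, M' η < M η) {ψ : L2Rd d} (hψ0 : ψ ≠ 0) (hψ : ψ ∈ formDomain M V hM hV)
    (hψ' : ψ ∈ formDomain M' V hM' hV) : formEnergy M' V ψ < formEnergy M V ψ := by
  have h1 : Integrable fun ξ => symbolFourier M ξ * ‖(𝓕 ψ : L2Rd d) ξ‖ ^ 2 := hψ.1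
  have h1' : Integrable fun ξ => symbolFourier M' ξ * ‖(𝓕 ψ : L2Rd d) ξ‖ ^ 2 := hψ'.1
  have hpos : ∀ ξ, 0 < symbolFourier M ξ - symbolFourier M' ξ := fun ξ => sub_pos.2 (hlt _)
  have hnn : ∀ ξ, 0 ≤ symbolFourier M ξ * ‖(𝓕 ψ : L2Rd d) ξ‖ ^ 2
      - symbolFourier M' ξ * ‖(𝓕 ψ : L2Rd d) ξ‖ ^ 2 := fun ξ => by
    rw [← sub_mul]
    exact mul_nonneg (hpos ξ).le (sq_nonneg _)
  refine add_lt_add_left ?_ _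
  rw [← sub_pos, ← integral_sub h1 h1']
  refine lt_of_le_of_ne (integral_nonneg hnn) fun h0 => hψ0 ?_
  have h2 := (integral_eq_zero_iff_of_nonneg hnn (h1.sub h1')).1 h0.symm
  have h3 : (𝓕 ψ : L2Rd d) = 0 := by
    refine Lp.ext ?_
    filter_upwards [h2, Lp.coeFn_zero ℂ 2 (volume : Measure (Rd d))] with ξ hξ hz
    rw [hz, Pi.zero_apply]
    rw [Pi.zero_apply, ← sub_mul] at hξ
    exact norm_eq_zero.1 (pow_eq_zero_iff two_ne_zero |>.1
      ((mul_eq_zero.1 hξ).resolve_left (hpos ξ).ne'))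
  exact (map_eq_zero_iff _ (Lp.fourierTransformₗᵢ (Rd d) ℂ).injective).1 h3

theorem mem_formDomain_bcsSymbol {μ β : ℝ} (hβ : 0 < β) {hV : AEMeasurable V} {ψ : L2Rd d}
    (hψ : ψ ∈ formDomain (bcsSymbolInfty d μ) V (measurable_bcsSymbolInfty d μ) hV) :
    ψ ∈ formDomain (bcsSymbol d β μ) V (measurable_bcsSymbol d β μ) hV :=
  formDomain_mono _ _ hV (fun η => (bcsSymbolInfty_nonneg μ η).trans
    (bcsSymbolInfty_le_bcsSymbol hβ η)) (bcsSymbol_le hβ) hψ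

theorem mem_formDomain_bcsSymbolInfty {μ β : ℝ} (hβ : 0 < β) {hV : AEMeasurable V} {ψ : L2Rd d}
    (hψ : ψ ∈ formDomain (bcsSymbol d β μ) V (measurable_bcsSymbol d β μ) hV) :
    ψ ∈ formDomain (bcsSymbolInfty d μ) V (measurable_bcsSymbolInfty d μ) hV :=
  formDomain_mono (c := 0) _ _ hV (bcsSymbolInfty_nonneg μ)
    (fun η => by rw [add_zero]; exact bcsSymbolInfty_le_bcsSymbol hβ η) hψ

/-- At high temperature the form of `K_{β,μ}(p) + V` is nonnegative. -/
theorem exists_formEnergy_bcsSymbol_nonneg {μ : ℝ} (hV : AEMeasurable V)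
    (hc : IsRelFormCompact (bcsSymbolInfty d μ) V) :
    ∃ β : ℝ, 0 < β ∧ ∀ ψ ∈ formDomain (bcsSymbol d β μ) V (measurable_bcsSymbol d β μ) hV,
      0 ≤ formEnergy (bcsSymbol d β μ) V ψ := by
  have hV2 : AEMeasurable fun x => 2 * V x := hV.const_mul 2
  obtain ⟨c, hcE⟩ := exists_formEnergy_ge (measurable_bcsSymbolInfty d μ) hV2
    (bcsSymbolInfty_nonneg μ) hc.two_mul
  -- Here `2/β = |c| + 1`. Splitting `K_β` into halves, one at least `T/2` and one at least `(|c| +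
  -- 1)/2`, and using `T/2 + V ≥ -c/2`, the total is nonnegative.
  have hb : 0 < 2 / (|c| + 1) := by positivity
  refine ⟨2 / (|c| + 1), hb, fun ψ hψ => ?_⟩
  have hψT := mem_formDomain_bcsSymbolInfty hb hψ
  have h1 := hcE ψ (hc.two_mul.mem_formDomain _ hV2 (bcsSymbolInfty_nonneg μ) hψT.1)
  set K := symbolFourier (bcsSymbol d (2 / (|c| + 1)) μ) with hK
  have hiT : Integrable fun ξ => symbolFourier (bcsSymbolInfty d μ) ξ
      * ‖(𝓕 ψ : L2Rd d) ξ‖ ^ 2 := hψT.1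
  have hiK : Integrable fun ξ => K ξ * ‖(𝓕 ψ : L2Rd d) ξ‖ ^ 2 := hψ.1
  have hi := integrable_norm_sq_L2Rd (𝓕 ψ : L2Rd d)
  have h2 : ∫ ξ, symbolFourier (bcsSymbolInfty d μ) ξ * ‖(𝓕 ψ : L2Rd d) ξ‖ ^ 2
      ≤ ∫ ξ, K ξ * ‖(𝓕 ψ : L2Rd d) ξ‖ ^ 2 :=
    integral_mono hiT hiK fun ξ => mul_le_mul_of_nonneg_right
      (bcsSymbolInfty_le_bcsSymbol hb _) (sq_nonneg _)
  have h3 : (|c| + 1) * ‖ψ‖ ^ 2 ≤ ∫ ξ, K ξ * ‖(𝓕 ψ : L2Rd d) ξ‖ ^ 2 := by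
    rw [← Lp.norm_fourier_eq ψ, norm_sq_L2Rd, ← integral_const_mul]
    refine integral_mono (hi.const_mul _) hiK fun ξ => mul_le_mul_of_nonneg_right ?_ (sq_nonneg _)
    have h4 := two_div_le_bcsSymbol (μ := μ) hb ((2 * Real.pi) • ξ)
    have h5 : 2 / (2 / (|c| + 1)) = |c| + 1 := by field_simp
    rwa [h5] at h4
  have h6 : ∫ x, 2 * V x * ‖ψ x‖ ^ 2 = 2 * ∫ x, V x * ‖ψ x‖ ^ 2 := by
    simp only [mul_assoc, integral_const_mul]
  unfold formEnergy at h1 ⊢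
  rw [h6] at h1
  nlinarith [le_abs_self c, sq_nonneg ‖ψ‖]

end Comparison

/-! ### Ground states and the critical temperature. -/

theorem theorem3p10 (d : ℕ) (hd : 2 ≤ d) (μ : ℝ) (hμ : 0 < μ)
    (V : Rd d → ℝ) (hV : AEMeasurable V)
    (hV_compact : IsRelFormCompact (bcsSymbolInfty d μ) V)
    (hV_ne : ¬ ∀ᵐ x : Rd d, V x = 0)
    (hV_pos : ∫⁻ x : Rd d, ENNReal.ofReal (V x) ≠ ∞)
    (hV_int : ∫⁻ x : Rd d, ENNReal.ofReal (V x) ≤ ∫⁻ x : Rd d, ENNReal.ofReal (-V x)) :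
    -- the operator `|p² - μ| + V`
    ((∃ E : ℝ, E < 0 ∧ IsEigenvalue (bcsOperatorInfty μ V hV) E) ∧
      ((∀ᵐ x : Rd d, V x ≤ 0) →
        {E : ℝ | E < 0 ∧ IsEigenvalue (bcsOperatorInfty μ V hV) E}.Infinite)) ∧
    -- the operators `K_{β,μ}(p) + V`
    ((∀ β : ℝ, 0 < β →
      (∃ E : ℝ, E < 2 / β ∧ IsEigenvalue (bcsOperator β μ V hV) E) ∧
      ((∀ᵐ x : Rd d, V x ≤ 0) →
        {E : ℝ | E < 2 / β ∧ IsEigenvalue (bcsOperator β μ V hV) E}.Infinite) ∧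
      IsLeast (realSpectrum (bcsOperator β μ V hV)) (infSpectrum (bcsOperator β μ V hV)) ∧
      IsEigenvalue (bcsOperator β μ V hV) (infSpectrum (bcsOperator β μ V hV))) ∧
      StrictAntiOn (fun β : ℝ => infSpectrum (bcsOperator β μ V hV)) (Set.Ioi 0) ∧
      (∃ β₀ : ℝ, 0 < β₀ ∧ ∀ β : ℝ, β₀ ≤ β → infSpectrum (bcsOperator β μ V hV) < 0)) ∧
    -- the critical temperature
    (0 < betaCritical μ V hV ∧ betaCritical μ V hV < ∞ ∧
      0 < criticalTemperature μ V hV ∧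
      ∀ β : ℝ, 0 < β →
        (ENNReal.ofReal β < betaCritical μ V hV → 0 < infSpectrum (bcsOperator β μ V hV)) ∧
        (betaCritical μ V hV < ENNReal.ofReal β → infSpectrum (bcsOperator β μ V hV) < 0)) := by
  set T := bcsSymbolInfty d μ with hT
  have hTm : Measurable T := measurable_bcsSymbolInfty d μ
  have hT0 : ∀ η, 0 ≤ T η := bcsSymbolInfty_nonneg μ
  have hKm : ∀ β, Measurable (bcsSymbol d β μ) := fun β => measurable_bcsSymbol d β μ
  have hKc : ∀ β, 0 < β → IsRelFormCompact (bcsSymbol d β μ) V := fun β hβ =>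
    hV_compact.mono hTm (hKm β) hT0 (bcsSymbolInfty_le_bcsSymbol hβ)
  obtain ⟨ψ₀, hψ₀, hψ₀neg⟩ := exists_formEnergy_neg hd hμ hV hV_compact hV_ne hV_pos hV_int
  have hKle : ∀ β, 0 < β → ∀ ψ ∈ formDomain T V hTm hV,
      formEnergy (bcsSymbol d β μ) V ψ ≤ formEnergy T V ψ + 2 / β * ‖ψ‖ ^ 2 := fun β hβ ψ hψ =>
    formEnergy_le_add (bcsSymbol_le hβ) hψ (mem_formDomain_bcsSymbol hβ hψ)
  -- the ground state of `K_{β,μ}(p) + V`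
  have hground : ∀ β, 0 < β → infSpectrum (bcsOperator β μ V hV) < 2 / β ∧
      IsLeast (realSpectrum (bcsOperator β μ V hV)) (infSpectrum (bcsOperator β μ V hV)) ∧
      IsEigenvalue (bcsOperator β μ V hV) (infSpectrum (bcsOperator β μ V hV)) ∧
      (∀ ψ ∈ formDomain (bcsSymbol d β μ) V (hKm β) hV,
        infSpectrum (bcsOperator β μ V hV) * ‖ψ‖ ^ 2 ≤ formEnergy (bcsSymbol d β μ) V ψ) ∧
      ∃ ψ ∈ formDomain (bcsSymbol d β μ) V (hKm β) hV, ψ ≠ 0 ∧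
        formEnergy (bcsSymbol d β μ) V ψ = infSpectrum (bcsOperator β μ V hV) * ‖ψ‖ ^ 2 := by
    intro β hβ
    -- The loss `2/β ‖ψ₀‖²` in passing from `T` to `K_β` is exactly the threshold, so negative
    -- energy for `T + V` suffices at every `β`.
    obtain ⟨E, hE, hleast, h⟩ := exists_ground_state (hKm β) hV (by positivity : 0 ≤ 2 / β)
      (two_div_le_bcsSymbol hβ) (hKc β hβ)
      ⟨ψ₀, mem_formDomain_bcsSymbol hβ hψ₀, by linarith [hKle β hβ ψ₀ hψ₀]⟩
    have hinf : infSpectrum (bcsOperator β μ V hV) = E := hleast.csInf_eq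
    rw [hinf]
    exact ⟨hE, hleast, h⟩
  have hanti : StrictAntiOn (fun β : ℝ => infSpectrum (bcsOperator β μ V hV)) (Set.Ioi 0) := by
    intro β₁ hβ₁ β₂ hβ₂ h12
    obtain ⟨-, -, -, -, ψ, hψ, hψ0, hψE⟩ := hground β₁ hβ₁
    -- The ground state at `β₁` is a trial state at `β₂`, where its energy is strictly lower.
    have hψ₂ := mem_formDomain_bcsSymbol hβ₂ (mem_formDomain_bcsSymbolInfty hβ₁ hψ)
    have h1 := (hground β₂ hβ₂).2.2.2.1 ψ hψ₂
    have h2 := formEnergy_lt (fun η => bcsSymbol_strictAnti (μ := μ) hβ₁ h12 η) hψ0 hψ hψ₂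
    have h3 : 0 < ‖ψ‖ ^ 2 := pow_pos (norm_pos_iff.2 hψ0) 2
    refine lt_of_mul_lt_mul_right (a := ‖ψ‖ ^ 2) ?_ h3.le
    linarith
  have hlow : ∃ β₀ : ℝ, 0 < β₀ ∧ ∀ β : ℝ, β₀ ≤ β → infSpectrum (bcsOperator β μ V hV) < 0 := by
    set δ := -formEnergy T V ψ₀ with hδ
    have hδ0 : 0 < δ := neg_pos.2 hψ₀neg
    -- For such `β` the cost `2/β ‖ψ₀‖²` is smaller than the gain `δ`; the `+ 1` makes this strict.
    refine ⟨2 * (‖ψ₀‖ ^ 2 + 1) / δ, by positivity, fun β hβ => ?_⟩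
    have hβ0 : 0 < β := lt_of_lt_of_le (by positivity) hβ
    have h1 := (hground β hβ0).2.2.2.1 ψ₀ (mem_formDomain_bcsSymbol hβ0 hψ₀)
    have h2 := hKle β hβ0 ψ₀ hψ₀
    have h3 : 2 / β * ‖ψ₀‖ ^ 2 < δ := by
      rw [div_le_iff₀ hδ0] at hβ
      rw [div_mul_eq_mul_div, div_lt_iff₀ hβ0]
      linarith
    by_contra hcon
    have := mul_nonneg (not_lt.1 hcon) (sq_nonneg ‖ψ₀‖)
    linarith
  have hhigh : ∃ β : ℝ, 0 < β ∧ 0 ≤ infSpectrum (bcsOperator β μ V hV) := by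
    obtain ⟨β, hβ, hnn⟩ := exists_formEnergy_bcsSymbol_nonneg hV hV_compact
    obtain ⟨-, -, -, -, ψ, hψ, hψ0, hψE⟩ := hground β hβ
    refine ⟨β, hβ, ?_⟩
    have h1 := hnn ψ hψ
    rw [hψE] at h1
    exact nonneg_of_mul_nonneg_left h1 (pow_pos (norm_pos_iff.2 hψ0) 2)
  have hcr0 : 0 < betaCritical μ V hV := by
    obtain ⟨β, hβ, h⟩ := hhigh
    exact (ENNReal.ofReal_pos.2 hβ).trans_le (le_sSup ⟨β, ⟨hβ, h⟩, rfl⟩)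
  have hcrtop : betaCritical μ V hV < ∞ := by
    obtain ⟨β₀, -, h⟩ := hlow
    refine lt_of_le_of_lt (sSup_le ?_) (ENNReal.ofReal_lt_top (r := β₀))
    rintro _ ⟨β, ⟨-, hβ⟩, rfl⟩
    exact ENNReal.ofReal_le_ofReal (le_of_not_ge fun hle => absurd (h β hle) (not_lt.2 hβ))
  refine ⟨⟨?_, fun hVneg => ?_⟩, ⟨fun β hβ => ⟨?_, fun hVneg => ?_, (hground β hβ).2.1,
    (hground β hβ).2.2.1⟩, hanti, hlow⟩, hcr0, hcrtop, ENNReal.inv_pos.2 hcrtop.ne,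
    fun β hβ => ⟨fun hlt => ?_, fun hlt => ?_⟩⟩
  · obtain ⟨E, hE, -, h, -⟩ := exists_ground_state hTm hV le_rfl hT0 hV_compact
      ⟨ψ₀, hψ₀, by rw [zero_mul]; exact hψ₀neg⟩
    exact ⟨E, hE, h⟩
  · refine infinite_eigenvalues hTm hV le_rfl hT0 hV_compact fun U hU => ?_
    obtain ⟨ψ, hψ, hperp, hneg⟩ :=
      exists_formEnergy_neg_orthogonal hd hμ hV hV_compact hV_ne hVneg U
    exact ⟨ψ, hψ, hperp, by rw [zero_mul]; exact hneg⟩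
  · exact ⟨_, (hground β hβ).1, (hground β hβ).2.2.1⟩
  · refine infinite_eigenvalues (hKm β) hV (by positivity) (two_div_le_bcsSymbol hβ) (hKc β hβ)
      fun U hU => ?_
    obtain ⟨ψ, hψ, hperp, hneg⟩ :=
      exists_formEnergy_neg_orthogonal hd hμ hV hV_compact hV_ne hVneg U
    exact ⟨ψ, mem_formDomain_bcsSymbol hβ hψ, hperp, by linarith [hKle β hβ ψ hψ]⟩
  -- Some `β' > β` still has nonnegative ground state energy, and strict monotonicity turns this
  -- into positivity at `β`.
  · obtain ⟨_, ⟨β', ⟨hβ', h⟩, rfl⟩, hlt'⟩ := lt_sSup_iff.1 hlt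
    exact h.trans_lt (hanti hβ hβ' ((ENNReal.ofReal_lt_ofReal_iff hβ').1 hlt'))
  · by_contra hcon
    exact absurd hlt (not_lt.2 (le_sSup ⟨β, ⟨hβ, not_lt.1 hcon⟩, rfl⟩))
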